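/- **Setting.** Let $m>0$ and let $\eta=\mathrm{diag}(1,-1,-1,-1)$ be the Minkowski metric. Let $\mathcal P$ be the graded commutative complex algebra generated by the even fields $v_\mu$ ($\mu=0,\dots,3$), $\Phi$ and the odd fields $u,\tilde u$, together with all their derivatives $y_{;\mu_1\dots\mu_n}=d_{\mu_1}\cdots d_{\mu_n}y$ (symmetric in the indices), modulo the Klein–Gordon equations $\eta^{\mu\nu}d_\mu d_\nu y+m^2y=0$ and all their derivatives. Let $d_Q$ be the graded derivation of $\mathcal P$ that commutes with the $d_\mu$ and satisfies $$d_Qv_\mu=i\,d_\mu u,\qquad d_Q\Phi=i\,m\,u,\qquad d_Qu=0,\qquad d_Q\tilde u=-i\,(d_\mu v^\mu+m\Phi);$$ then $d_Q^2=0$. Put $Z_Q=\ker d_Q$, $B_Q=d_Q\mathcal P$, $H_Q=Z_Q/B_Q$. Let $$F_{\mu\nu;\rho_1\dots\rho_n}=d_{\rho_1}\cdots d_{\rho_n}(d_\mu v_\nu-d_\nu v_\mu)\ (n\ge0),\qquad g_{\mu_1\dots\mu_n}=\tfrac1n\sum_{l}v_{\mu_l;\mu_1\dots\hat\mu_l\dots\mu_n},\qquad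 \phi_{\mu_1\dots\mu_n}=d_{\mu_1}\cdots d_{\mu_n}\Phi-m\,g_{\mu_1\dots\mu_n}\ (n\ge1).$$ A traceless part of a tensor $T$ is a tensor $T^{(0)}$ all of whose $\eta$-contractions of two indices vanish and such that $T-T^{(0)}$ is a sum, over pairs of indices, of $\eta_{\mu_i\mu_j}$ times a tensor in the remaining indices. The canonical dimension of a monomial is the number of its factors plus the total number of derivatives. Let $\mathcal P^{(n)}\subset\mathcal P$ be the span of the monomials of dimension $\le n$, and put $Z_Q^{(n)}=Z_Q\cap\mathcal P^{(n)}$, $B_Q^{(n)}=d_Q\mathcal P^{(n-1)}$ (with $\mathcal P^{(-1)}=0$), $H_Q^{(n)}=Z_Q^{(n)}/B_Q^{(n)}$. **Theorem.** The tensors $F_{\mu\nu;\rho_1\dots\rho_n}$ ($n\ge 0$) and $\phi_{\mu_1\dots\mu_n}$ ($n\ge 1$) have unique traceless parts $F^{(0)}_{\mu\nu;\rho_1\dots\rho_n}$ and $\phi^{(0)}_{\mu_1\dots\mu_n}$. Let $\mathcal P_0\subset\mathcal P$ be the subalgebra generated by the components of these traceless parts. (1) Every $p\in Z_Q$ is of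 the form $p=p_0+d_Qq$ with $p_0\in\mathcal P_0$, $q\in\mathcal P$. (2) Let $\mathcal A$ be the algebra of polynomials in formal symbols $F^{(0)}_{\mu\nu;\rho_1\dots\rho_n}$ ($n\ge0$) and $\phi^{(0)}_{\mu_1\dots\mu_n}$ ($n\ge1$), modulo the relations saying that $F^{(0)}$ is antisymmetric in $\mu,\nu$, symmetric in the $\rho_l$ and traceless, that $\phi^{(0)}$ is symmetric and traceless, and modulo the Bianchi identities $F^{(0)}_{\mu\nu;\rho\tau_1\dots\tau_n}+F^{(0)}_{\nu\rho;\mu\tau_1\dots\tau_n}+F^{(0)}_{\rho\mu;\nu\tau_1\dots\tau_n}=0$. Sending symbols to the corresponding elements of $\mathcal P$ gives a well-defined injective algebra homomorphism $\Psi:\mathcal A\to\mathcal P$ with image $\mathcal P_0\subset Z_Q$, and $a\mapsto[\Psi(a)]$ is a linear isomorphism $\mathcal A\cong H_Q$. (3) For every $n\ge0$, every $p\in Z_Q^{(n)}$ is of the form $p=p_1+d_Qp_2$ with $p_1\in\mathcal P_0\cap\mathcal P^{(n)}$ (primary cocycle) and $p_2\in\mathcal P^{(n)}$ (so that $d_Qp_2\in\mathcal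 P^{(n)}$ is a secondary cocycle). Moreover, if $\mathcal A^{(n)}\subset\mathcal A$ is the span of the products of symbols of total dimension $\le n$, where $F^{(0)}_{\mu\nu;\rho_1\dots\rho_k}$ has dimension $k+2$ and $\phi^{(0)}_{\mu_1\dots\mu_k}$ has dimension $k+1$, then $(a,[s])\mapsto[\Psi(a)+s]$ is a linear isomorphism $$\mathcal A^{(n)}\oplus\bigl(\mathcal P^{(n)}\cap d_Q\mathcal P^{(n)}\bigr)/d_Q\mathcal P^{(n-1)}\;\cong\;H_Q^{(n)}.$$ -/

import Mathlib

namespace MassiveGauge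

/-! ## Fields and on-shell polynomials -/

/-- The basic fields: the covector field `v_μ`, the scalar `Φ` (Bose statistics), and the ghosts
`u`, `ũ` (Fermi statistics). -/
inductive Fld : Type
  | v (μ : Fin 4)
  | Phi
  | u
  | ut

/-- Grassmann parity (`0` for Bose, `1` for Fermi statistics). -/
def Fld.parity : Fld → ℕ
  | .v _ => 0
  | .Phi => 0
  | .u => 1
  | .ut => 1

/-- Jet variables `y_{α;μ₁…μₙ}`: a field with an (unordered) list of derivative indices. -/
abbrev Jet : Type := Fld × Multiset (Fin 4)

/-- Canonical dimension of a jet variable: one for the field, and one for each derivative. -/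
def Jet.dim (a : Jet) : ℕ := 1 + Multiset.card a.2

/-- The Minkowski metric `diag(1, -1, -1, -1)`. -/
def eta (μ ν : Fin 4) : ℂ := if μ = ν then (if μ = 0 then 1 else -1) else 0

/-- Graded commutativity of the jet variables, and the Klein-Gordon equation of mass `m`
with all its derivatives. -/
inductive Rel (m : ℝ) : FreeAlgebra ℂ Jet → FreeAlgebra ℂ Jet → Prop
  | comm (a b : Jet) :
      Rel m (FreeAlgebra.ι ℂ a * FreeAlgebra.ι ℂ b)
        ((-1 : ℂ) ^ (a.1.parity * b.1.parity) • (FreeAlgebra.ι ℂ b * FreeAlgebra.ι ℂ a))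
  | kleinGordon (α : Fld) (J : Multiset (Fin 4)) :
      Rel m (∑ μ, eta μ μ • FreeAlgebra.ι ℂ ((α, μ ::ₘ μ ::ₘ J) : Jet)
        + (m : ℂ) ^ 2 • FreeAlgebra.ι ℂ ((α, J) : Jet)) 0

/-- The graded commutative algebra `𝒫` of complex polynomials in the fields and their
derivatives, on the mass shell. -/
def Poly (m : ℝ) : Type := RingQuot (Rel m)

noncomputable instance (m : ℝ) : Ring (Poly m) := inferInstanceAs (Ring (RingQuot (Rel m)))

noncomputable instance (m : ℝ) : Algebra ℂ (Poly m) :=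
  inferInstanceAs (Algebra ℂ (RingQuot (Rel m)))

/-- The quotient map onto `𝒫`. -/
noncomputable def Poly.mk (m : ℝ) : FreeAlgebra ℂ Jet →ₐ[ℂ] Poly m :=
  RingQuot.mkAlgHom ℂ (Rel m)

theorem Poly.mk_surjective (m : ℝ) : Function.Surjective (Poly.mk m) :=
  RingQuot.mkAlgHom_surjective ℂ (Rel m)

theorem Poly.mk_rel (m : ℝ) {x y : FreeAlgebra ℂ Jet} (h : Rel m x y) :
    Poly.mk m x = Poly.mk m y :=
  RingQuot.mkAlgHom_rel ℂ h

/-- The algebra homomorphism on `𝒫` with prescribed values on the variables. -/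
noncomputable def Poly.lift {A : Type} [Semiring A] [Algebra ℂ A] (m : ℝ) (f : Jet → A)
    (h : ∀ ⦃x y⦄, Rel m x y → FreeAlgebra.lift ℂ f x = FreeAlgebra.lift ℂ f y) :
    Poly m →ₐ[ℂ] A :=
  RingQuot.liftAlgHom ℂ ⟨FreeAlgebra.lift ℂ f, h⟩

theorem Poly.lift_mk {A : Type} [Semiring A] [Algebra ℂ A] (m : ℝ) (f : Jet → A)
    (h : ∀ ⦃x y⦄, Rel m x y → FreeAlgebra.lift ℂ f x = FreeAlgebra.lift ℂ f y)
    (x : FreeAlgebra ℂ Jet) : Poly.lift m f h (Poly.mk m x) = FreeAlgebra.lift ℂ f x :=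
  RingQuot.liftAlgHom_mkAlgHom_apply ℂ _ _ _

/-- The variable `y_{α;J}` as an element of `𝒫`. -/
noncomputable def jet (m : ℝ) (a : Jet) : Poly m :=
  Poly.mk m (FreeAlgebra.ι ℂ a)

theorem jet_comm (m : ℝ) (a b : Jet) :
    jet m a * jet m b = (-1 : ℂ) ^ (a.1.parity * b.1.parity) • (jet m b * jet m a) := by
  have h := Poly.mk_rel m (Rel.comm a b)
  simpa [jet] using h

theorem jet_kleinGordon (m : ℝ) (α : Fld) (J : Multiset (Fin 4)) :
    ∑ μ, eta μ μ • jet m (α, μ ::ₘ μ ::ₘ J) + (m : ℂ) ^ 2 • jet m (α, J) = 0 := by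
  have h := Poly.mk_rel m (Rel.kleinGordon α J)
  simp only [map_add, map_sum, map_smul, map_zero] at h
  exact h

/-! ## The operator `d_Q` -/

theorem parity_aux (m : ℝ) ⦃x y : FreeAlgebra ℂ Jet⦄ (h : Rel m x y) :
    FreeAlgebra.lift ℂ (fun a : Jet => (-1 : ℂ) ^ a.1.parity • jet m a) x =
      FreeAlgebra.lift ℂ (fun a : Jet => (-1 : ℂ) ^ a.1.parity • jet m a) y := by
  induction h with
  | comm a b =>
    simp only [map_mul, map_smul, FreeAlgebra.lift_ι_apply, smul_mul_assoc, mul_smul_comm]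
    rw [jet_comm m a b]
    simp only [smul_smul]
    congr 1
    ring
  | kleinGordon α J =>
    have h := congrArg (fun z => (-1 : ℂ) ^ α.parity • z) (jet_kleinGordon m α J)
    simp only [smul_add, Finset.smul_sum, smul_zero] at h
    simp only [map_add, map_sum, map_smul, map_zero, FreeAlgebra.lift_ι_apply]
    rw [← h]
    congr 1
    · exact Finset.sum_congr rfl fun μ _ => smul_comm _ _ _
    · exact smul_comm _ _ _

/-- The parity automorphism of `𝒫`: it multiplies an element of ghost parity `ε` by `(-1)^ε`. -/
noncomputable def parityAut (m : ℝ) : Poly m →ₐ[ℂ] Poly m :=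
  Poly.lift m (fun a : Jet => (-1 : ℂ) ^ a.1.parity • jet m a) (parity_aux m)

theorem parityAut_jet (m : ℝ) (a : Jet) :
    parityAut m (jet m a) = (-1 : ℂ) ^ a.1.parity • jet m a := by
  rw [parityAut]
  nth_rewrite 1 [jet]
  rw [Poly.lift_mk, FreeAlgebra.lift_ι_apply]

/-- The variable `C = ∂_μ v^μ + m Φ` and its derivatives. -/
noncomputable def Cjet (m : ℝ) (J : Multiset (Fin 4)) : Poly m :=
  ∑ μ, eta μ μ • jet m (.v μ, μ ::ₘ J) + (m : ℂ) • jet m (.Phi, J)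

/-- `d_Q` on the variables, with `d_Q` commuting with the derivatives:
`d_Q v_μ = i ∂_μ u`, `d_Q Φ = i m u`, `d_Q u = 0`, `d_Q ũ = -i C`. -/
noncomputable def dQGen (m : ℝ) : Jet → Poly m
  | (.v μ, J) => Complex.I • jet m (.u, μ ::ₘ J)
  | (.Phi, J) => (Complex.I * (m : ℂ)) • jet m (.u, J)
  | (.u, _) => 0
  | (.ut, J) => (-Complex.I) • Cjet m J

theorem Cjet_comm (m : ℝ) (J : Multiset (Fin 4)) (b : Jet) :
    Cjet m J * jet m b = jet m b * Cjet m J := by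
  have h1 : ∀ μ K, jet m (.v μ, K) * jet m b = jet m b * jet m (.v μ, K) := fun μ K => by
    simpa [Fld.parity] using jet_comm m (.v μ, K) b
  have h2 : ∀ K, jet m (.Phi, K) * jet m b = jet m b * jet m (.Phi, K) := fun K => by
    simpa [Fld.parity] using jet_comm m (.Phi, K) b
  simp only [Cjet, add_mul, mul_add, Finset.sum_mul, Finset.mul_sum, smul_mul_assoc,
    mul_smul_comm, h1, h2]

theorem dQGen_comm (m : ℝ) (a b : Jet) :
    dQGen m a * jet m b = (-1 : ℂ) ^ ((a.1.parity + 1) * b.1.parity) • (jet m b * dQGen m a) := by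
  obtain ⟨α, J⟩ := a
  have hu : ∀ K, jet m (.u, K) * jet m b = (-1 : ℂ) ^ b.1.parity • (jet m b * jet m (.u, K)) :=
    fun K => by simpa [Fld.parity] using jet_comm m (.u, K) b
  cases α with
  | v μ =>
    simp only [dQGen, Fld.parity, smul_mul_assoc, mul_smul_comm, hu, zero_add, one_mul]
    exact smul_comm _ _ _
  | Phi =>
    simp only [dQGen, Fld.parity, smul_mul_assoc, mul_smul_comm, hu, zero_add, one_mul]
    exact smul_comm _ _ _
  | u => simp [dQGen]
  | ut =>
    have : (-1 : ℂ) ^ ((1 + 1) * b.1.parity) = 1 := by rw [pow_mul]; norm_num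
    change (-Complex.I • Cjet m J) * jet m b =
      (-1 : ℂ) ^ ((1 + 1) * b.1.parity) • (jet m b * (-Complex.I • Cjet m J))
    rw [this, one_smul, smul_mul_assoc, mul_smul_comm, Cjet_comm]

theorem Cjet_kleinGordon (m : ℝ) (J : Multiset (Fin 4)) :
    ∑ μ, eta μ μ • Cjet m (μ ::ₘ μ ::ₘ J) + (m : ℂ) ^ 2 • Cjet m J = 0 := by
  have h1 : ∑ ν, eta ν ν • (∑ μ, eta μ μ • jet m (.v ν, μ ::ₘ μ ::ₘ ν ::ₘ J)
      + (m : ℂ) ^ 2 • jet m (.v ν, ν ::ₘ J)) = 0 :=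
    Finset.sum_eq_zero fun ν _ => by rw [jet_kleinGordon, smul_zero]
  have h2 := congrArg (fun z => (m : ℂ) • z) (jet_kleinGordon m .Phi J)
  simp only [smul_zero] at h2
  rw [← add_zero (0 : Poly m)]
  nth_rewrite 1 [← h1]
  rw [← h2]
  have h3 : ∀ μ ν : Fin 4, ν ::ₘ μ ::ₘ μ ::ₘ J = μ ::ₘ μ ::ₘ ν ::ₘ J := fun μ ν => by
    rw [Multiset.cons_swap ν μ, Multiset.cons_swap ν μ]
  simp only [Cjet, smul_add, Finset.smul_sum, Finset.sum_add_distrib, h3]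
  rw [Finset.sum_comm]
  simp only [smul_smul, mul_comm]
  abel

theorem dQGen_kleinGordon (m : ℝ) (α : Fld) (J : Multiset (Fin 4)) :
    ∑ μ, eta μ μ • dQGen m (α, μ ::ₘ μ ::ₘ J) + (m : ℂ) ^ 2 • dQGen m (α, J) = 0 := by
  have key : ∀ (c : ℂ) (f : Fin 4 → Poly m) (g : Poly m),
      ∑ μ, eta μ μ • f μ + (m : ℂ) ^ 2 • g = 0 →
      ∑ μ, eta μ μ • c • f μ + (m : ℂ) ^ 2 • c • g = 0 := fun c f g h => by
    simp only [smul_comm _ c, ← Finset.smul_sum, ← smul_add, h, smul_zero]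
  cases α with
  | v ν =>
    have h3 : ∀ μ : Fin 4, ν ::ₘ μ ::ₘ μ ::ₘ J = μ ::ₘ μ ::ₘ ν ::ₘ J := fun μ => by
      rw [Multiset.cons_swap ν μ, Multiset.cons_swap ν μ]
    simp only [dQGen, h3]
    exact key _ _ _ (jet_kleinGordon m .u (ν ::ₘ J))
  | Phi => exact key _ _ _ (jet_kleinGordon m .u J)
  | u => simp [dQGen]
  | ut => exact key _ _ _ (Cjet_kleinGordon m J)

/-- `p ↦ [[parity p, d_Q p], [0, p]]` is multiplicative exactly when `d_Q` is a graded
derivation; this is its value on the variables. -/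
noncomputable def dQMat (m : ℝ) (a : Jet) : Matrix (Fin 2) (Fin 2) (Poly m) :=
  !![(-1 : ℂ) ^ a.1.parity • jet m a, dQGen m a; 0, jet m a]

theorem dQMat_rel (m : ℝ) ⦃x y : FreeAlgebra ℂ Jet⦄ (h : Rel m x y) :
    FreeAlgebra.lift ℂ (dQMat m) x = FreeAlgebra.lift ℂ (dQMat m) y := by
  induction h with
  | comm a b =>
    have e1 := jet_comm m a b
    have e2 := dQGen_comm m a b
    have e3 := dQGen_comm m b a
    have e4 : (-1 : ℂ) ^ a.1.parity * (-1 : ℂ) ^ a.1.parity = 1 := by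
      rw [← mul_pow]; norm_num
    have e5 : (-1 : ℂ) ^ (a.1.parity * b.1.parity) * (-1 : ℂ) ^ (a.1.parity * b.1.parity) = 1 := by
      rw [← mul_pow]; norm_num
    simp only [map_mul, map_smul, FreeAlgebra.lift_ι_apply, dQMat, Matrix.mul_fin_two]
    ext i j
    fin_cases i <;> fin_cases j
    · simp [e1, smul_smul]
      congr 1
      ring
    · simp [e2, e3, smul_smul]
      rw [add_comm]
      congr 2
      · ring
      · rw [add_mul, one_mul, pow_add, mul_comm b.1.parity, ← mul_assoc, e5, one_mul]
    · simp
    · simp [e1]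
  | kleinGordon α J =>
    have k1 := jet_kleinGordon m α J
    have k2 := dQGen_kleinGordon m α J
    simp only [map_add, map_sum, map_smul, map_zero, FreeAlgebra.lift_ι_apply, dQMat]
    ext i j
    fin_cases i <;> fin_cases j
    · have k3 := congrArg (fun z => (-1 : ℂ) ^ α.parity • z) k1
      simp only [smul_add, Finset.smul_sum, smul_zero, smul_comm ((-1 : ℂ) ^ α.parity)] at k3
      simpa [Matrix.sum_apply] using k3
    · simpa [Matrix.sum_apply] using k2
    · simp [Matrix.sum_apply]
    · simpa [Matrix.sum_apply] using k1

/-- The algebra homomorphism `p ↦ [[parity p, d_Q p], [0, p]]`. -/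
noncomputable def dQHom (m : ℝ) : Poly m →ₐ[ℂ] Matrix (Fin 2) (Fin 2) (Poly m) :=
  Poly.lift m (dQMat m) (dQMat_rel m)

/-- The operator `d_Q`: the graded derivation of `𝒫` with the values `dQGen` on the variables
(see `dQ_jet` and `dQ_mul`). -/
noncomputable def dQ (m : ℝ) : Poly m →ₗ[ℂ] Poly m :=
  Matrix.entryLinearMap ℂ (Poly m) 0 1 ∘ₗ (dQHom m).toLinearMap

theorem dQHom_jet (m : ℝ) (a : Jet) : dQHom m (jet m a) = dQMat m a := by
  rw [dQHom, jet, Poly.lift_mk, FreeAlgebra.lift_ι_apply]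

theorem dQ_jet (m : ℝ) (a : Jet) : dQ m (jet m a) = dQGen m a := by
  simp [dQ, dQHom_jet, dQMat]

theorem poly_induction (m : ℝ) {P : Poly m → Prop} (h1 : ∀ c : ℂ, P (algebraMap ℂ _ c))
    (hj : ∀ a, P (jet m a)) (hm : ∀ p q, P p → P q → P (p * q))
    (ha : ∀ p q, P p → P q → P (p + q)) (p : Poly m) : P p := by
  obtain ⟨x, rfl⟩ := Poly.mk_surjective m p
  induction x using FreeAlgebra.induction with
  | grade0 r => simpa using h1 r
  | grade1 a => exact hj a
  | mul a b h h' => rw [map_mul]; exact hm _ _ h h'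
  | add a b h h' => rw [map_add]; exact ha _ _ h h'

theorem dQHom_apply (m : ℝ) (p : Poly m) :
    dQHom m p = !![parityAut m p, dQ m p; 0, p] := by
  have h : dQHom m p 0 0 = parityAut m p ∧ dQHom m p 1 0 = 0 ∧ dQHom m p 1 1 = p := by
    induction p using poly_induction m with
    | h1 c => simp [Matrix.algebraMap_matrix_apply]
    | hj a => simp [dQHom_jet, dQMat, parityAut_jet]
    | hm p q hp hq =>
      obtain ⟨h1, h2, h3⟩ := hp
      obtain ⟨k1, k2, k3⟩ := hq
      simp [Matrix.mul_apply, h1, h2, h3, k1, k2, k3]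
    | ha p q hp hq =>
      obtain ⟨h1, h2, h3⟩ := hp
      obtain ⟨k1, k2, k3⟩ := hq
      simp [h1, h2, h3, k1, k2, k3]
  ext i j
  fin_cases i <;> fin_cases j
  · exact h.1
  · rfl
  · exact h.2.1
  · exact h.2.2

theorem dQ_mul (m : ℝ) (p q : Poly m) :
    dQ m (p * q) = dQ m p * q + parityAut m p * dQ m q := by
  have h := congrFun (congrFun (map_mul (dQHom m) p q) 0) 1
  rw [dQHom_apply, dQHom_apply, dQHom_apply, Matrix.mul_fin_two] at h
  simpa [add_comm] using h

theorem dQ_algebraMap (m : ℝ) (c : ℂ) : dQ m (algebraMap ℂ _ c) = 0 := by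
  simp [dQ, Matrix.algebraMap_matrix_apply]

theorem dQ_Cjet (m : ℝ) (J : Multiset (Fin 4)) : dQ m (Cjet m J) = 0 := by
  have h := congrArg (fun z => Complex.I • z) (jet_kleinGordon m .u J)
  simp only [smul_zero, smul_add, Finset.smul_sum] at h
  rw [← h]
  simp only [Cjet, map_add, map_sum, map_smul, dQ_jet, dQGen, smul_smul]
  congr 1
  · exact Finset.sum_congr rfl fun μ _ => by rw [mul_comm]
  · congr 1; ring

theorem dQ_dQ (m : ℝ) (p : Poly m) : dQ m (dQ m p) = 0 := by
  have h : dQ m (dQ m p) = 0 ∧ dQ m (parityAut m p) = - parityAut m (dQ m p) := by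
    induction p using poly_induction m with
    | h1 c => simp [dQ_algebraMap]
    | hj a =>
      have hC : ∀ J, parityAut m (Cjet m J) = Cjet m J := fun J => by
        simp only [Cjet, map_add, map_sum, map_smul, parityAut_jet, Fld.parity, pow_zero, one_smul]
      obtain ⟨α, J⟩ := a
      cases α <;>
        simp [dQ_jet, dQGen, parityAut_jet, Fld.parity, dQ_Cjet, hC]
    | hm p q hp hq =>
      have hpp : ∀ x : Poly m, parityAut m (parityAut m x) = x := fun x => by
        induction x using poly_induction m with
        | h1 c => simp
        | hj a =>
          have : (-1 : ℂ) ^ a.1.parity * (-1 : ℂ) ^ a.1.parity = 1 := by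
            rw [← mul_pow]; norm_num
          simp [parityAut_jet, smul_smul, this]
        | hm p q hp hq => simp [hp, hq]
        | ha p q hp hq => simp [hp, hq]
      constructor
      · simp [dQ_mul, hp.1, hq.1, hp.2]
      · simp only [dQ_mul, map_mul, map_add, hp.2, hq.2, hpp]
        noncomm_ring
    | ha p q hp hq => simp [hp.1, hq.1, hp.2, hq.2, add_comm]
  exact h.1

/-! ## Tensors and their traceless parts -/

/-- A tensor of rank `k` on Minkowski space (lower indices) with entries in `𝒫`. -/
abbrev Tensor (m : ℝ) (k : ℕ) : Type := (Fin k → Fin 4) → Poly m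

/-- All contractions of two indices with the Minkowski metric vanish. -/
def IsTraceless {m : ℝ} {k : ℕ} (T : Tensor m k) : Prop :=
  ∀ (I : Fin k → Fin 4) (i j : Fin k), i ≠ j →
    ∑ μ, eta μ μ • T (Function.update (Function.update I i μ) j μ) = 0

/-- `T₀` is the traceless part of `T`: it is traceless, and `T - T₀` is a sum over pairs `i < j`
of `η_{μ_i μ_j}` times a tensor `S i j` in the remaining indices. -/
def IsTracelessPart {m : ℝ} {k : ℕ} (T T₀ : Tensor m k) : Prop :=
  IsTraceless T₀ ∧
  ∃ S : Fin k → Fin k → Tensor m k,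
    (∀ i j I μ ν, S i j (Function.update (Function.update I i μ) j ν) = S i j I) ∧
    ∀ I, T I - T₀ I =
      ∑ i, ∑ j, if i < j then eta (I i) (I j) • S i j I else 0

open Classical in
/-- The traceless part of a tensor (junk value `0` if there were none). -/
noncomputable def tracelessPart {m : ℝ} {k : ℕ} (T : Tensor m k) : Tensor m k :=
  if h : ∃ T₀, IsTracelessPart T T₀ then h.choose else 0

/-- The list of indices `μ₁, …, μ_k` as a multiset of derivative indices. -/
def idx {k : ℕ} (I : Fin k → Fin 4) : Multiset (Fin 4) := Finset.univ.val.map I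

/-- The tensor `F_{μν;ρ₁…ρₙ}`, where `F_{μν} = ∂_μ v_ν - ∂_ν v_μ`. -/
noncomputable def fieldStrength (m : ℝ) (n : ℕ) : Tensor m (n + 2) := fun I =>
  let ρ := idx fun l : Fin n => I l.succ.succ
  jet m (.v (I 1), I 0 ::ₘ ρ) - jet m (.v (I 0), I 1 ::ₘ ρ)

/-- `g_{μ₁…μₙ} = (1/n) ∑_l v_{μ_l;μ₁…μ̂_l…μₙ}`, the symmetric part of `v_{μ₁;μ₂…μₙ}`. -/
noncomputable def gTensor (m : ℝ) (n : ℕ) : Tensor m n := fun I =>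
  (n : ℂ)⁻¹ • ∑ l, jet m (.v (I l), (Finset.univ.erase l).val.map I)

/-- `φ_{μ₁…μₙ} = ∂_{μ₁}…∂_{μₙ} Φ - m g_{μ₁…μₙ}`, used for `n ≥ 1`. -/
noncomputable def phiTensor (m : ℝ) (n : ℕ) : Tensor m n := fun I =>
  jet m (.Phi, idx I) - (m : ℂ) • gTensor m n I

/-! ## The space `𝒫₀` and its formal counterpart -/

/-- Symbols for the components of `F⁽⁰⁾_{μν;ρ₁…ρₙ}` (`n ≥ 0`) and of `φ⁽⁰⁾_{μ₁…μₙ₊₁}`. -/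
inductive Sym0 : Type
  | F (n : ℕ) (I : Fin (n + 2) → Fin 4)
  | phi (n : ℕ) (I : Fin (n + 1) → Fin 4)

/-- Canonical dimension of the symbols; both kinds contain `n + 1` derivatives of a field. -/
def Sym0.dim : Sym0 → ℕ
  | .F n _ => n + 2
  | .phi n _ => n + 2

/-- The element of `𝒫` denoted by a symbol. -/
noncomputable def Sym0.val (m : ℝ) : Sym0 → Poly m
  | .F n I => tracelessPart (fieldStrength m n) I
  | .phi n I => tracelessPart (phiTensor m (n + 1)) I

/-- `𝒫₀`: the polynomials in the components of the tensors `F⁽⁰⁾` and `φ⁽⁰⁾`. -/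
noncomputable def P0 (m : ℝ) : Subalgebra ℂ (Poly m) :=
  Algebra.adjoin ℂ (Set.range (Sym0.val m))

/-- The index symmetries and tracelessness which make the symbols components of traceless
tensors: antisymmetry in `μ, ν`, symmetry in the `ρ`'s, symmetry of `φ`, vanishing traces. -/
inductive TensorRel : MvPolynomial Sym0 ℂ → Prop
  | F_antisymm (n : ℕ) (I : Fin (n + 2) → Fin 4) :
      TensorRel (MvPolynomial.X (.F n I) + MvPolynomial.X (.F n (I ∘ Equiv.swap 0 1)))
  | F_symm (n : ℕ) (I : Fin (n + 2) → Fin 4) (i j : Fin n) :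
      TensorRel (MvPolynomial.X (.F n I) -
        MvPolynomial.X (.F n (I ∘ Equiv.swap i.succ.succ j.succ.succ)))
  | F_trace (n : ℕ) (I : Fin (n + 2) → Fin 4) (i j : Fin (n + 2)) (h : i ≠ j) :
      TensorRel (∑ μ, eta μ μ •
        MvPolynomial.X (.F n (Function.update (Function.update I i μ) j μ)))
  | phi_symm (n : ℕ) (I : Fin (n + 1) → Fin 4) (i j : Fin (n + 1)) :
      TensorRel (MvPolynomial.X (.phi n I) - MvPolynomial.X (.phi n (I ∘ Equiv.swap i j)))
  | phi_trace (n : ℕ) (I : Fin (n + 1) → Fin 4) (i j : Fin (n + 1)) (h : i ≠ j) :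
      TensorRel (∑ μ, eta μ μ •
        MvPolynomial.X (.phi n (Function.update (Function.update I i μ) j μ)))

/-- The Bianchi identities `F_{μν;ρτ} + F_{νρ;μτ} + F_{ρμ;ντ} = 0`, with `τ = τ₁…τₙ`. -/
inductive BianchiRel : MvPolynomial Sym0 ℂ → Prop
  | mk (n : ℕ) (μ ν ρ : Fin 4) (τ : Fin n → Fin 4) :
      BianchiRel
        (MvPolynomial.X (.F (n + 1) (Matrix.vecCons μ (Matrix.vecCons ν (Matrix.vecCons ρ τ)))) +
        MvPolynomial.X (.F (n + 1) (Matrix.vecCons ν (Matrix.vecCons ρ (Matrix.vecCons μ τ)))) +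
        MvPolynomial.X (.F (n + 1) (Matrix.vecCons ρ (Matrix.vecCons μ (Matrix.vecCons ν τ)))))

/-- The ideal generated by the tensor relations and the Bianchi identities. -/
noncomputable def bianchiIdeal : Ideal (MvPolynomial Sym0 ℂ) :=
  Ideal.span {f | TensorRel f} ⊔ Ideal.span {f | BianchiRel f}

/-- Polynomials in traceless tensors `F⁽⁰⁾`, `φ⁽⁰⁾`, modulo the Bianchi identities. -/
abbrev FormalP0 : Type := MvPolynomial Sym0 ℂ ⧸ bianchiIdeal

/-- The class of a symbol. -/
noncomputable def Sym0.cls (s : Sym0) : FormalP0 :=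
  Ideal.Quotient.mk bianchiIdeal (MvPolynomial.X s)

/-! ## Filtration by canonical dimension, and the cohomology spaces -/

/-- The span of the monomials of total weight `≤ n` in generators `gen` with weights `w`. -/
def weightLE {G A : Type} [Semiring A] [Algebra ℂ A] (gen : G → A) (w : G → ℕ) (n : ℤ) :
    Submodule ℂ A :=
  Submodule.span ℂ {a | ∃ L : List G, ((L.map w).sum : ℤ) ≤ n ∧ a = (L.map gen).prod}

/-- `𝒫⁽ⁿ⁾`: the polynomials of canonical dimension `≤ n`. -/
noncomputable def PolyLE (m : ℝ) (n : ℤ) : Submodule ℂ (Poly m) := weightLE (jet m) Jet.dim n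

/-- Formal polynomials of canonical dimension `≤ n`, modulo the Bianchi identities. -/
noncomputable def FormalP0LE (n : ℤ) : Submodule ℂ FormalP0 := weightLE Sym0.cls Sym0.dim n

/-- The cocycles `Z_Q`. -/
noncomputable def ZQ (m : ℝ) : Submodule ℂ (Poly m) := LinearMap.ker (dQ m)

/-- The coboundaries `B_Q`. -/
noncomputable def BQ (m : ℝ) : Submodule ℂ (Poly m) := LinearMap.range (dQ m)

/-- The cohomology space `H_Q = Z_Q / B_Q`. -/
abbrev HQ (m : ℝ) : Type := ZQ m ⧸ (BQ m).submoduleOf (ZQ m)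

/-- The cocycles `Z_Q⁽ⁿ⁾` in `𝒫⁽ⁿ⁾`. -/
noncomputable def ZQLE (m : ℝ) (n : ℤ) : Submodule ℂ (Poly m) := ZQ m ⊓ PolyLE m n

/-- The coboundaries `B_Q⁽ⁿ⁾ = d_Q 𝒫⁽ⁿ⁻¹⁾`. -/
noncomputable def BQLE (m : ℝ) (n : ℤ) : Submodule ℂ (Poly m) := (PolyLE m (n - 1)).map (dQ m)

/-- The cohomology space `H_Q⁽ⁿ⁾ = Z_Q⁽ⁿ⁾ / B_Q⁽ⁿ⁾`. -/
abbrev HQLE (m : ℝ) (n : ℤ) : Type := ZQLE m n ⧸ (BQLE m n).submoduleOf (ZQLE m n)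

/-- The secondary cocycles: the elements of `𝒫⁽ⁿ⁾` of the form `d_Q p₂` with `p₂ ∈ 𝒫⁽ⁿ⁾`. -/
noncomputable def SQLE (m : ℝ) (n : ℤ) : Submodule ℂ (Poly m) :=
  PolyLE m n ⊓ (PolyLE m n).map (dQ m)

end MassiveGauge

/-! The proof rests on two algebra maps and one contracting homotopy.

The map Ψ is `ofFormal`. The symbols go to even elements, which are central in 𝒫, and the relations
survive because the projection `tlProj` onto traceless tensors is linear and commutes with
permutations of the indices. All values are cocycles, since d_Q kills F and φ before the traces are
removed.

Injectivity, even modulo coboundaries, comes from a map `toFormal` in the other direction. It kills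
u, ũ and C = ∂·v + mΦ, hence every coboundary (`toFormal_dQ`). Up to lower order, v must be sent to
a tensor with curl F and divergence -mφ. `vSymbol` is such a tensor; it solves the massless
equation, and `kgExtend` restores the mass terms. The image of Φ is then forced by C ↦ 0. The
composite of Ψ with `toFormal` is the identity up to terms of smaller `Sym0.weight`
(`toFormal_ofFormal_mem`), so it is injective.

Surjectivity uses a linear change of variables to generators W (the traceless parts), C, G, U = u
and T = ũ, with d_Q W = 0, d_Q T = -iC and d_Q G = iU. They span the jet variables dimension by
dimension (`jv_mem_genLE`). The odd derivation h with C ↦ iT, U ↦ -iG and zero on the other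
generators makes D = d_Q h + h d_Q a derivation, and D multiplies a product of generators by its
number of factors other than W. The finite product of the operators 1 - D/j kills all products that
contain such a factor, and it changes a cocycle only by a coboundary. What remains is a polynomial
in the W's. The generators need not be independent: only their span and the existence of h on the
on-shell space are used.

h and D preserve 𝒫⁽ⁿ⁾, so the argument respects the dimension. Since d_Q itself may raise the
dimension, the primitive obtained lies in 𝒫⁽ⁿ⁾ and not always in 𝒫⁽ⁿ⁻¹⁾; this is the origin of the
secondary cocycles. -/

namespace MassiveGauge

/-! ## Projection onto traceless tensors -/

section Traceless

variable {M N : Type} [AddCommGroup M] [Module ℂ M] [AddCommGroup N] [Module ℂ N] {k : ℕ}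

/-- All contractions of two indices vanish, for tensors with entries in a vector space. -/
def Traceless (T : (Fin k → Fin 4) → M) : Prop :=
  ∀ (I : Fin k → Fin 4) (i j : Fin k), i ≠ j →
    ∑ μ, eta μ μ • T (Function.update (Function.update I i μ) j μ) = 0

/-- Sums over pairs of indices of the metric times a tensor in the remaining indices. -/
def TraceForm (T : (Fin k → Fin 4) → M) : Prop :=
  ∃ S : Fin k → Fin k → (Fin k → Fin 4) → M,
    (∀ i j I μ ν, S i j (Function.update (Function.update I i μ) j ν) = S i j I) ∧
    ∀ I, T I = ∑ i, ∑ j, if i < j then eta (I i) (I j) • S i j I else 0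

/-! ### Traceless tensors and trace forms as orthogonal complements -/

theorem eta_of_ne {μ ν : Fin 4} (h : μ ≠ ν) : eta μ ν = 0 := if_neg h

theorem sum_eta_smul (μ : Fin 4) (f : Fin 4 → M) :
    ∑ ν, eta μ ν • f ν = eta μ μ • f μ := by
  rw [Finset.sum_eq_single μ]
  · intro ν _ h
    rw [eta_of_ne h.symm, zero_smul]
  · simp

theorem conj_eta (μ ν : Fin 4) : (starRingEnd ℂ) (eta μ ν) = eta μ ν := by
  unfold eta
  split_ifs <;> simp

/-- Exchanging the i-th index of I with μ is an involution on the pairs (I, μ), so overwriting an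
index by a free one only produces the factor 4. -/
theorem sum_update (g : (Fin k → Fin 4) → ℂ) (i : Fin k) :
    ∑ I, ∑ μ, g (Function.update I i μ) = 4 * ∑ I, g I := by
  have h : ∑ p : (Fin k → Fin 4) × Fin 4, g (Function.update p.1 i p.2) =
      ∑ p : (Fin k → Fin 4) × Fin 4, g p.1 := by
    refine Finset.sum_nbij' (fun p => (Function.update p.1 i p.2, p.1 i))
      (fun p => (Function.update p.1 i p.2, p.1 i)) ?_ ?_ ?_ ?_ ?_ <;> simp
  rw [Fintype.sum_prod_type, Fintype.sum_prod_type] at h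
  rw [h, Finset.mul_sum]
  simp

/-- If the indices i and j are summed first, S is constant and the metric turns the inner sum into a
contraction of T. -/
theorem Traceless.sum_eta_mul {T : (Fin k → Fin 4) → ℂ} (hT : Traceless T) {i j : Fin k}
    (hij : i ≠ j) {S : (Fin k → Fin 4) → ℂ}
    (hS : ∀ I μ ν, S (Function.update (Function.update I i μ) j ν) = S I) :
    ∑ I, eta (I i) (I j) * S I * T I = 0 := by
  obtain ⟨G, hG⟩ : ∃ G : (Fin k → Fin 4) → ℂ, ∀ I, G I = eta (I i) (I j) * S I * T I :=
    ⟨_, fun _ => rfl⟩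
  have h := sum_update (fun I => ∑ ν, G (Function.update I j ν)) i
  rw [sum_update] at h
  simp only [hG] at h
  have h2 : ∀ I, ∑ μ, ∑ ν, eta ((Function.update (Function.update I i μ) j ν) i)
      ((Function.update (Function.update I i μ) j ν) j) *
      S (Function.update (Function.update I i μ) j ν) *
      T (Function.update (Function.update I i μ) j ν) = 0 := fun I => by
    simp only [hS, Function.update_self, Function.update_of_ne hij]
    have h3 : ∀ μ, ∑ ν, eta μ ν * S I * T (Function.update (Function.update I i μ) j ν) =
        S I * (eta μ μ • T (Function.update (Function.update I i μ) j μ)) := fun μ => by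
      rw [← sum_eta_smul μ fun ν => T (Function.update (Function.update I i μ) j ν),
        Finset.mul_sum]
      refine Finset.sum_congr rfl fun ν _ => ?_
      rw [smul_eq_mul]; ring
    simp only [h3, ← Finset.mul_sum, hT I i j hij, mul_zero]
  simp only [h2, Finset.sum_const_zero] at h
  -- Two free indices were inserted, each costing a factor 4.
  linear_combination (-1 / 16 : ℂ) * h

theorem TraceForm.sum_mul {D : (Fin k → Fin 4) → ℂ} (hD : TraceForm D)
    {T : (Fin k → Fin 4) → ℂ} (hT : Traceless T) : ∑ I, D I * T I = 0 := by
  obtain ⟨S, hS, hD⟩ := hD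
  simp only [hD, Finset.sum_mul]
  rw [Finset.sum_comm]
  refine Finset.sum_eq_zero fun i _ => ?_
  rw [Finset.sum_comm]
  refine Finset.sum_eq_zero fun j _ => ?_
  by_cases h : i < j
  · simpa [h] using hT.sum_eta_mul h.ne (hS i j)
  · simp [h]

theorem Traceless.conj {T : (Fin k → Fin 4) → ℂ} (hT : Traceless T) :
    Traceless fun I => (starRingEnd ℂ) (T I) := fun I i j hij => by
  have h := congrArg (starRingEnd ℂ) (hT I i j hij)
  simpa [map_sum, conj_eta] using h

theorem Traceless.map {T : (Fin k → Fin 4) → M} (hT : Traceless T) (f : M →ₗ[ℂ] N) :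
    Traceless fun I => f (T I) := fun I i j hij => by
  have h := congrArg f (hT I i j hij)
  simpa [map_sum] using h

theorem TraceForm.map {T : (Fin k → Fin 4) → M} (hT : TraceForm T) (f : M →ₗ[ℂ] N) :
    TraceForm fun I => f (T I) := by
  obtain ⟨S, hS, hD⟩ := hT
  refine ⟨fun i j I => f (S i j I), fun i j I μ ν => by simp only [hS], fun I => ?_⟩
  simp only [hD, map_sum]
  refine Finset.sum_congr rfl fun i _ => Finset.sum_congr rfl fun j _ => ?_
  split_ifs <;> simp

/-- For complex entries, D is paired with its conjugate, which is traceless because the metric is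
real; the sum of |D I|² therefore vanishes. Although η is indefinite, the pairing used is positive
definite. Linear functionals reduce the general case to this one. -/
theorem TraceForm.eq_zero {D : (Fin k → Fin 4) → M} (hD : TraceForm D) (hT : Traceless D) :
    D = 0 := by
  have key : ∀ D : (Fin k → Fin 4) → ℂ, TraceForm D → Traceless D → D = 0 := by
    intro D hD hT
    have h := hD.sum_mul hT.conj
    simp only [Complex.mul_conj] at h
    norm_cast at h
    rw [Finset.sum_eq_zero_iff_of_nonneg fun I _ => Complex.normSq_nonneg _] at h
    funext I
    simpa using h I (Finset.mem_univ _)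
  funext I
  rw [Pi.zero_apply, ← Module.forall_dual_apply_eq_zero_iff ℂ]
  intro f
  exact congrFun (key _ (hD.map f) (hT.map f)) I

theorem Traceless.sum {ι : Type} (s : Finset ι) (c : ι → M) {T : ι → (Fin k → Fin 4) → ℂ}
    (hT : ∀ a, Traceless (T a)) : Traceless fun I => ∑ a ∈ s, T a I • c a := fun I i j hij => by
  simp only [Finset.smul_sum, smul_smul]
  rw [Finset.sum_comm]
  refine Finset.sum_eq_zero fun a _ => ?_
  rw [← Finset.sum_smul]
  have := hT a I i j hij
  simp only [smul_eq_mul] at this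
  rw [this, zero_smul]

theorem TraceForm.sum {ι : Type} (s : Finset ι) (c : ι → M) {T : ι → (Fin k → Fin 4) → ℂ}
    (hT : ∀ a, TraceForm (T a)) : TraceForm fun I => ∑ a ∈ s, T a I • c a := by
  choose S hS hD using hT
  refine ⟨fun i j I => ∑ a ∈ s, S a i j I • c a, fun i j I μ ν => by simp only [hS], fun I => ?_⟩
  simp only [hD, Finset.sum_smul]
  rw [Finset.sum_comm]
  refine Finset.sum_congr rfl fun i _ => ?_
  rw [Finset.sum_comm]
  refine Finset.sum_congr rfl fun j _ => ?_
  split_ifs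
  · simp only [smul_eq_mul, Finset.smul_sum, smul_smul]
  · simp

theorem Traceless.sub {T T' : (Fin k → Fin 4) → M} (h : Traceless T) (h' : Traceless T') :
    Traceless fun I => T I - T' I := fun I i j hij => by
  simp only [smul_sub, Finset.sum_sub_distrib, h I i j hij, h' I i j hij, sub_zero]

theorem TraceForm.sub {T T' : (Fin k → Fin 4) → M} (h : TraceForm T) (h' : TraceForm T') :
    TraceForm fun I => T I - T' I := by
  obtain ⟨S, hS, hD⟩ := h
  obtain ⟨S', hS', hD'⟩ := h'
  refine ⟨fun i j I => S i j I - S' i j I, fun i j I μ ν => by simp only [hS, hS'], fun I => ?_⟩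
  simp only [hD, hD', ← Finset.sum_sub_distrib]
  refine Finset.sum_congr rfl fun i _ => Finset.sum_congr rfl fun j _ => ?_
  split_ifs <;> simp [smul_sub]

/-- The trace forms with complex entries. -/
def traceFormSubmodule (k : ℕ) : Submodule ℂ (EuclideanSpace ℂ (Fin k → Fin 4)) where
  carrier := {T | TraceForm fun I => T I}
  zero_mem' := ⟨0, by simp, by simp⟩
  add_mem' := by
    rintro T T' ⟨S, hS, hD⟩ ⟨S', hS', hD'⟩
    refine ⟨fun i j I => S i j I + S' i j I, fun i j I μ ν => by simp only [hS, hS'], fun I => ?_⟩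
    simp only [PiLp.add_apply, hD, hD', ← Finset.sum_add_distrib]
    refine Finset.sum_congr rfl fun i _ => Finset.sum_congr rfl fun j _ => ?_
    split_ifs <;> simp [mul_add]
  smul_mem' c T hT := by
    have := hT.map (LinearMap.lsmul ℂ ℂ c)
    simpa using this

-- A test form for the converse of orthogonality: pairing it with a tensor gives exactly one
-- contraction, the one at the remaining indices of I₀.
open Classical in
theorem traceForm_single {i j : Fin k} (hij : i < j) (I₀ : Fin k → Fin 4) :
    TraceForm fun I => eta (I i) (I j) * if ∀ l, l ≠ i → l ≠ j → I l = I₀ l then (1 : ℂ) else 0 := by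
  refine ⟨fun i' j' I => if i' = i ∧ j' = j then
    (if ∀ l, l ≠ i → l ≠ j → I l = I₀ l then (1 : ℂ) else 0) else 0, fun i' j' I μ ν => ?_,
    fun I => ?_⟩
  · by_cases h : i' = i ∧ j' = j
    · obtain ⟨rfl, rfl⟩ := h
      simp only [and_self, if_true]
      congr 1
      refine propext (forall_congr' fun l => forall_congr' fun h1 => forall_congr' fun h2 => ?_)
      rw [Function.update_of_ne h2, Function.update_of_ne h1]
    · simp only [h, if_false]
  · rw [Finset.sum_eq_single i, Finset.sum_eq_single j]
    · simp [hij]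
    · intro b _ hb; simp [hb]
    · simp
    · intro b _ hb; simp [hb]
    · simp

theorem traceless_of_sum_mul {T : (Fin k → Fin 4) → ℂ}
    (h : ∀ D : (Fin k → Fin 4) → ℂ, TraceForm D → ∑ I, D I * T I = 0) : Traceless T := by
  classical
  have key : ∀ (I₀ : Fin k → Fin 4) (i j : Fin k), i < j →
      ∑ μ, eta μ μ • T (Function.update (Function.update I₀ i μ) j μ) = 0 := by
    intro I₀ i j hij
    -- The test form is supported on the multi-indices that agree with I₀ off i, j and have equal
    -- entries there, and these are the four terms of the contraction.
    rw [← h _ (traceForm_single hij I₀)]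
    have hinj : Function.Injective
        fun μ : Fin 4 => Function.update (Function.update I₀ i μ) j μ := fun μ ν hμν => by
      simpa using congrFun hμν j
    rw [← Finset.sum_subset (Finset.subset_univ (Finset.univ.image
      fun μ : Fin 4 => Function.update (Function.update I₀ i μ) j μ)),
      Finset.sum_image fun a _ b _ hab => hinj hab]
    · refine Finset.sum_congr rfl fun μ _ => ?_
      rw [if_pos fun l h1 h2 => by rw [Function.update_of_ne h2, Function.update_of_ne h1]]
      simp [hij.ne]
    · intro I _ hI
      by_cases h1 : I i = I j
      · rw [if_neg, mul_zero, zero_mul]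
        intro h2
        refine hI (Finset.mem_image.2 ⟨I i, Finset.mem_univ _, ?_⟩)
        funext l
        by_cases h3 : l = j
        · subst h3; simp [h1]
        · by_cases h4 : l = i
          · subst h4; simp [h3]
          · simp [h3, h4, h2 l h4 h3]
      · rw [eta_of_ne h1, zero_mul, zero_mul]
  intro I i j hij
  rcases lt_or_gt_of_ne hij with h1 | h1
  · exact key I i j h1
  · rw [← key I j i h1]
    exact Finset.sum_congr rfl fun μ _ => by rw [Function.update_comm hij]

/-- Orthogonal decomposition in the Hermitian space of tensors: the complement of the trace forms
consists of traceless tensors. -/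
theorem exists_traceless_sub (T : (Fin k → Fin 4) → ℂ) :
    ∃ T₀ : (Fin k → Fin 4) → ℂ, Traceless T₀ ∧ TraceForm fun I => T I - T₀ I := by
  have h := Submodule.sup_orthogonal_of_hasOrthogonalProjection (K := traceFormSubmodule k)
  have hT : WithLp.toLp 2 T ∈ (traceFormSubmodule k) ⊔ (traceFormSubmodule k)ᗮ := by
    rw [h]; trivial
  obtain ⟨D, hD, T₀, hT₀, hs⟩ := Submodule.mem_sup.1 hT
  refine ⟨fun I => T₀ I, traceless_of_sum_mul fun E hE => ?_, ?_⟩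
  -- The Hermitian product conjugates its first argument, so the bilinear pairing with E is the
  -- product with the conjugate of E, again a trace form.
  · have h1 : TraceForm fun I => (starRingEnd ℂ) (E I) := by
      obtain ⟨S, hS, hE⟩ := hE
      refine ⟨fun i j I => (starRingEnd ℂ) (S i j I), fun i j I μ ν => by simp only [hS],
        fun I => ?_⟩
      simp only [hE, map_sum]
      refine Finset.sum_congr rfl fun i _ => Finset.sum_congr rfl fun j _ => ?_
      split_ifs <;> simp [conj_eta]
    have h2 := (Submodule.mem_orthogonal _ _).1 hT₀ (WithLp.toLp 2 fun I => (starRingEnd ℂ) (E I)) h1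
    rw [PiLp.inner_apply] at h2
    rw [← h2]
    refine Finset.sum_congr rfl fun I _ => ?_
    simp [mul_comm]
  · have h3 : (fun I => T I - T₀ I) = fun I => D I := by
      funext I
      have := congrArg (fun x : EuclideanSpace ℂ (Fin k → Fin 4) => x I) hs
      simp only [PiLp.add_apply] at this
      rw [← this]; ring
    rw [h3]
    exact hD

open Classical in
/-- The matrix of the projection onto the traceless tensors. -/
noncomputable def tlMatrix (k : ℕ) (J : Fin k → Fin 4) : (Fin k → Fin 4) → ℂ :=
  (exists_traceless_sub fun I => if I = J then (1 : ℂ) else 0).choose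

/-- The projection onto the traceless tensors. -/
noncomputable def tlProj (T : (Fin k → Fin 4) → M) (I : Fin k → Fin 4) : M :=
  ∑ J, tlMatrix k J I • T J

theorem tlProj_traceless (T : (Fin k → Fin 4) → M) : Traceless (tlProj T) :=
  Traceless.sum _ _ fun J =>
    (exists_traceless_sub fun I => if I = J then (1 : ℂ) else 0).choose_spec.1

theorem sub_tlProj_traceForm (T : (Fin k → Fin 4) → M) :
    TraceForm fun I => T I - tlProj T I := by
  classical
  have h := TraceForm.sum Finset.univ T fun J =>
    (exists_traceless_sub fun I => if I = J then (1 : ℂ) else 0).choose_spec.2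
  convert h using 2 with I
  simp [sub_smul, Finset.sum_sub_distrib, tlProj, tlMatrix]

theorem tlProj_unique {T T₀ : (Fin k → Fin 4) → M} (h : Traceless T₀)
    (h' : TraceForm fun I => T I - T₀ I) : tlProj T = T₀ := by
  have h1 := (h'.sub (sub_tlProj_traceForm T)).eq_zero
    (by simpa using (tlProj_traceless T).sub h)
  funext I
  simpa [sub_eq_zero] using congrFun h1 I

theorem traceForm_zero : TraceForm fun _ : Fin k → Fin 4 => (0 : M) :=
  ⟨0, by simp, by simp⟩

theorem tlProj_of_traceless {T : (Fin k → Fin 4) → M} (h : Traceless T) : tlProj T = T :=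
  tlProj_unique h (by simpa using traceForm_zero)

theorem map_tlProj (f : M →ₗ[ℂ] N) (T : (Fin k → Fin 4) → M) (I : Fin k → Fin 4) :
    f (tlProj T I) = tlProj (fun I => f (T I)) I := by
  simp [tlProj, map_sum]

theorem tlProj_add (T T' : (Fin k → Fin 4) → M) (I : Fin k → Fin 4) :
    tlProj (fun I => T I + T' I) I = tlProj T I + tlProj T' I := by
  simp [tlProj, Finset.sum_add_distrib]

theorem tlProj_neg (T : (Fin k → Fin 4) → M) (I : Fin k → Fin 4) :
    tlProj (fun I => - T I) I = - tlProj T I := by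
  simp [tlProj]

theorem tlProj_zero (I : Fin k → Fin 4) :
    tlProj (fun _ => (0 : M)) I = 0 := by
  simp [tlProj]

theorem tlProj_mem {T : (Fin k → Fin 4) → M} {Y : Submodule ℂ M} (h : ∀ I, T I ∈ Y)
    (I : Fin k → Fin 4) : tlProj T I ∈ Y :=
  Submodule.sum_mem _ fun J _ => Submodule.smul_mem _ _ (h J)

/-- If all the traces of a tensor lie in `Y`, so does its difference with the traceless part. -/
theorem sub_tlProj_mem {T : (Fin k → Fin 4) → M} {Y : Submodule ℂ M}
    (h : ∀ (I : Fin k → Fin 4) (i j : Fin k), i ≠ j →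
      ∑ μ, eta μ μ • T (Function.update (Function.update I i μ) j μ) ∈ Y)
    (I : Fin k → Fin 4) : T I - tlProj T I ∈ Y := by
  have h1 : Traceless fun I => Y.mkQ (T I) := fun I i j hij => by
    simp only [← map_smul, ← map_sum]
    rw [Submodule.mkQ_apply, Submodule.Quotient.mk_eq_zero]
    exact h I i j hij
  have h2 := congrFun (tlProj_of_traceless h1) I
  rw [← map_tlProj] at h2
  rw [← Submodule.Quotient.mk_eq_zero, Submodule.Quotient.mk_sub, sub_eq_zero]
  exact h2.symm

/-! ### Traceless parts and permutations of the indices -/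

theorem update_update_comp_perm (I : Fin k → Fin 4) (σ : Equiv.Perm (Fin k)) (i j : Fin k)
    (μ ν : Fin 4) : Function.update (Function.update I i μ) j ν ∘ σ =
      Function.update (Function.update (I ∘ σ) (σ.symm i) μ) (σ.symm j) ν := by
  funext l
  simp only [Function.comp_apply, Function.update_apply, Equiv.eq_symm_apply]

/-- A permutation of the indices does not respect the condition i < j; this criterion allows all
ordered pairs, the two orders being merged by the symmetry of η. -/
theorem traceForm_of_pairs {T : (Fin k → Fin 4) → M}
    {S : Fin k → Fin k → (Fin k → Fin 4) → M}
    (hS : ∀ i j I μ ν, i ≠ j → S i j (Function.update (Function.update I i μ) j ν) = S i j I)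
    (h : ∀ I, T I = ∑ i, ∑ j, if i ≠ j then eta (I i) (I j) • S i j I else 0) :
    TraceForm T := by
  refine ⟨fun i j I => if i ≠ j then S i j I + S j i I else 0, fun i j I μ ν => ?_, fun I => ?_⟩
  · by_cases hij : i = j
    · simp [hij]
    · have := hS j i I ν μ (Ne.symm hij)
      rw [Function.update_comm (Ne.symm hij)] at this
      simp [hij, hS i j I μ ν hij, this]
  · have e1 : ∀ i j, (if i ≠ j then eta (I i) (I j) • S i j I else 0) =
        (if i < j then eta (I i) (I j) • S i j I else 0) +
        (if j < i then eta (I i) (I j) • S i j I else 0) := fun i j => by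
      rcases lt_trichotomy i j with h1 | h1 | h1
      · simp [h1, h1.ne, h1.not_gt]
      · simp [h1]
      · simp [h1, h1.ne', h1.not_gt]
    have e2 : ∀ i j, (if i < j then eta (I i) (I j) •
        (if i ≠ j then S i j I + S j i I else 0) else 0) =
        (if i < j then eta (I i) (I j) • S i j I else 0) +
        (if i < j then eta (I j) (I i) • S j i I else 0) := fun i j => by
      have : eta (I i) (I j) = eta (I j) (I i) := by
        unfold eta
        by_cases h : I i = I j
        · simp [h]
        · simp [h, Ne.symm h]
      split_ifs with h1 h2
      · rw [smul_add, this]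
      · exact absurd h1.ne h2
      · simp
    simp only [h, e1, e2, Finset.sum_add_distrib]
    congr 1
    exact Finset.sum_comm

/-- Both conditions that characterize the traceless part are invariant under permutations, so
uniqueness applies. -/
theorem tlProj_comp_perm (T : (Fin k → Fin 4) → M) (σ : Equiv.Perm (Fin k))
    (I : Fin k → Fin 4) : tlProj (fun I => T (I ∘ σ)) I = tlProj T (I ∘ σ) := by
  have h : tlProj (fun I => T (I ∘ σ)) = fun I => tlProj T (I ∘ σ) := by
    refine tlProj_unique (fun I i j hij => ?_) ?_
    · simp only [update_update_comp_perm]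
      exact tlProj_traceless T _ _ _ (by simpa using hij)
    · obtain ⟨S, hS, hD⟩ := sub_tlProj_traceForm T
      refine traceForm_of_pairs (S := fun i j I =>
        if σ.symm i < σ.symm j then S (σ.symm i) (σ.symm j) (I ∘ σ) else 0)
        (fun i j I μ ν hij => ?_) fun I => ?_
      · simp only [update_update_comp_perm, hS]
      · refine (hD (I ∘ σ)).trans ?_
        rw [← Equiv.sum_comp σ.symm]
        refine Finset.sum_congr rfl fun i _ => ?_
        rw [← Equiv.sum_comp σ.symm]
        refine Finset.sum_congr rfl fun j _ => ?_
        by_cases h : i = j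
        · simp [h]
        · simp [h]
  exact congrFun h I

end Traceless

/-! ## The space of jet variables on the mass shell -/

section JetSpace

/-- The Klein-Gordon relations between the jet variables. -/
noncomputable def kgSpan (m : ℝ) : Submodule ℂ (Jet →₀ ℂ) :=
  Submodule.span ℂ {x | ∃ (α : Fld) (J : Multiset (Fin 4)),
    x = ∑ μ, eta μ μ • Finsupp.single ((α, μ ::ₘ μ ::ₘ J) : Jet) (1 : ℂ)
      + (m : ℂ) ^ 2 • Finsupp.single ((α, J) : Jet) (1 : ℂ)}

/-- The space of linear combinations of jet variables modulo the Klein-Gordon equations. -/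
abbrev JetSpace (m : ℝ) : Type := (Jet →₀ ℂ) ⧸ kgSpan m

/-- The class of a jet variable. -/
noncomputable def jv (m : ℝ) (a : Jet) : JetSpace m :=
  Submodule.Quotient.mk (Finsupp.single a 1)

variable {M : Type} [AddCommGroup M] [Module ℂ M]

/-- The Klein-Gordon equations for a family indexed by the jet variables. -/
def KleinGordon (m : ℝ) (f : Multiset (Fin 4) → M) : Prop :=
  ∀ J, ∑ μ, eta μ μ • f (μ ::ₘ μ ::ₘ J) + (m : ℂ) ^ 2 • f J = 0

/-- The linear map with given values on the jet variables. -/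
noncomputable def jetLift (m : ℝ) (f : Jet → M) (h : ∀ α, KleinGordon m fun J => f (α, J)) :
    JetSpace m →ₗ[ℂ] M :=
  (kgSpan m).liftQ (Finsupp.linearCombination ℂ f) <| by
    rw [kgSpan, Submodule.span_le]
    rintro _ ⟨α, J, rfl⟩
    simpa [Finsupp.linearCombination_single] using h α J

@[simp]
theorem jetLift_jv (m : ℝ) (f : Jet → M) (h) (a : Jet) : jetLift m f h (jv m a) = f a := by
  rw [jv, jetLift, Submodule.liftQ_apply]
  simp

theorem jv_kleinGordon (m : ℝ) (α : Fld) : KleinGordon m fun J => jv m (α, J) := fun J => by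
  have h : (Submodule.Quotient.mk (∑ μ, eta μ μ • Finsupp.single ((α, μ ::ₘ μ ::ₘ J) : Jet) (1 : ℂ)
      + (m : ℂ) ^ 2 • Finsupp.single ((α, J) : Jet) (1 : ℂ)) : JetSpace m) = 0 :=
    (Submodule.Quotient.mk_eq_zero _).2 (Submodule.subset_span ⟨α, J, rfl⟩)
  rw [← Submodule.mkQ_apply] at h
  simp only [map_add, map_sum, map_smul] at h
  exact h

theorem jv_span (m : ℝ) : Submodule.span ℂ (Set.range (jv m)) = ⊤ := by
  rw [eq_top_iff]
  rintro x -
  obtain ⟨x, rfl⟩ := Submodule.Quotient.mk_surjective _ x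
  induction x using Finsupp.induction_linear with
  | zero => exact Submodule.zero_mem _
  | add f g hf hg => exact Submodule.add_mem _ hf hg
  | single a c =>
    have : (Submodule.Quotient.mk (Finsupp.single a c) : JetSpace m) = c • jv m a := by
      rw [jv, ← Submodule.Quotient.mk_smul]; simp
    rw [this]
    exact Submodule.smul_mem _ _ (Submodule.subset_span ⟨a, rfl⟩)

theorem jet_linearMap_ext {m : ℝ} {f g : JetSpace m →ₗ[ℂ] M}
    (h : ∀ a, f (jv m a) = g (jv m a)) : f = g :=
  LinearMap.ext_on (jv_span m) (by rintro _ ⟨a, rfl⟩; exact h a)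

/-- The inclusion of the jet variables into `𝒫`. -/
noncomputable def toPoly (m : ℝ) : JetSpace m →ₗ[ℂ] Poly m :=
  jetLift m (jet m) fun α J => jet_kleinGordon m α J

@[simp]
theorem toPoly_jv (m : ℝ) (a : Jet) : toPoly m (jv m a) = jet m a := jetLift_jv _ _ _ _

/-- In the square-zero extension all products of variables vanish, so graded commutativity is
trivial and only the linear Klein-Gordon relations remain. The resulting projection shows that
`toPoly` is injective. -/
theorem linearPart_aux (m : ℝ) ⦃x y : FreeAlgebra ℂ Jet⦄ (h : Rel m x y) :
    FreeAlgebra.lift ℂ (fun a : Jet => TrivSqZeroExt.inr (R := ℂ) (jv m a)) x =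
      FreeAlgebra.lift ℂ (fun a : Jet => TrivSqZeroExt.inr (R := ℂ) (jv m a)) y := by
  induction h with
  | comm a b => simp
  | kleinGordon α J =>
    have h := jv_kleinGordon m α J
    simp only [map_add, map_sum, map_smul, map_zero, FreeAlgebra.lift_ι_apply,
      ← TrivSqZeroExt.inr_smul]
    rw [← TrivSqZeroExt.inr_zero, ← h, TrivSqZeroExt.inr_add]
    congr 1
    exact (map_sum (TrivSqZeroExt.inrHom ℂ (JetSpace m)) _ _).symm

/-- The part of a polynomial which is linear in the jet variables. -/
noncomputable def linearPart (m : ℝ) : Poly m →ₗ[ℂ] JetSpace m :=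
  TrivSqZeroExt.sndHom ℂ (JetSpace m) ∘ₗ (Poly.lift m _ (linearPart_aux m)).toLinearMap

@[simp]
theorem linearPart_toPoly (m : ℝ) (x : JetSpace m) : linearPart m (toPoly m x) = x := by
  have : linearPart m ∘ₗ toPoly m = LinearMap.id := jet_linearMap_ext fun a => by
    simp only [LinearMap.comp_apply, toPoly_jv, LinearMap.id_apply]
    rw [linearPart, LinearMap.comp_apply, jet, AlgHom.toLinearMap_apply, Poly.lift_mk,
      FreeAlgebra.lift_ι_apply]
    simp
  exact LinearMap.congr_fun this x

/-! ## Solutions of the Klein-Gordon equations from their initial data -/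

/-- The solution of the Klein-Gordon equations with given values on the multi-indices which
contain the index `0` at most once. -/
noncomputable def kgExtend (m : ℝ) (f : Multiset (Fin 4) → M) (J : Multiset (Fin 4)) : M :=
  if 2 ≤ J.count 0 then
    (∑ i : Fin 3, kgExtend m f (i.succ ::ₘ i.succ ::ₘ (J.erase 0).erase 0))
      - (m : ℂ) ^ 2 • kgExtend m f ((J.erase 0).erase 0)
  else f J
termination_by J.count 0
decreasing_by
  · rw [Multiset.count_cons_of_ne (Fin.succ_ne_zero i).symm,
      Multiset.count_cons_of_ne (Fin.succ_ne_zero i).symm]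
    simp only [Multiset.count_erase_self]
    omega
  · simp only [Multiset.count_erase_self]
    omega

theorem kgExtend_of_lt (m : ℝ) (f : Multiset (Fin 4) → M) {J : Multiset (Fin 4)}
    (h : J.count 0 < 2) : kgExtend m f J = f J := by
  rw [kgExtend, if_neg (by omega)]

theorem kgExtend_cons_cons (m : ℝ) (f : Multiset (Fin 4) → M) (J : Multiset (Fin 4)) :
    kgExtend m f (0 ::ₘ 0 ::ₘ J) = (∑ i : Fin 3, kgExtend m f (i.succ ::ₘ i.succ ::ₘ J))
      - (m : ℂ) ^ 2 • kgExtend m f J := by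
  rw [kgExtend, if_pos (by simp)]
  simp

theorem sum_eta_self_smul (f : Fin 4 → M) :
    ∑ μ, eta μ μ • f μ = f 0 - ∑ i : Fin 3, f i.succ := by
  rw [Fin.sum_univ_succ]
  simp [eta, Fin.succ_ne_zero, sub_eq_add_neg]

/-- The recursion defining `kgExtend` is the Klein-Gordon equation solved for its 00 term. -/
theorem kleinGordon_kgExtend (m : ℝ) (f : Multiset (Fin 4) → M) :
    KleinGordon m (kgExtend m f) := fun J => by
  rw [sum_eta_self_smul, kgExtend_cons_cons]
  abel

theorem KleinGordon.cons_cons {m : ℝ} {f : Multiset (Fin 4) → M} (h : KleinGordon m f)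
    (J : Multiset (Fin 4)) : f (0 ::ₘ 0 ::ₘ J) = (∑ i : Fin 3, f (i.succ ::ₘ i.succ ::ₘ J))
      - (m : ℂ) ^ 2 • f J := by
  have := h J
  rw [sum_eta_self_smul] at this
  rw [← sub_eq_zero, ← this]
  abel

/-- Induction on the number of indices `0`. -/
theorem time_induction {P : Multiset (Fin 4) → Prop} (h1 : ∀ J, J.count 0 < 2 → P J)
    (h2 : ∀ J, P J → (∀ i : Fin 3, P (i.succ ::ₘ i.succ ::ₘ J)) → P (0 ::ₘ 0 ::ₘ J))
    (J : Multiset (Fin 4)) : P J := by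
  generalize hn : J.count 0 = n
  induction n using Nat.strong_induction_on generalizing J with
  | _ n ih =>
    by_cases h : J.count 0 < 2
    · exact h1 J h
    · have e1 : (0 : Fin 4) ∈ J := Multiset.count_pos.1 (by omega)
      have e2 : (0 : Fin 4) ∈ J.erase 0 :=
        Multiset.count_pos.1 (by rw [Multiset.count_erase_self]; omega)
      rw [← Multiset.cons_erase e1, ← Multiset.cons_erase e2]
      have e3 : ((J.erase 0).erase 0).count 0 = n - 2 := by
        simp only [Multiset.count_erase_self]; omega
      refine h2 _ (ih _ (by omega) _ e3) fun i => ih (n - 2) (by omega) _ ?_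
      rw [Multiset.count_cons_of_ne (Fin.succ_ne_zero i).symm,
        Multiset.count_cons_of_ne (Fin.succ_ne_zero i).symm, e3]

end JetSpace

/-! ## Formal symbols indexed by multisets -/

theorem idx_coe {k : ℕ} (f : Fin k → Fin 4) : idx f = (List.ofFn f : Multiset (Fin 4)) := by
  rw [idx, Fin.univ_val_map]

theorem idx_vecCons {k : ℕ} (a : Fin 4) (f : Fin k → Fin 4) :
    idx (Matrix.vecCons a f) = a ::ₘ idx f := by
  rw [idx_coe, idx_coe, List.ofFn_succ]
  rfl

theorem card_idx {k : ℕ} (f : Fin k → Fin 4) : Multiset.card (idx f) = k := by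
  simp [idx]

theorem idx_comp_perm {k : ℕ} (f : Fin k → Fin 4) (σ : Equiv.Perm (Fin k)) :
    idx (f ∘ σ) = idx f := by
  rw [idx, idx, ← Multiset.map_map, Multiset.map_univ_val_equiv]

theorem exists_idx (K : Multiset (Fin 4)) {n : ℕ} (hn : Multiset.card K = n) :
    ∃ f : Fin n → Fin 4, idx f = K := by
  subst hn
  induction K using Quotient.inductionOn with
  | h l => exact ⟨l.get, (idx_coe l.get).trans (congrArg _ (List.ofFn_get l))⟩

theorem exists_eq_idx (K : Multiset (Fin 4)) : ∃ (n : ℕ) (f : Fin n → Fin 4), idx f = K :=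
  ⟨_, exists_idx K rfl⟩

/-- Both families become equal after sorting. -/
theorem exists_perm_of_idx_eq {k : ℕ} {f g : Fin k → Fin 4} (h : idx f = idx g) :
    ∃ σ : Equiv.Perm (Fin k), f = g ∘ σ := by
  have h1 : f ∘ Tuple.sort f = g ∘ Tuple.sort g := by
    apply List.ofFn_injective
    rw [idx_coe, idx_coe, Multiset.coe_eq_coe] at h
    exact (((Tuple.sort f).ofFn_comp_perm f).trans
      (h.trans ((Tuple.sort g).ofFn_comp_perm g).symm)).eq_of_pairwise'
        (Tuple.monotone_sort f).sortedLE_ofFn.pairwise (Tuple.monotone_sort g).sortedLE_ofFn.pairwise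
  refine ⟨(Tuple.sort f).symm.trans (Tuple.sort g), funext fun i => ?_⟩
  have := congrFun h1 ((Tuple.sort f).symm i)
  simpa using this

/-! ### The relations between the classes of the symbols -/

theorem cls_rel {x : MvPolynomial Sym0 ℂ} (h : TensorRel x) :
    Ideal.Quotient.mk bianchiIdeal x = 0 :=
  Ideal.Quotient.eq_zero_iff_mem.2 (Ideal.mem_sup_left (Ideal.subset_span h))

theorem cls_bianchi {x : MvPolynomial Sym0 ℂ} (h : BianchiRel x) :
    Ideal.Quotient.mk bianchiIdeal x = 0 :=
  Ideal.Quotient.eq_zero_iff_mem.2 (Ideal.mem_sup_right (Ideal.subset_span h))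

theorem cls_F_antisymm (n : ℕ) (I : Fin (n + 2) → Fin 4) :
    (Sym0.F n I).cls + (Sym0.F n (I ∘ Equiv.swap 0 1)).cls = 0 := by
  have h := cls_rel (.F_antisymm n I)
  rwa [map_add] at h

theorem cls_F_symm (n : ℕ) (I : Fin (n + 2) → Fin 4) (i j : Fin n) :
    (Sym0.F n I).cls = (Sym0.F n (I ∘ Equiv.swap i.succ.succ j.succ.succ)).cls := by
  have h := cls_rel (.F_symm n I i j)
  rwa [map_sub, sub_eq_zero] at h

theorem cls_F_traceless (n : ℕ) : Traceless fun I => (Sym0.F n I).cls := fun I i j hij => by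
  have h := cls_rel (.F_trace n I i j hij)
  rw [map_sum] at h
  exact h

theorem cls_phi_symm (n : ℕ) (I : Fin (n + 1) → Fin 4) (i j : Fin (n + 1)) :
    (Sym0.phi n I).cls = (Sym0.phi n (I ∘ Equiv.swap i j)).cls := by
  have h := cls_rel (.phi_symm n I i j)
  rwa [map_sub, sub_eq_zero] at h

theorem cls_phi_traceless (n : ℕ) : Traceless fun I => (Sym0.phi n I).cls := fun I i j hij => by
  have h := cls_rel (.phi_trace n I i j hij)
  rw [map_sum] at h
  exact h

theorem cls_phi_comp_perm (n : ℕ) (I : Fin (n + 1) → Fin 4) (σ : Equiv.Perm (Fin (n + 1))) :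
    (Sym0.phi n (I ∘ σ)).cls = (Sym0.phi n I).cls := by
  induction σ using Equiv.Perm.swap_induction_on generalizing I with
  | one => rfl
  | swap_mul f x y _ ih =>
    rw [Equiv.Perm.coe_mul, ← Function.comp_assoc, ih, ← cls_phi_symm]

theorem cls_F_comp_perm (n : ℕ) (μ ν : Fin 4) (I : Fin n → Fin 4) (σ : Equiv.Perm (Fin n)) :
    (Sym0.F n (Matrix.vecCons μ (Matrix.vecCons ν (I ∘ σ)))).cls =
      (Sym0.F n (Matrix.vecCons μ (Matrix.vecCons ν I))).cls := by
  induction σ using Equiv.Perm.swap_induction_on generalizing I with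
  | one => rfl
  | swap_mul f x y _ ih =>
    rw [Equiv.Perm.coe_mul, ← Function.comp_assoc, ih, cls_F_symm n _ x y]
    congr 2
    funext l
    refine Fin.cases ?_ (fun l => Fin.cases ?_ (fun l => ?_) l) l
    · rw [Function.comp_apply, Equiv.swap_apply_of_ne_of_ne] <;> simp [Fin.ext_iff]
    · rw [Function.comp_apply, Equiv.swap_apply_of_ne_of_ne] <;> simp [Fin.ext_iff]
    · rw [Function.comp_apply]
      have : Equiv.swap x.succ.succ y.succ.succ l.succ.succ = (Equiv.swap x y l).succ.succ := by
        simp only [Equiv.swap_apply_def, Fin.succ_inj]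
        split_ifs <;> rfl
      rw [this]
      simp

/-- The class of the symbol `F⁽⁰⁾_{μν;K}`. -/
noncomputable def clsF (μ ν : Fin 4) (K : Multiset (Fin 4)) : FormalP0 :=
  (Sym0.F _ (Matrix.vecCons μ (Matrix.vecCons ν (exists_idx K rfl).choose))).cls

/-- The class of the symbol `φ⁽⁰⁾_K`, and zero if `K` is empty. -/
noncomputable def clsPhi (K : Multiset (Fin 4)) : FormalP0 :=
  if h : K = 0 then 0 else (Sym0.phi (Multiset.card K - 1) (exists_idx K
    (Nat.sub_add_cancel (Multiset.card_pos.2 h)).symm).choose).cls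

theorem cls_F_vecCons {n : ℕ} (μ ν : Fin 4) (f : Fin n → Fin 4) :
    (Sym0.F n (Matrix.vecCons μ (Matrix.vecCons ν f))).cls = clsF μ ν (idx f) := by
  -- The list chosen in `clsF` has length `card (idx f)`, which equals n only propositionally; a
  -- free length n' lets the equation be substituted.
  have key : ∀ (n' : ℕ) (g : Fin n' → Fin 4), n' = n → idx g = idx f →
      (Sym0.F n (Matrix.vecCons μ (Matrix.vecCons ν f))).cls =
        (Sym0.F n' (Matrix.vecCons μ (Matrix.vecCons ν g))).cls := by
    rintro n' g rfl h
    obtain ⟨σ, rfl⟩ := exists_perm_of_idx_eq h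
    rw [cls_F_comp_perm]
  exact key _ _ (card_idx f) (exists_idx (idx f) rfl).choose_spec

theorem vecCons_head_tail {n : ℕ} (I : Fin (n + 2) → Fin 4) :
    Matrix.vecCons (I 0) (Matrix.vecCons (I 1) fun l : Fin n => I l.succ.succ) = I := by
  funext l
  refine Fin.cases rfl (fun l => Fin.cases rfl (fun l => rfl) l) l

theorem cls_F {n : ℕ} (I : Fin (n + 2) → Fin 4) :
    (Sym0.F n I).cls = clsF (I 0) (I 1) (idx fun l : Fin n => I l.succ.succ) := by
  rw [← cls_F_vecCons, vecCons_head_tail]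

theorem cls_phi {n : ℕ} (I : Fin (n + 1) → Fin 4) : (Sym0.phi n I).cls = clsPhi (idx I) := by
  have key : ∀ (n' : ℕ) (g : Fin (n' + 1) → Fin 4), n' = n → idx g = idx I →
      (Sym0.phi n I).cls = (Sym0.phi n' g).cls := by
    rintro n' g rfl h
    obtain ⟨σ, rfl⟩ := exists_perm_of_idx_eq h
    rw [cls_phi_comp_perm]
  have h : idx I ≠ 0 := by
    rw [← Multiset.card_pos, card_idx]; omega
  rw [clsPhi, dif_neg h]
  exact key _ _ (by rw [card_idx]; omega) (exists_idx (idx I)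
    (Nat.sub_add_cancel (Multiset.card_pos.2 h)).symm).choose_spec

theorem clsF_antisymm (μ ν : Fin 4) (K : Multiset (Fin 4)) : clsF μ ν K = - clsF ν μ K := by
  obtain ⟨n, f, rfl⟩ := exists_eq_idx K
  have h := cls_F_antisymm _ (Matrix.vecCons μ (Matrix.vecCons ν f))
  rw [cls_F_vecCons, cls_F] at h
  rw [eq_neg_iff_add_eq_zero, ← h]
  congr 3

theorem clsF_self (μ : Fin 4) (K : Multiset (Fin 4)) : clsF μ μ K = 0 := by
  have h := clsF_antisymm μ μ K
  have h2 : (2 : ℂ) • clsF μ μ K = 0 := by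
    rw [two_smul]; nth_rewrite 1 [h]; exact neg_add_cancel _
  exact (smul_eq_zero.1 h2).resolve_left two_ne_zero

theorem clsF_trace (μ ν : Fin 4) (K : Multiset (Fin 4)) :
    ∑ κ, eta κ κ • clsF μ ν (κ ::ₘ κ ::ₘ K) = 0 := by
  obtain ⟨n, f, rfl⟩ := exists_eq_idx K
  rw [← cls_F_traceless _ (Matrix.vecCons μ (Matrix.vecCons ν (Matrix.vecCons 0 (Matrix.vecCons 0
    f)))) (Fin.succ (Fin.succ 0)) (Fin.succ (Fin.succ (Fin.succ 0))) (by
      simp only [ne_eq, Fin.ext_iff, Fin.val_succ, Fin.val_zero]; omega)]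
  refine Finset.sum_congr rfl fun κ _ => ?_
  rw [← idx_vecCons, ← idx_vecCons, ← cls_F_vecCons]
  congr 3
  funext l
  refine Fin.cases rfl (fun l => Fin.cases rfl (fun l => Fin.cases rfl
    (fun l => Fin.cases rfl (fun l => ?_) l) l) l) l
  rw [Function.update_of_ne, Function.update_of_ne]
  · rfl
  · simp only [ne_eq, Fin.ext_iff, Fin.val_succ, Fin.val_zero]; omega
  · simp only [ne_eq, Fin.ext_iff, Fin.val_succ, Fin.val_zero]; omega

theorem clsF_div (ν : Fin 4) (K : Multiset (Fin 4)) :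
    ∑ κ, eta κ κ • clsF κ ν (κ ::ₘ K) = 0 := by
  obtain ⟨n, f, rfl⟩ := exists_eq_idx K
  rw [← cls_F_traceless _ (Matrix.vecCons 0 (Matrix.vecCons ν (Matrix.vecCons 0 f))) 0
    (Fin.succ (Fin.succ 0)) (by
      simp only [ne_eq, Fin.ext_iff, Fin.val_succ, Fin.val_zero]; omega)]
  refine Finset.sum_congr rfl fun κ _ => ?_
  rw [← idx_vecCons, ← cls_F_vecCons]
  congr 3
  funext l
  refine Fin.cases rfl (fun l => Fin.cases rfl (fun l => Fin.cases rfl (fun l => ?_) l) l) l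
  rw [Function.update_of_ne, Function.update_of_ne]
  · rfl
  · simp only [ne_eq, Fin.ext_iff, Fin.val_succ, Fin.val_zero]; omega
  · simp only [ne_eq, Fin.ext_iff, Fin.val_succ, Fin.val_zero]; omega

theorem clsF_bianchi (μ ν ρ : Fin 4) (K : Multiset (Fin 4)) :
    clsF μ ν (ρ ::ₘ K) + clsF ν ρ (μ ::ₘ K) + clsF ρ μ (ν ::ₘ K) = 0 := by
  obtain ⟨n, f, rfl⟩ := exists_eq_idx K
  have h := cls_bianchi (.mk _ μ ν ρ f)
  simp only [map_add] at h
  simp only [← idx_vecCons, ← cls_F_vecCons]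
  exact h

theorem clsPhi_trace (K : Multiset (Fin 4)) :
    ∑ κ, eta κ κ • clsPhi (κ ::ₘ κ ::ₘ K) = 0 := by
  obtain ⟨n, f, rfl⟩ := exists_eq_idx K
  rw [← cls_phi_traceless _ (Matrix.vecCons 0 (Matrix.vecCons 0 f)) 0 1 (by simp)]
  refine Finset.sum_congr rfl fun κ _ => ?_
  rw [← idx_vecCons, ← idx_vecCons, ← cls_phi]
  congr 3
  funext l
  refine Fin.cases rfl (fun l => Fin.cases rfl (fun l => ?_) l) l
  rw [Function.update_of_ne, Function.update_of_ne]
  · rfl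
  · simp [Fin.ext_iff]
  · simp [Fin.ext_iff]

/-! ## Sums over the elements of a multiset -/

section MSum

variable {M : Type} [AddCommGroup M] [Module ℂ M]

/-- The sum of `f ρ (J - ρ)` over the elements `ρ` of `J`. -/
noncomputable def msum (f : Fin 4 → Multiset (Fin 4) → M) (J : Multiset (Fin 4)) : M :=
  ∑ ρ, (J.count ρ : ℂ) • f ρ (J.erase ρ)

/-- A product rule: the element removed is either the new κ or one of K. It reduces the traces,
divergences and curls below to the relations between the symbols. -/
theorem msum_cons (f : Fin 4 → Multiset (Fin 4) → M) (κ : Fin 4) (K : Multiset (Fin 4)) :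
    msum f (κ ::ₘ K) = f κ K + msum (fun ρ L => f ρ (κ ::ₘ L)) K := by
  have h : ∀ ρ, ((κ ::ₘ K).count ρ : ℂ) • f ρ ((κ ::ₘ K).erase ρ) =
      (if ρ = κ then f κ K else 0) + (K.count ρ : ℂ) • f ρ (κ ::ₘ K.erase ρ) := fun ρ => by
    by_cases h1 : ρ = κ
    · subst h1
      by_cases h2 : ρ ∈ K
      · rw [Multiset.cons_erase h2]
        simp [add_smul, add_comm]
      · simp [Multiset.count_eq_zero_of_notMem h2]
    · rw [Multiset.count_cons_of_ne h1, Multiset.erase_cons_tail _ (Ne.symm h1)]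
      simp [h1]
  simp only [msum, h, Finset.sum_add_distrib]
  simp

theorem msum_cons_cons (f : Fin 4 → Multiset (Fin 4) → M) (κ : Fin 4) (K : Multiset (Fin 4)) :
    msum f (κ ::ₘ κ ::ₘ K) =
      (2 : ℂ) • f κ (κ ::ₘ K) + msum (fun ρ L => f ρ (κ ::ₘ κ ::ₘ L)) K := by
  rw [msum_cons, msum_cons, two_smul, add_assoc]

theorem msum_add (f g : Fin 4 → Multiset (Fin 4) → M) (K : Multiset (Fin 4)) :
    msum (fun ρ L => f ρ L + g ρ L) K = msum f K + msum g K := by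
  simp [msum, Finset.sum_add_distrib]

theorem msum_smul (c : ℂ) (f : Fin 4 → Multiset (Fin 4) → M) (K : Multiset (Fin 4)) :
    msum (fun ρ L => c • f ρ L) K = c • msum f K := by
  simp only [msum, Finset.smul_sum]
  exact Finset.sum_congr rfl fun ρ _ => smul_comm _ _ _

theorem msum_sum (f : Fin 4 → Fin 4 → Multiset (Fin 4) → M) (K : Multiset (Fin 4)) :
    msum (fun ρ L => ∑ κ, f κ ρ L) K = ∑ κ, msum (f κ) K := by
  simp only [msum, Finset.smul_sum]
  exact Finset.sum_comm

theorem sum_smul_msum (f : Fin 4 → Fin 4 → Multiset (Fin 4) → M) (K : Multiset (Fin 4)) :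
    ∑ κ, eta κ κ • msum (f κ) K = msum (fun ρ L => ∑ κ, eta κ κ • f κ ρ L) K := by
  rw [msum_sum]
  simp only [msum_smul]

theorem msum_zero' (K : Multiset (Fin 4)) :
    msum (fun _ _ => (0 : M)) K = 0 := by
  simp [msum]

theorem msum_mem {Y : Submodule ℂ M} {f : Fin 4 → Multiset (Fin 4) → M} {K : Multiset (Fin 4)}
    (h : ∀ ρ ∈ K, f ρ (K.erase ρ) ∈ Y) : msum f K ∈ Y := by
  refine Submodule.sum_mem _ fun ρ _ => ?_
  by_cases h1 : ρ ∈ K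
  · exact Submodule.smul_mem _ _ (h ρ h1)
  · simp [Multiset.count_eq_zero_of_notMem h1]

/-- Euler's formula. -/
theorem msum_euler (f : Multiset (Fin 4) → M) (K : Multiset (Fin 4)) :
    msum (fun ρ L => f (ρ ::ₘ L)) K = (Multiset.card K : ℂ) • f K := by
  have h : ∀ ρ, (K.count ρ : ℂ) • f (ρ ::ₘ K.erase ρ) = (K.count ρ : ℂ) • f K := fun ρ => by
    by_cases h1 : ρ ∈ K
    · rw [Multiset.cons_erase h1]
    · simp [Multiset.count_eq_zero_of_notMem h1]
  simp only [msum, h]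
  rw [← Finset.sum_smul, ← Nat.cast_sum]
  congr 2
  rw [Multiset.sum_count_eq_card]
  simp

theorem sum_eta_mul (μ : Fin 4) (f : Fin 4 → M) :
    ∑ κ, eta κ κ • eta κ μ • f κ = f μ := by
  rw [Finset.sum_eq_single μ]
  · rw [smul_smul]
    have : eta μ μ * eta μ μ = 1 := by
      unfold eta; split_ifs <;> simp_all
    rw [this, one_smul]
  · intro κ _ h; rw [eta_of_ne h]; simp
  · simp

theorem eta_comm (μ ν : Fin 4) : eta μ ν = eta ν μ := by
  unfold eta
  by_cases h : μ = ν
  · simp [h]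
  · simp [h, Ne.symm h]

theorem sum_eta_mul' (μ : Fin 4) (f : Fin 4 → M) :
    ∑ κ, eta κ κ • eta μ κ • f κ = f μ := by
  simp only [eta_comm μ]
  exact sum_eta_mul μ f

theorem sum_eta_mul_self (x : M) : ∑ κ, eta κ κ • eta κ κ • x = (4 : ℂ) • x := by
  have : ∀ κ, eta κ κ * eta κ κ = 1 := fun κ => by
    unfold eta; split_ifs <;> simp_all
  simp only [smul_smul, this, one_smul, Finset.sum_const, Finset.card_univ, Fintype.card_fin]
  norm_num [← Nat.cast_smul_eq_nsmul ℂ]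

end MSum

/-! ## A left inverse, up to lower order terms, of the embedding of the formal symbols -/

/-- The part of the image of `v_{μ;J}` made of the symbols `F⁽⁰⁾`, up to normalization. -/
noncomputable def curlPart (μ : Fin 4) (J : Multiset (Fin 4)) : FormalP0 :=
  msum (fun ρ L => clsF ρ μ L) J

/-- The tensor `∑ η_{μρ} φ⁽⁰⁾_{J-ρ}`. -/
noncomputable def etaPhi (μ : Fin 4) (J : Multiset (Fin 4)) : FormalP0 :=
  msum (fun ρ L => eta μ ρ • clsPhi L) J

/-- The tensor `∑ η_{ρσ} φ⁽⁰⁾_{μ(J-ρ-σ)}`, summed over ordered pairs. -/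
noncomputable def etaEtaPhi (μ : Fin 4) (J : Multiset (Fin 4)) : FormalP0 :=
  msum (fun ρ L => msum (fun σ M => eta ρ σ • clsPhi (μ ::ₘ M)) L) J

/-! ### Traces, divergences and curls of the building blocks -/

theorem curlPart_trace (μ : Fin 4) (K : Multiset (Fin 4)) :
    ∑ κ, eta κ κ • curlPart μ (κ ::ₘ κ ::ₘ K) = 0 := by
  simp only [curlPart, msum_cons_cons, smul_add, Finset.sum_add_distrib, sum_smul_msum, clsF_trace,
    msum_zero', smul_comm _ (2 : ℂ), ← Finset.smul_sum, clsF_div, smul_zero, add_zero]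

theorem curlPart_div (I : Multiset (Fin 4)) :
    ∑ μ, eta μ μ • curlPart μ (μ ::ₘ I) = 0 := by
  have h : ∀ ρ L, ∑ μ, eta μ μ • clsF ρ μ (μ ::ₘ L) = 0 := fun ρ L => by
    have := clsF_div ρ L
    simp only [clsF_antisymm _ ρ, smul_neg, Finset.sum_neg_distrib, neg_eq_zero] at this
    exact this
  simp only [curlPart, msum_cons, clsF_self, zero_add, sum_smul_msum, h, msum_zero']

/-- Removing μ or ν contributes F_{μν;K} twice. In the other terms the Bianchi identity moves ρ
behind μν, and Euler's formula contributes card K more. With card J = card K + 1, this is the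
normalization 1/(card J + 1) in `vSymbol`. -/
theorem curlPart_curl (μ ν : Fin 4) (K : Multiset (Fin 4)) :
    curlPart ν (μ ::ₘ K) - curlPart μ (ν ::ₘ K) = ((Multiset.card K : ℂ) + 2) • clsF μ ν K := by
  have h : ∀ ρ L, clsF ρ ν (μ ::ₘ L) + (-1 : ℂ) • clsF ρ μ (ν ::ₘ L) = clsF μ ν (ρ ::ₘ L) :=
    fun ρ L => by
      have h := clsF_bianchi μ ν ρ L
      rw [clsF_antisymm ν ρ] at h
      rw [neg_one_smul, ← sub_eq_zero, ← neg_eq_zero, ← h]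
      abel
  have h2 := msum_add (fun ρ L => clsF ρ ν (μ ::ₘ L)) (fun ρ L => (-1 : ℂ) • clsF ρ μ (ν ::ₘ L)) K
  simp only [h, msum_smul] at h2
  rw [msum_euler] at h2
  rw [curlPart, curlPart, msum_cons, msum_cons, clsF_antisymm ν μ, add_smul, h2, two_smul,
    neg_one_smul]
  abel

theorem etaPhi_trace (μ : Fin 4) (K : Multiset (Fin 4)) :
    ∑ κ, eta κ κ • etaPhi μ (κ ::ₘ κ ::ₘ K) = (2 : ℂ) • clsPhi (μ ::ₘ K) := by
  have h : ∀ ρ L, ∑ κ, eta κ κ • eta μ ρ • clsPhi (κ ::ₘ κ ::ₘ L) = 0 := fun ρ L => by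
    simp only [smul_comm _ (eta μ ρ), ← Finset.smul_sum, clsPhi_trace, smul_zero]
  simp only [etaPhi, msum_cons_cons, smul_add, Finset.sum_add_distrib, sum_smul_msum, h,
    msum_zero', smul_comm _ (2 : ℂ), ← Finset.smul_sum, add_zero]
  rw [sum_eta_mul' μ fun κ => clsPhi (κ ::ₘ K)]

theorem etaPhi_div (I : Multiset (Fin 4)) :
    ∑ μ, eta μ μ • etaPhi μ (μ ::ₘ I) = ((Multiset.card I : ℂ) + 4) • clsPhi I := by
  have h : ∀ ρ L, ∑ μ, eta μ μ • eta μ ρ • clsPhi (μ ::ₘ L) = clsPhi (ρ ::ₘ L) := fun ρ L =>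
    sum_eta_mul ρ fun κ => clsPhi (κ ::ₘ L)
  simp only [etaPhi, msum_cons, smul_add, Finset.sum_add_distrib, sum_smul_msum, h]
  rw [msum_euler, sum_eta_mul_self, add_smul, add_comm]

theorem etaEtaPhi_trace (μ : Fin 4) (K : Multiset (Fin 4)) :
    ∑ κ, eta κ κ • etaEtaPhi μ (κ ::ₘ κ ::ₘ K) =
      (4 * ((Multiset.card K : ℂ) + 2)) • clsPhi (μ ::ₘ K) := by
  have e1 : ∀ ρ L, ∑ κ, eta κ κ • eta ρ κ • clsPhi (μ ::ₘ κ ::ₘ L) = clsPhi (μ ::ₘ ρ ::ₘ L) :=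
    fun ρ L => sum_eta_mul' ρ fun κ => clsPhi (μ ::ₘ κ ::ₘ L)
  have e2 : ∀ ρ L, ∑ κ, eta κ κ • eta κ ρ • clsPhi (μ ::ₘ κ ::ₘ L) = clsPhi (μ ::ₘ ρ ::ₘ L) :=
    fun ρ L => sum_eta_mul ρ fun κ => clsPhi (μ ::ₘ κ ::ₘ L)
  have e3 : ∀ ρ σ L, ∑ κ, eta κ κ • eta ρ σ • clsPhi (μ ::ₘ κ ::ₘ κ ::ₘ L) = 0 := fun ρ σ L => by
    have h := clsPhi_trace (μ ::ₘ L)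
    simp only [smul_comm _ (eta ρ σ), ← Finset.smul_sum]
    rw [← smul_zero (eta ρ σ), ← h]
    congr 1
    refine Finset.sum_congr rfl fun κ _ => ?_
    rw [Multiset.cons_swap μ κ, Multiset.cons_swap μ κ]
  have e4 : ∀ L, msum (fun ρ L => clsPhi (μ ::ₘ ρ ::ₘ L)) L =
      (Multiset.card L : ℂ) • clsPhi (μ ::ₘ L) := fun L => msum_euler (fun L => clsPhi (μ ::ₘ L)) L
  simp only [etaEtaPhi, msum_cons, smul_add, Finset.sum_add_distrib, sum_smul_msum, e1, e2, e3,
    msum_add, msum_zero', e4, sum_eta_mul_self, add_zero]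
  simp only [← add_smul]
  congr 1
  ring

theorem etaEtaPhi_div (I : Multiset (Fin 4)) :
    ∑ μ, eta μ μ • etaEtaPhi μ (μ ::ₘ I) = (2 * (Multiset.card I : ℂ)) • clsPhi I := by
  have e1 : ∀ ρ L, ∑ μ, eta μ μ • eta μ ρ • clsPhi (μ ::ₘ L) = clsPhi (ρ ::ₘ L) := fun ρ L =>
    sum_eta_mul ρ fun κ => clsPhi (κ ::ₘ L)
  have e2 : ∀ ρ L, ∑ μ, eta μ μ • eta ρ μ • clsPhi (μ ::ₘ L) = clsPhi (ρ ::ₘ L) := fun ρ L =>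
    sum_eta_mul' ρ fun κ => clsPhi (κ ::ₘ L)
  have e3 : ∀ ρ σ L, ∑ κ, eta κ κ • eta ρ σ • clsPhi (κ ::ₘ κ ::ₘ L) = 0 := fun ρ σ L => by
    simp only [smul_comm _ (eta ρ σ), ← Finset.smul_sum, clsPhi_trace, smul_zero]
  simp only [etaEtaPhi, msum_cons, smul_add, Finset.sum_add_distrib, sum_smul_msum, e1, e2, e3,
    msum_add, msum_zero', msum_euler, add_zero, ← add_smul]
  congr 1
  ring

/-- The image of `v_{μ;J}` up to lower order terms. -/
noncomputable def vSymbol (m : ℝ) (μ : Fin 4) (J : Multiset (Fin 4)) : FormalP0 :=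
  ((Multiset.card J : ℂ) + 1)⁻¹ • curlPart μ J +
    (-(m : ℂ) * (Multiset.card J : ℂ) / ((Multiset.card J : ℂ) + 1) ^ 2) •
      (etaPhi μ J - (2 * (Multiset.card J : ℂ))⁻¹ • etaEtaPhi μ J)

/-- The massless equation. For card J = card K + 2 the traces of `etaPhi` and `etaEtaPhi` are 2 and
4(card K + 2) times the same φ; this fixes the relative coefficient 1/(2 card J). -/
theorem vSymbol_trace (m : ℝ) (μ : Fin 4) (K : Multiset (Fin 4)) :
    ∑ κ, eta κ κ • vSymbol m μ (κ ::ₘ κ ::ₘ K) = 0 := by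
  have h : (2 : ℂ) - (2 * ((Multiset.card K : ℂ) + 1 + 1))⁻¹ * (4 * ((Multiset.card K : ℂ) + 2)) =
      0 := by
    have : (Multiset.card K : ℂ) + 2 ≠ 0 := by norm_cast
    have h3 : (Multiset.card K : ℂ) + 1 + 1 = (Multiset.card K : ℂ) + 2 := by ring
    rw [h3]
    field_simp
    ring
  simp only [vSymbol, Multiset.card_cons, smul_add, smul_sub, Finset.sum_add_distrib,
    Finset.sum_sub_distrib, smul_comm (eta _ _), ← Finset.smul_sum, curlPart_trace, etaPhi_trace,
    etaEtaPhi_trace, smul_zero, zero_add]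
  rw [← smul_sub, smul_smul _ (4 * _), ← sub_smul]
  push_cast
  rw [h, zero_smul, smul_zero]

/-- With n = card I and card J = n + 1, the bracket has divergence (n + 4) - 2n/(2(n + 1)) = (n +
2)²/(n + 1) times φ; the prefactor -m card J/(card J + 1)² is chosen to leave -m. -/
theorem vSymbol_div (m : ℝ) {I : Multiset (Fin 4)} :
    ∑ μ, eta μ μ • vSymbol m μ (μ ::ₘ I) = (-(m : ℂ)) • clsPhi I := by
  have h1 : (Multiset.card I : ℂ) + 1 ≠ 0 := by norm_cast
  have h2 : (Multiset.card I : ℂ) + 1 + 1 ≠ 0 := by norm_cast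
  simp only [vSymbol, Multiset.card_cons, smul_add, smul_sub, Finset.sum_add_distrib,
    Finset.sum_sub_distrib, smul_comm (eta _ _), ← Finset.smul_sum, curlPart_div, etaPhi_div,
    etaEtaPhi_div, smul_zero, zero_add]
  rw [← smul_sub, smul_smul _ (2 * _), ← sub_smul, smul_smul]
  push_cast
  congr 1
  field_simp
  ring

/-- The curl reproduces F up to φ's with card K indices, whose weight 2 card K + 2 is one below that
of F. The value of c is irrelevant. -/
theorem vSymbol_curl (m : ℝ) (μ ν : Fin 4) (K : Multiset (Fin 4)) :
    ∃ c : ℂ, vSymbol m ν (μ ::ₘ K) - vSymbol m μ (ν ::ₘ K) = clsF μ ν K +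
      c • ((etaPhi ν (μ ::ₘ K) - (2 * ((Multiset.card K : ℂ) + 1))⁻¹ • etaEtaPhi ν (μ ::ₘ K)) -
        (etaPhi μ (ν ::ₘ K) - (2 * ((Multiset.card K : ℂ) + 1))⁻¹ • etaEtaPhi μ (ν ::ₘ K))) := by
  have h2 : (Multiset.card K : ℂ) + 2 ≠ 0 := by norm_cast
  have h : clsF μ ν K = ((Multiset.card K : ℂ) + 1 + 1)⁻¹ •
      (curlPart ν (μ ::ₘ K) - curlPart μ (ν ::ₘ K)) := by
    rw [curlPart_curl, smul_smul, add_assoc, one_add_one_eq_two, inv_mul_cancel₀ h2, one_smul]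
  refine ⟨-(m : ℂ) * ((Multiset.card K : ℂ) + 1) / ((Multiset.card K : ℂ) + 1 + 1) ^ 2, ?_⟩
  rw [h, vSymbol, vSymbol, Multiset.card_cons, Multiset.card_cons, add_sub_add_comm, ← smul_sub,
    ← smul_sub]
  push_cast
  rfl

/-! ## Weights of the symbols -/

/-- A weight which orders the symbols by the number of derivatives in their leading terms. -/
def Sym0.weight : Sym0 → ℕ
  | .F n _ => 2 * n + 3
  | .phi n _ => 2 * n + 4

/-- The span of the symbols of weight `≤ w`. -/
noncomputable def symLE (w : ℕ) : Submodule ℂ FormalP0 :=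
  Submodule.span ℂ {a | ∃ s : Sym0, s.weight ≤ w ∧ s.cls = a}

theorem symLE_mono {w w' : ℕ} (h : w ≤ w') : symLE w ≤ symLE w' :=
  Submodule.span_mono fun _ ⟨s, hs, e⟩ => ⟨s, hs.trans h, e⟩

theorem clsF_mem (μ ν : Fin 4) (K : Multiset (Fin 4)) {w : ℕ}
    (h : 2 * Multiset.card K + 3 ≤ w) : clsF μ ν K ∈ symLE w := by
  obtain ⟨n, f, rfl⟩ := exists_eq_idx K
  rw [← cls_F_vecCons]
  rw [card_idx] at h
  exact Submodule.subset_span ⟨.F n _, h, rfl⟩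

theorem clsPhi_mem (K : Multiset (Fin 4)) {w : ℕ}
    (h : 2 * Multiset.card K + 2 ≤ w) : clsPhi K ∈ symLE w := by
  obtain ⟨n, f, rfl⟩ := exists_eq_idx K
  rw [card_idx] at h
  cases n with
  | zero =>
    rw [clsPhi, dif_pos]
    · exact Submodule.zero_mem _
    · rw [← Multiset.card_eq_zero, card_idx]
  | succ n =>
    rw [← cls_phi]
    exact Submodule.subset_span ⟨_, by simp only [Sym0.weight]; omega, rfl⟩

theorem card_erase_add_one {ρ : Fin 4} {J : Multiset (Fin 4)} (h : ρ ∈ J) :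
    Multiset.card (J.erase ρ) + 1 = Multiset.card J := Multiset.card_erase_add_one h

theorem curlPart_mem (μ : Fin 4) (J : Multiset (Fin 4)) {w : ℕ}
    (h : 2 * Multiset.card J + 1 ≤ w) : curlPart μ J ∈ symLE w :=
  msum_mem fun ρ hρ => clsF_mem _ _ _ (by have := card_erase_add_one hρ; omega)

theorem etaPhi_mem (μ : Fin 4) (J : Multiset (Fin 4)) {w : ℕ}
    (h : 2 * Multiset.card J ≤ w) : etaPhi μ J ∈ symLE w :=
  msum_mem fun ρ hρ => Submodule.smul_mem _ _
    (clsPhi_mem _ (by have := card_erase_add_one hρ; omega))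

theorem etaEtaPhi_mem (μ : Fin 4) (J : Multiset (Fin 4)) {w : ℕ}
    (h : 2 * Multiset.card J ≤ w) : etaEtaPhi μ J ∈ symLE w :=
  msum_mem fun ρ hρ => msum_mem fun σ hσ => Submodule.smul_mem _ _
    (clsPhi_mem _ (by
      have h1 := card_erase_add_one hρ
      have h2 := card_erase_add_one hσ
      rw [Multiset.card_cons]; omega))

theorem vSymbol_mem (m : ℝ) (μ : Fin 4) (J : Multiset (Fin 4)) {w : ℕ}
    (h : 2 * Multiset.card J + 1 ≤ w) : vSymbol m μ J ∈ symLE w :=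
  Submodule.add_mem _ (Submodule.smul_mem _ _ (curlPart_mem _ _ h))
    (Submodule.smul_mem _ _ (Submodule.sub_mem _ (etaPhi_mem _ _ (by omega))
      (Submodule.smul_mem _ _ (etaEtaPhi_mem _ _ (by omega)))))

/-- The image of `v_{μ;J}`. -/
noncomputable def vImage (m : ℝ) (μ : Fin 4) : Multiset (Fin 4) → FormalP0 :=
  kgExtend m (vSymbol m μ)

/-- The two agree on the initial data and solve the massive and the massless equation, respectively.
They differ by mass terms with two derivatives fewer, which lowers the weight. -/
theorem vImage_sub_vSymbol (m : ℝ) (μ : Fin 4) (J : Multiset (Fin 4)) :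
    vImage m μ J - vSymbol m μ J ∈ symLE (2 * Multiset.card J - 1) := by
  induction J using time_induction with
  | h1 J h => rw [vImage, kgExtend_of_lt m _ h, sub_self]; exact Submodule.zero_mem _
  | h2 J ih ih' =>
    have e : vImage m μ (0 ::ₘ 0 ::ₘ J) - vSymbol m μ (0 ::ₘ 0 ::ₘ J) =
        (∑ i : Fin 3, (vImage m μ (i.succ ::ₘ i.succ ::ₘ J) -
          vSymbol m μ (i.succ ::ₘ i.succ ::ₘ J))) -
        (m : ℂ) ^ 2 • ((vImage m μ J - vSymbol m μ J) + vSymbol m μ J) := by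
      have h := vSymbol_trace m μ J
      rw [sum_eta_self_smul] at h
      rw [Finset.sum_sub_distrib, ← sub_eq_zero.1 h, vImage, kgExtend_cons_cons, sub_add_cancel]
      abel
    rw [e]
    simp only [Multiset.card_cons] at ih' ⊢
    refine Submodule.sub_mem _ (Submodule.sum_mem _ fun i _ => ih' i) (Submodule.smul_mem _ _
      (Submodule.add_mem _ (symLE_mono (by omega) ih) (vSymbol_mem _ _ _ (by omega))))

theorem vImage_mem (m : ℝ) (μ : Fin 4) (J : Multiset (Fin 4)) {w : ℕ}
    (h : 2 * Multiset.card J + 1 ≤ w) : vImage m μ J ∈ symLE w := by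
  rw [← sub_add_cancel (vImage m μ J) (vSymbol m μ J)]
  exact Submodule.add_mem _ (symLE_mono (by omega) (vImage_sub_vSymbol m μ J))
    (vSymbol_mem _ _ _ h)

/-- The images of the jet variables in the formal polynomials. -/
noncomputable def jetImage (m : ℝ) : Jet → FormalP0
  | (.v μ, J) => vImage m μ J
  | (.Phi, J) => (-(m : ℂ)⁻¹) • ∑ μ, eta μ μ • vImage m μ (μ ::ₘ J)
  | (.u, _) => 0
  | (.ut, _) => 0

theorem jetImage_kleinGordon (m : ℝ) (α : Fld) :
    KleinGordon m fun J => jetImage m (α, J) := by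
  cases α with
  | v μ => exact kleinGordon_kgExtend m _
  | Phi =>
    intro J
    -- Each derivative of a solution is a solution, hence so is the divergence that represents Φ.
    have h : ∀ μ, ∑ κ, eta κ κ • vImage m μ (μ ::ₘ κ ::ₘ κ ::ₘ J) =
        - ((m : ℂ) ^ 2 • vImage m μ (μ ::ₘ J)) := fun μ => by
      rw [eq_neg_iff_add_eq_zero, ← kleinGordon_kgExtend m (vSymbol m μ) (μ ::ₘ J)]
      congr 1
      refine Finset.sum_congr rfl fun κ _ => ?_
      rw [Multiset.cons_swap μ κ, Multiset.cons_swap μ κ]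
      rfl
    have e : ∀ μ, ∑ κ, eta κ κ • eta μ μ • vImage m μ (μ ::ₘ κ ::ₘ κ ::ₘ J) =
        - ((m : ℂ) ^ 2 • eta μ μ • vImage m μ (μ ::ₘ J)) := fun μ => by
      simp only [smul_comm _ (eta μ μ), ← Finset.smul_sum, h, smul_neg]
    simp only [jetImage, smul_comm _ (-(m : ℂ)⁻¹), ← Finset.smul_sum, ← smul_add]
    simp only [Finset.smul_sum (f := fun _ => _ • vImage _ _ _)]
    rw [Finset.sum_comm]
    simp only [e, Finset.sum_neg_distrib, neg_add_cancel, smul_zero]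
  | u => intro J; simp [jetImage]
  | ut => intro J; simp [jetImage]

/-- The target is commutative and the odd variables go to zero, so no sign survives. -/
theorem jetImage_rel (m : ℝ) ⦃x y : FreeAlgebra ℂ Jet⦄ (h : Rel m x y) :
    FreeAlgebra.lift ℂ (jetImage m) x = FreeAlgebra.lift ℂ (jetImage m) y := by
  induction h with
  | comm a b =>
    obtain ⟨α, J⟩ := a
    obtain ⟨β, K⟩ := b
    cases α <;> cases β <;> simp [Fld.parity, jetImage, mul_comm]
  | kleinGordon α J =>
    simpa using jetImage_kleinGordon m α J

/-- The algebra homomorphism from `𝒫` to the formal polynomials. -/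
noncomputable def toFormal (m : ℝ) : Poly m →ₐ[ℂ] FormalP0 :=
  Poly.lift m (jetImage m) (jetImage_rel m)

@[simp]
theorem toFormal_jet (m : ℝ) (a : Jet) : toFormal m (jet m a) = jetImage m a := by
  rw [toFormal, jet, Poly.lift_mk, FreeAlgebra.lift_ι_apply]

/-- The image of Φ was defined for this purpose; dividing by m requires m ≠ 0. -/
theorem toFormal_Cjet {m : ℝ} (hm : m ≠ 0) (J : Multiset (Fin 4)) :
    toFormal m (Cjet m J) = 0 := by
  have : (m : ℂ) ≠ 0 := by exact_mod_cast hm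
  rw [Cjet, map_add, map_sum]
  simp only [map_smul, toFormal_jet, jetImage]
  rw [smul_smul, mul_neg, mul_inv_cancel₀ this, neg_one_smul, add_neg_cancel]

/-- On variables, d_Q produces only derivatives of u and of C, all of which are killed; the Leibniz
rule extends this to 𝒫. -/
theorem toFormal_dQ {m : ℝ} (hm : m ≠ 0) (p : Poly m) : toFormal m (dQ m p) = 0 := by
  induction p using poly_induction m with
  | h1 c => simp [dQ_algebraMap]
  | hj a =>
    obtain ⟨α, J⟩ := a
    rw [dQ_jet]
    cases α <;> simp [dQGen, jetImage, toFormal_Cjet hm]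
  | hm p q hp hq => simp [dQ_mul, hp, hq]
  | ha p q hp hq => simp [hp, hq]

/-! ## Filtrations by weight -/

section WeightLE

variable {G G' A : Type} [Semiring A] [Algebra ℂ A] {gen : G → A} {w : G → ℕ}
  {gen' : G' → A} {w' : G' → ℕ}

theorem prod_mem_weightLE (L : List G) : (L.map gen).prod ∈ weightLE gen w ((L.map w).sum : ℕ) :=
  Submodule.subset_span ⟨L, le_rfl, rfl⟩

theorem weightLE_mono {i j : ℤ} (h : i ≤ j) : weightLE gen w i ≤ weightLE gen w j :=
  Submodule.span_mono fun _ ⟨L, hL, e⟩ => ⟨L, hL.trans h, e⟩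

theorem gen_mem_weightLE (g : G) : gen g ∈ weightLE gen w (w g) := by
  simpa using prod_mem_weightLE (gen := gen) (w := w) [g]

theorem one_mem_weightLE : (1 : A) ∈ weightLE gen w 0 := by
  simpa using prod_mem_weightLE (gen := gen) (w := w) []

theorem mul_mem_weightLE {a b : A} {i j : ℤ} (ha : a ∈ weightLE gen w i)
    (hb : b ∈ weightLE gen w j) : a * b ∈ weightLE gen w (i + j) := by
  induction ha using Submodule.span_induction with
  | mem a ha =>
    obtain ⟨L, hL, rfl⟩ := ha
    induction hb using Submodule.span_induction with
    | mem b hb =>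
      obtain ⟨L', hL', rfl⟩ := hb
      refine Submodule.subset_span ⟨L ++ L', ?_, by simp⟩
      simp only [List.map_append, List.sum_append]
      omega
    | zero => simp
    | add x y _ _ hx hy => rw [mul_add]; exact Submodule.add_mem _ hx hy
    | smul c x _ hx => rw [mul_smul_comm]; exact Submodule.smul_mem _ _ hx
  | zero => simp
  | add x y _ _ hx hy => rw [add_mul]; exact Submodule.add_mem _ hx hy
  | smul c x _ hx => rw [smul_mul_assoc]; exact Submodule.smul_mem _ _ hx

theorem weightLE_le_of_gen (h : ∀ g, gen' g ∈ weightLE gen w (w' g)) (n : ℤ) :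
    weightLE gen' w' n ≤ weightLE gen w n := by
  refine Submodule.span_le.2 ?_
  rintro _ ⟨L, hL, rfl⟩
  refine weightLE_mono hL ?_
  clear hL
  induction L with
  | nil => simpa using one_mem_weightLE
  | cons g L ih =>
    simp only [List.map_cons, List.prod_cons, List.sum_cons]
    push_cast
    exact mul_mem_weightLE (h g) (by exact_mod_cast ih)

theorem map_weightLE {B : Type} [Semiring B] [Algebra ℂ B] (f : A →ₐ[ℂ] B) {a : A} {n : ℤ}
    (ha : a ∈ weightLE gen w n) : f a ∈ weightLE (fun g => f (gen g)) w n := by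
  induction ha using Submodule.span_induction with
  | mem a ha =>
    obtain ⟨L, hL, rfl⟩ := ha
    refine Submodule.subset_span ⟨L, hL, ?_⟩
    rw [map_list_prod, List.map_map]
    rfl
  | zero => simp
  | add x y _ _ hx hy => rw [map_add]; exact Submodule.add_mem _ hx hy
  | smul c x _ hx => rw [map_smul]; exact Submodule.smul_mem _ _ hx

theorem weightLE_of_neg {n : ℤ} (hn : n < 0) : weightLE gen w n = ⊥ := by
  rw [weightLE, Submodule.span_eq_bot]
  rintro _ ⟨L, hL, rfl⟩
  exact absurd hL (by omega)

theorem exists_mem_weightLE (h : Algebra.adjoin ℂ (Set.range gen) = ⊤) (a : A) :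
    ∃ n : ℕ, a ∈ weightLE gen w n := by
  have ha : a ∈ Algebra.adjoin ℂ (Set.range gen) := h ▸ Algebra.mem_top
  induction ha using Algebra.adjoin_induction with
  | mem x hx => obtain ⟨g, rfl⟩ := hx; exact ⟨_, gen_mem_weightLE g⟩
  | algebraMap r =>
    refine ⟨0, ?_⟩
    rw [Algebra.algebraMap_eq_smul_one]
    exact Submodule.smul_mem _ _ one_mem_weightLE
  | add x y _ _ hx hy =>
    obtain ⟨i, hi⟩ := hx
    obtain ⟨j, hj⟩ := hy
    exact ⟨max i j, Submodule.add_mem _ (weightLE_mono (by simp) hi)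
      (weightLE_mono (by simp) hj)⟩
  | mul x y _ _ hx hy =>
    obtain ⟨i, hi⟩ := hx
    obtain ⟨j, hj⟩ := hy
    exact ⟨i + j, by push_cast; exact mul_mem_weightLE hi hj⟩

end WeightLE

/-! ## The embedding of the formal polynomials -/

/-- The linear combinations of jet variables of parity `ε`. -/
noncomputable def parityPart (m : ℝ) (ε : ℕ) : Submodule ℂ (JetSpace m) :=
  Submodule.span ℂ {x | ∃ a : Jet, a.1.parity = ε ∧ jv m a = x}

theorem jv_mem_parityPart (m : ℝ) (a : Jet) : jv m a ∈ parityPart m a.1.parity :=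
  Submodule.subset_span ⟨a, rfl, rfl⟩

theorem toPoly_mul_jet {m : ℝ} {ε : ℕ} {x : JetSpace m} (hx : x ∈ parityPart m ε) (b : Jet) :
    toPoly m x * jet m b = (-1 : ℂ) ^ (ε * b.1.parity) • (jet m b * toPoly m x) := by
  induction hx using Submodule.span_induction with
  | mem x hx =>
    obtain ⟨a, rfl, rfl⟩ := hx
    simpa using jet_comm m a b
  | zero => simp
  | add x y _ _ hx hy => rw [map_add, add_mul, mul_add, hx, hy, smul_add]
  | smul c x _ hx => rw [map_smul, smul_mul_assoc, hx, mul_smul_comm, smul_comm]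

/-- Even elements commute with everything. Evaluation of commutative polynomials needs a commutative
target, and the center of 𝒫 serves as one. -/
theorem toPoly_mem_center {m : ℝ} {x : JetSpace m} (hx : x ∈ parityPart m 0) :
    toPoly m x ∈ Subalgebra.center ℂ (Poly m) := by
  rw [Subalgebra.mem_center_iff]
  intro p
  induction p using poly_induction m with
  | h1 c => exact Algebra.commutes c _
  | hj a => have h := toPoly_mul_jet hx a; simpa using h.symm
  | hm p q hp hq => rw [mul_assoc, hq, ← mul_assoc, hp, mul_assoc]
  | ha p q hp hq => rw [add_mul, mul_add, hp, hq]

/-- The tensor `F` in the space of jet variables. -/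
noncomputable def fieldStrengthV (m : ℝ) (n : ℕ) (I : Fin (n + 2) → Fin 4) : JetSpace m :=
  jv m (.v (I 1), I 0 ::ₘ idx fun l : Fin n => I l.succ.succ) -
    jv m (.v (I 0), I 1 ::ₘ idx fun l : Fin n => I l.succ.succ)

/-- The tensor `g` in the space of jet variables. -/
noncomputable def gTensorV (m : ℝ) (n : ℕ) (I : Fin n → Fin 4) : JetSpace m :=
  (n : ℂ)⁻¹ • ∑ l, jv m (.v (I l), (Finset.univ.erase l).val.map I)

/-- The tensor `φ` in the space of jet variables. -/
noncomputable def phiTensorV (m : ℝ) (n : ℕ) (I : Fin n → Fin 4) : JetSpace m :=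
  jv m (.Phi, idx I) - (m : ℂ) • gTensorV m n I

/-- The component of a traceless part denoted by a symbol, in the space of jet variables. -/
noncomputable def Sym0.valV (m : ℝ) : Sym0 → JetSpace m
  | .F n I => tlProj (fieldStrengthV m n) I
  | .phi n I => tlProj (phiTensorV m (n + 1)) I

theorem toPoly_fieldStrengthV (m : ℝ) (n : ℕ) :
    (fun I => toPoly m (fieldStrengthV m n I)) = fieldStrength m n := by
  funext I
  simp [fieldStrengthV, fieldStrength]

theorem toPoly_phiTensorV (m : ℝ) (n : ℕ) :
    (fun I => toPoly m (phiTensorV m n I)) = phiTensor m n := by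
  funext I
  simp only [phiTensorV, phiTensor, gTensorV, gTensor, map_sub, map_smul, map_sum, toPoly_jv]

theorem isTracelessPart_tlProj {m : ℝ} {k : ℕ} (T : Tensor m k) :
    IsTracelessPart T (tlProj T) :=
  ⟨tlProj_traceless T, sub_tlProj_traceForm T⟩

theorem IsTracelessPart.eq_tlProj {m : ℝ} {k : ℕ} {T T₀ : Tensor m k}
    (h : IsTracelessPart T T₀) : T₀ = tlProj T := (tlProj_unique h.1 h.2).symm

theorem existsUnique_isTracelessPart {m : ℝ} {k : ℕ} (T : Tensor m k) :
    ∃! T₀, IsTracelessPart T T₀ :=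
  ⟨tlProj T, isTracelessPart_tlProj T, fun _ h => h.eq_tlProj⟩

theorem tracelessPart_eq_tlProj {m : ℝ} {k : ℕ} (T : Tensor m k) :
    tracelessPart T = tlProj T := by
  have h : ∃ T₀, IsTracelessPart T T₀ := ⟨_, isTracelessPart_tlProj T⟩
  rw [tracelessPart, dif_pos h]
  exact h.choose_spec.eq_tlProj

theorem toPoly_valV (m : ℝ) (s : Sym0) : toPoly m (s.valV m) = s.val m := by
  cases s with
  | F n I => rw [Sym0.valV, map_tlProj, toPoly_fieldStrengthV, Sym0.val, tracelessPart_eq_tlProj]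
  | phi n I => rw [Sym0.valV, map_tlProj, toPoly_phiTensorV, Sym0.val, tracelessPart_eq_tlProj]

theorem jv_v_mem (m : ℝ) (μ : Fin 4) (J : Multiset (Fin 4)) :
    jv m (.v μ, J) ∈ parityPart m 0 := jv_mem_parityPart m (.v μ, J)

theorem jv_Phi_mem (m : ℝ) (J : Multiset (Fin 4)) :
    jv m (.Phi, J) ∈ parityPart m 0 := jv_mem_parityPart m (.Phi, J)

theorem valV_mem_parityPart (m : ℝ) (s : Sym0) : s.valV m ∈ parityPart m 0 := by
  cases s with
  | F n I =>
    refine tlProj_mem (T := fieldStrengthV m n) (fun I => ?_) I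
    exact Submodule.sub_mem _ (jv_v_mem m _ _) (jv_v_mem m _ _)
  | phi n I =>
    refine tlProj_mem (T := phiTensorV m (n + 1)) (fun I => ?_) I
    refine Submodule.sub_mem _ (jv_Phi_mem m _) (Submodule.smul_mem _ _ (Submodule.smul_mem _ _ ?_))
    exact Submodule.sum_mem _ fun l _ => jv_v_mem m _ _

theorem val_mem_center (m : ℝ) (s : Sym0) : s.val m ∈ Subalgebra.center ℂ (Poly m) := by
  rw [← toPoly_valV]
  exact toPoly_mem_center (valV_mem_parityPart m s)

/-! ### The formal relations hold in 𝒫 -/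

theorem map_erase_comp_swap {k : ℕ} (I : Fin k → Fin 4) (σ : Equiv.Perm (Fin k)) (l : Fin k) :
    (Finset.univ.erase l).val.map (I ∘ σ) = (Finset.univ.erase (σ l)).val.map I := by
  rw [← Multiset.map_map]
  congr 1
  have h : (Finset.univ.erase l).map σ.toEmbedding = Finset.univ.erase (σ l) := by
    ext x
    simp [← Equiv.symm_apply_eq]
  rw [← h]
  rfl

theorem val_F_antisymm (m : ℝ) (n : ℕ) (I : Fin (n + 2) → Fin 4) :
    (Sym0.F n I).val m + (Sym0.F n (I ∘ Equiv.swap 0 1)).val m = 0 := by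
  simp only [Sym0.val, tracelessPart_eq_tlProj]
  rw [← tlProj_comp_perm, ← tlProj_add]
  refine Eq.trans (congrFun (congrArg tlProj (funext fun J => ?_)) I) (tlProj_zero I)
  have h : ∀ l : Fin n, Equiv.swap (0 : Fin (n + 2)) 1 l.succ.succ = l.succ.succ := fun l =>
    Equiv.swap_apply_of_ne_of_ne (Fin.succ_ne_zero _) (by simp [Fin.ext_iff])
  simp [fieldStrength, h]

theorem val_F_symm (m : ℝ) (n : ℕ) (I : Fin (n + 2) → Fin 4) (i j : Fin n) :
    (Sym0.F n I).val m = (Sym0.F n (I ∘ Equiv.swap i.succ.succ j.succ.succ)).val m := by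
  simp only [Sym0.val, tracelessPart_eq_tlProj]
  rw [← tlProj_comp_perm]
  congr 1
  funext J
  have h0 : Equiv.swap i.succ.succ j.succ.succ 0 = 0 :=
    Equiv.swap_apply_of_ne_of_ne (Fin.succ_ne_zero _).symm (Fin.succ_ne_zero _).symm
  have h1 : Equiv.swap i.succ.succ j.succ.succ 1 = 1 :=
    Equiv.swap_apply_of_ne_of_ne (by simp [Fin.ext_iff]) (by simp [Fin.ext_iff])
  have h2 : (fun l : Fin n => (J ∘ Equiv.swap i.succ.succ j.succ.succ) l.succ.succ) =
      (fun l : Fin n => J l.succ.succ) ∘ Equiv.swap i j := by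
    funext l
    simp only [Function.comp_apply, Equiv.swap_apply_def, Fin.succ_inj]
    split_ifs <;> rfl
  rw [fieldStrength, fieldStrength, h2, idx_comp_perm]
  simp only [Function.comp_apply, h0, h1]

theorem val_phi_symm (m : ℝ) (n : ℕ) (I : Fin (n + 1) → Fin 4) (i j : Fin (n + 1)) :
    (Sym0.phi n I).val m = (Sym0.phi n (I ∘ Equiv.swap i j)).val m := by
  simp only [Sym0.val, tracelessPart_eq_tlProj]
  rw [← tlProj_comp_perm]
  congr 1
  funext J
  rw [phiTensor, phiTensor, idx_comp_perm, gTensor, gTensor]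
  congr 3
  simp only [map_erase_comp_swap]
  exact (Equiv.sum_comp (Equiv.swap i j)
    fun l => jet m (.v (J l), (Finset.univ.erase l).val.map J)).symm

theorem idx_succ {k : ℕ} (f : Fin (k + 1) → Fin 4) : idx f = f 0 ::ₘ idx fun l => f l.succ := by
  rw [← idx_vecCons]
  congr 1
  funext l
  exact Fin.cases rfl (fun l => rfl) l

/-- The three terms are one tensor with its first three indices permuted cyclically. As `tlProj`
commutes with permutations, the identity reduces to the one for F before removal of traces, where
six jet variables cancel in pairs. -/
theorem val_bianchi (m : ℝ) (n : ℕ) (μ ν ρ : Fin 4) (τ : Fin n → Fin 4) :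
    (Sym0.F (n + 1) (Matrix.vecCons μ (Matrix.vecCons ν (Matrix.vecCons ρ τ)))).val m +
    (Sym0.F (n + 1) (Matrix.vecCons ν (Matrix.vecCons ρ (Matrix.vecCons μ τ)))).val m +
    (Sym0.F (n + 1) (Matrix.vecCons ρ (Matrix.vecCons μ (Matrix.vecCons ν τ)))).val m = 0 := by
  obtain ⟨σ, hσ⟩ : ∃ σ, σ = Equiv.swap (0 : Fin (n + 3)) 1 * Equiv.swap 1 (Fin.succ (Fin.succ 0)) :=
    ⟨_, rfl⟩
  have h01 : (0 : Fin (n + 3)) ≠ 1 := by simp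
  have h02 : (0 : Fin (n + 3)) ≠ Fin.succ (Fin.succ 0) := (Fin.succ_ne_zero _).symm
  have h12 : (1 : Fin (n + 3)) ≠ Fin.succ (Fin.succ 0) := by
    simp only [ne_eq, Fin.ext_iff, Fin.val_succ, Fin.val_zero, Fin.val_one]; omega
  have s0 : σ 0 = 1 := by
    rw [hσ, Equiv.Perm.mul_apply, Equiv.swap_apply_of_ne_of_ne h01 h02, Equiv.swap_apply_left]
  have s1 : σ 1 = Fin.succ (Fin.succ 0) := by
    rw [hσ, Equiv.Perm.mul_apply, Equiv.swap_apply_left,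
      Equiv.swap_apply_of_ne_of_ne h02.symm h12.symm]
  have s2 : σ (Fin.succ (Fin.succ 0)) = 0 := by
    rw [hσ, Equiv.Perm.mul_apply, Equiv.swap_apply_right, Equiv.swap_apply_right]
  have s3 : ∀ l : Fin n, σ l.succ.succ.succ = l.succ.succ.succ := fun l => by
    have e1 : l.succ.succ.succ ≠ 1 := by
      simp only [ne_eq, Fin.ext_iff, Fin.val_succ, Fin.val_one]; omega
    have e2 : l.succ.succ.succ ≠ Fin.succ (Fin.succ 0) := by
      simp only [ne_eq, Fin.ext_iff, Fin.val_succ, Fin.val_zero]; omega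
    rw [hσ, Equiv.Perm.mul_apply, Equiv.swap_apply_of_ne_of_ne e1 e2,
      Equiv.swap_apply_of_ne_of_ne (Fin.succ_ne_zero _) e1]
  have hI : ∀ a b c : Fin 4, Matrix.vecCons b (Matrix.vecCons c (Matrix.vecCons a τ)) =
      Matrix.vecCons a (Matrix.vecCons b (Matrix.vecCons c τ)) ∘ σ := fun a b c => by
    funext l
    rw [Function.comp_apply]
    refine Fin.cases ?_ (fun l => Fin.cases ?_ (fun l => Fin.cases ?_ (fun l => ?_) l) l) l
    · rw [s0]; rfl
    · exact (congrArg (Matrix.vecCons a (Matrix.vecCons b (Matrix.vecCons c τ))) s1).symm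
    · rw [s2]; rfl
    · rw [s3]; rfl
  simp only [Sym0.val, tracelessPart_eq_tlProj]
  rw [hI ν ρ μ, hI μ ν ρ, ← tlProj_comp_perm, ← tlProj_comp_perm _ σ, ← tlProj_comp_perm,
    ← tlProj_add, ← tlProj_add]
  refine Eq.trans (congrFun (congrArg tlProj (funext fun J => ?_)) _) (tlProj_zero _)
  have hf : ∀ J : Fin (n + 3) → Fin 4, fieldStrength m (n + 1) J =
      jet m (.v (J 1), J 0 ::ₘ J (Fin.succ (Fin.succ 0)) ::ₘ idx fun l : Fin n => J l.succ.succ.succ) -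
      jet m (.v (J 0), J 1 ::ₘ J (Fin.succ (Fin.succ 0)) ::ₘ idx fun l : Fin n => J l.succ.succ.succ) :=
    fun J => by
      rw [fieldStrength, idx_succ]
  rw [hf, hf, hf]
  simp only [Function.comp_apply, s0, s1, s2, s3]
  rw [Multiset.cons_swap (J 1) (J 0), Multiset.cons_swap (J (Fin.succ (Fin.succ 0))) (J 0),
    Multiset.cons_swap (J (Fin.succ (Fin.succ 0))) (J 1)]
  abel

/-- The evaluation of polynomials in the symbols. -/
noncomputable def evalSym (m : ℝ) : MvPolynomial Sym0 ℂ →ₐ[ℂ] Subalgebra.center ℂ (Poly m) :=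
  MvPolynomial.aeval fun s => ⟨s.val m, val_mem_center m s⟩

theorem evalSym_X (m : ℝ) (s : Sym0) :
    (evalSym m (MvPolynomial.X s) : Poly m) = s.val m := by
  simp [evalSym]

theorem val_F_traceless (m : ℝ) (n : ℕ) : Traceless fun I => (Sym0.F n I).val m := by
  simp only [Sym0.val, tracelessPart_eq_tlProj]
  exact tlProj_traceless _

theorem val_phi_traceless (m : ℝ) (n : ℕ) : Traceless fun I => (Sym0.phi n I).val m := by
  simp only [Sym0.val, tracelessPart_eq_tlProj]
  exact tlProj_traceless _

theorem evalSym_eq_zero (m : ℝ) (x : MvPolynomial Sym0 ℂ) (hx : x ∈ bianchiIdeal) :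
    evalSym m x = 0 := by
  suffices h : bianchiIdeal ≤ RingHom.ker (evalSym m) from h hx
  refine sup_le (Ideal.span_le.2 ?_) (Ideal.span_le.2 ?_)
  · intro f hf
    rw [SetLike.mem_coe, RingHom.mem_ker]
    apply Subtype.ext
    cases hf with
    | F_antisymm n I => simpa [evalSym_X] using val_F_antisymm m n I
    | F_symm n I i j => simpa [evalSym_X, sub_eq_zero] using val_F_symm m n I i j
    | F_trace n I i j h => simpa [evalSym_X] using val_F_traceless m n I i j h
    | phi_symm n I i j => simpa [evalSym_X, sub_eq_zero] using val_phi_symm m n I i j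
    | phi_trace n I i j h => simpa [evalSym_X] using val_phi_traceless m n I i j h
  · intro f hf
    rw [SetLike.mem_coe, RingHom.mem_ker]
    apply Subtype.ext
    cases hf with
    | mk n μ ν ρ τ => simpa [evalSym_X] using val_bianchi m n μ ν ρ τ

/-- The embedding of the formal polynomials into `𝒫`. -/
noncomputable def ofFormal (m : ℝ) : FormalP0 →ₐ[ℂ] Poly m :=
  (Subalgebra.center ℂ (Poly m)).val.comp
    (Ideal.Quotient.liftₐ bianchiIdeal (evalSym m) (evalSym_eq_zero m))

@[simp]
theorem ofFormal_cls (m : ℝ) (s : Sym0) : ofFormal m s.cls = s.val m := by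
  rw [ofFormal, Sym0.cls]
  exact evalSym_X m s

theorem adjoin_cls : Algebra.adjoin ℂ (Set.range Sym0.cls) = ⊤ := by
  have h : Set.range Sym0.cls = Ideal.Quotient.mkₐ ℂ bianchiIdeal ''
      Set.range (MvPolynomial.X (R := ℂ)) := by
    rw [← Set.range_comp]; rfl
  rw [h, ← AlgHom.map_adjoin, MvPolynomial.adjoin_range_X, Algebra.map_top,
    AlgHom.range_eq_top]
  exact Ideal.Quotient.mkₐ_surjective ℂ _

theorem ofFormal_range (m : ℝ) : (ofFormal m).range = P0 m := by
  rw [← Algebra.map_top, ← adjoin_cls, AlgHom.map_adjoin, ← Set.range_comp, P0]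
  congr 2
  funext s
  exact ofFormal_cls m s

/-! ## Injectivity in cohomology -/

/-- Modulo smaller weight, `toFormal` returns each symbol. Linear maps commute with `tlProj`, which
fixes the already traceless symbols, so it suffices to compute with F and φ themselves. -/
theorem toFormal_toPoly_mem {m : ℝ} (hm : m ≠ 0) (s : Sym0) :
    toFormal m (toPoly m (s.valV m)) - s.cls ∈ symLE (s.weight - 1) := by
  have hm' : (m : ℂ) ≠ 0 := by exact_mod_cast hm
  have key : ∀ {k : ℕ} (T : (Fin k → Fin 4) → JetSpace m) (T' : (Fin k → Fin 4) → FormalP0)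
      (w : ℕ), Traceless T' → (∀ I, toFormal m (toPoly m (T I)) - T' I ∈ symLE w) →
      ∀ I, toFormal m (toPoly m (tlProj T I)) - T' I ∈ symLE w := by
    intro k T T' w hT' h I
    have h1 : toFormal m (toPoly m (tlProj T I)) =
        tlProj (fun I => toFormal m (toPoly m (T I))) I :=
      map_tlProj ((toFormal m).toLinearMap ∘ₗ toPoly m) T I
    have h2 := tlProj_mem h I
    simp only [sub_eq_add_neg] at h2
    rw [tlProj_add, tlProj_neg, tlProj_of_traceless hT', ← h1, ← sub_eq_add_neg] at h2
    exact h2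
  cases s with
  | F n I =>
    refine key (fieldStrengthV m n) (fun I => (Sym0.F n I).cls) _ (cls_F_traceless n) (fun I => ?_) I
    simp only [fieldStrengthV, map_sub, toPoly_jv, toFormal_jet, jetImage, Sym0.weight]
    generalize hK : (idx fun l : Fin n => I l.succ.succ) = K
    have hn : Multiset.card K = n := by rw [← hK, card_idx]
    rw [cls_F, hK]
    obtain ⟨c, hc⟩ := vSymbol_curl m (I 0) (I 1) K
    have h1 := vImage_sub_vSymbol m (I 1) (I 0 ::ₘ K)
    have h2 := vImage_sub_vSymbol m (I 0) (I 1 ::ₘ K)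
    rw [Multiset.card_cons] at h1 h2
    have e : vImage m (I 1) (I 0 ::ₘ K) - vImage m (I 0) (I 1 ::ₘ K) - clsF (I 0) (I 1) K =
        (vImage m (I 1) (I 0 ::ₘ K) - vSymbol m (I 1) (I 0 ::ₘ K)) -
        (vImage m (I 0) (I 1 ::ₘ K) - vSymbol m (I 0) (I 1 ::ₘ K)) +
        ((vSymbol m (I 1) (I 0 ::ₘ K) - vSymbol m (I 0) (I 1 ::ₘ K)) - clsF (I 0) (I 1) K) := by
      abel
    rw [e, hc, add_sub_cancel_left]
    refine Submodule.add_mem _ (Submodule.sub_mem _ (symLE_mono (by omega) h1)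
      (symLE_mono (by omega) h2)) (Submodule.smul_mem _ _ ?_)
    refine Submodule.sub_mem _ (Submodule.sub_mem _ (etaPhi_mem _ _ ?_)
      (Submodule.smul_mem _ _ (etaEtaPhi_mem _ _ ?_))) (Submodule.sub_mem _ (etaPhi_mem _ _ ?_)
      (Submodule.smul_mem _ _ (etaEtaPhi_mem _ _ ?_))) <;>
    · rw [Multiset.card_cons]; omega
  | phi n I =>
    refine key (phiTensorV m (n + 1)) (fun I => (Sym0.phi n I).cls) _ (cls_phi_traceless n)
      (fun I => ?_) I
    simp only [phiTensorV, gTensorV, map_sub, map_smul, map_sum, toPoly_jv, toFormal_jet, jetImage,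
      Sym0.weight]
    have hn : Multiset.card (idx I) = n + 1 := card_idx I
    rw [cls_phi]
    have h := vSymbol_div m (I := idx I)
    -- The leading part of Φ_I is supplied by `vSymbol_div`: the factors -1/m and -m cancel. The
    -- remaining g has one derivative less than Φ_I and contributes smaller weight.
    have e : (-(m : ℂ)⁻¹) • ∑ μ, eta μ μ • vImage m μ (μ ::ₘ idx I) =
        clsPhi (idx I) + (-(m : ℂ)⁻¹) • ∑ μ, eta μ μ •
          (vImage m μ (μ ::ₘ idx I) - vSymbol m μ (μ ::ₘ idx I)) := by
      simp only [smul_sub (eta _ _), Finset.sum_sub_distrib, h]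
      rw [smul_sub, smul_smul, neg_mul_neg, inv_mul_cancel₀ hm', one_smul]
      abel
    have e2 : ∀ x y z : FormalP0, x + y - z - x = y - z := fun x y z => by abel
    rw [e, e2]
    refine Submodule.sub_mem _ (Submodule.smul_mem _ _ (Submodule.sum_mem _ fun μ _ =>
      Submodule.smul_mem _ _ (symLE_mono ?_ (vImage_sub_vSymbol m μ _))))
      (Submodule.smul_mem _ _ (Submodule.smul_mem _ _ (Submodule.sum_mem _ fun l _ =>
      vImage_mem m _ _ ?_)))
    · rw [Multiset.card_cons]; omega
    · rw [Multiset.card_map, Finset.card_val, Finset.card_erase_of_mem (Finset.mem_univ _),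
        Finset.card_univ, Fintype.card_fin]
      omega

theorem symLE_le_weightLE (w : ℕ) : symLE w ≤ weightLE Sym0.cls Sym0.weight w := by
  refine Submodule.span_le.2 ?_
  rintro _ ⟨s, hs, rfl⟩
  exact weightLE_mono (by exact_mod_cast hs) (gen_mem_weightLE s)

/-- Multiplicativity carries the leading-term statement from symbols to monomials: in a telescoped
difference of products one factor has dropped in weight. -/
theorem toFormal_ofFormal_mem {m : ℝ} (hm : m ≠ 0) {n : ℤ} {a : FormalP0}
    (ha : a ∈ weightLE Sym0.cls Sym0.weight n) :
    toFormal m (ofFormal m a) - a ∈ weightLE Sym0.cls Sym0.weight (n - 1) := by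
  have key : ∀ L : List Sym0, toFormal m (ofFormal m (L.map Sym0.cls).prod) - (L.map Sym0.cls).prod
      ∈ weightLE Sym0.cls Sym0.weight (((L.map Sym0.weight).sum : ℕ) - 1) := by
    intro L
    induction L with
    | nil => simp
    | cons s L ih =>
      have h0 : 1 ≤ s.weight := by cases s <;> simp only [Sym0.weight] <;> omega
      have h1 : toFormal m (ofFormal m s.cls) - s.cls ∈
          weightLE Sym0.cls Sym0.weight ((s.weight : ℤ) - 1) := by
        rw [ofFormal_cls, ← toPoly_valV]
        have := symLE_le_weightLE _ (toFormal_toPoly_mem hm s)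
        rwa [Nat.cast_sub h0] at this
      have h2 : toFormal m (ofFormal m (L.map Sym0.cls).prod) ∈
          weightLE Sym0.cls Sym0.weight ((L.map Sym0.weight).sum : ℕ) := by
        rw [← sub_add_cancel (toFormal m (ofFormal m (L.map Sym0.cls).prod)) (L.map Sym0.cls).prod]
        exact Submodule.add_mem _ (weightLE_mono (by omega) ih) (prod_mem_weightLE L)
      simp only [List.map_cons, List.prod_cons, List.sum_cons, map_mul]
      have e : ∀ x y x' y' : FormalP0, x * y - x' * y' = (x - x') * y + x' * (y - y') :=
        fun x y x' y' => by ring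
      rw [e]
      refine Submodule.add_mem _ (weightLE_mono ?_ (mul_mem_weightLE h1 h2))
        (weightLE_mono ?_ (mul_mem_weightLE (gen_mem_weightLE s) ih)) <;> omega
  induction ha using Submodule.span_induction with
  | mem a ha =>
    obtain ⟨L, hL, rfl⟩ := ha
    exact weightLE_mono (by omega) (key L)
  | zero => simp
  | add x y _ _ hx hy =>
    have := Submodule.add_mem _ hx hy
    simp only [map_add]
    rwa [add_sub_add_comm]
  | smul c x _ hx =>
    rw [map_smul, map_smul, ← smul_sub]
    exact Submodule.smul_mem _ _ hx

/-- Subtracting the identity lowers the weight, so an element of the kernel descends through the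
filtration until it vanishes. -/
theorem toFormal_ofFormal_injective {m : ℝ} (hm : m ≠ 0) :
    Function.Injective ((toFormal m).comp (ofFormal m)) := by
  rw [injective_iff_map_eq_zero]
  intro a ha
  -- The shift by one starts the induction at weight -1, where the filtration is zero.
  have key : ∀ n : ℕ, a ∈ weightLE Sym0.cls Sym0.weight ((n : ℤ) - 1) → a = 0 := by
    intro n
    induction n with
    | zero => intro h; simpa [weightLE_of_neg] using h
    | succ n ih =>
      intro h
      have h1 := toFormal_ofFormal_mem hm h
      rw [AlgHom.comp_apply] at ha
      rw [ha, zero_sub, neg_mem_iff] at h1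
      exact ih (by simpa using h1)
  obtain ⟨n, hn⟩ := exists_mem_weightLE (w := Sym0.weight) adjoin_cls a
  exact key (n + 1) (by simpa using hn)

theorem eq_zero_of_ofFormal_eq_dQ {m : ℝ} (hm : m ≠ 0) {a : FormalP0} {q : Poly m}
    (h : ofFormal m a = dQ m q) : a = 0 := by
  refine (injective_iff_map_eq_zero _).1 (toFormal_ofFormal_injective hm) a ?_
  rw [AlgHom.comp_apply, h, toFormal_dQ hm]

/-! ### The traceless parts are cocycles -/

theorem cons_map_erase {k : ℕ} (I : Fin k → Fin 4) (l : Fin k) :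
    I l ::ₘ (Finset.univ.erase l).val.map I = idx I := by
  rw [idx, ← Multiset.map_cons, Finset.erase_val, Multiset.cons_erase (Finset.mem_univ l)]

theorem dQ_fieldStrength (m : ℝ) (n : ℕ) (I : Fin (n + 2) → Fin 4) :
    dQ m (fieldStrength m n I) = 0 := by
  simp only [fieldStrength, map_sub, dQ_jet, dQGen]
  rw [Multiset.cons_swap, sub_self]

/-- d_Q sends every summand of g to the same i u_I, so the average cancels against d_Q of Φ_I after
multiplication by m. -/
theorem dQ_phiTensor (m : ℝ) (n : ℕ) (I : Fin (n + 1) → Fin 4) :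
    dQ m (phiTensor m (n + 1) I) = 0 := by
  simp only [phiTensor, gTensor, map_sub, map_smul, map_sum, dQ_jet, dQGen, cons_map_erase]
  have h : ((n + 1 : ℕ) : ℂ) ≠ 0 := by exact_mod_cast Nat.succ_ne_zero n
  rw [Finset.sum_const, Finset.card_univ, Fintype.card_fin, ← Nat.cast_smul_eq_nsmul ℂ,
    inv_smul_smul₀ h, smul_smul, mul_comm, sub_self]

theorem dQ_val (m : ℝ) (s : Sym0) : dQ m (s.val m) = 0 := by
  cases s with
  | F n I =>
    rw [Sym0.val, tracelessPart_eq_tlProj, map_tlProj]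
    simp only [dQ_fieldStrength, tlProj_zero]
  | phi n I =>
    rw [Sym0.val, tracelessPart_eq_tlProj, map_tlProj]
    simp only [dQ_phiTensor, tlProj_zero]

theorem dQ_ofFormal (m : ℝ) (a : FormalP0) : dQ m (ofFormal m a) = 0 := by
  have ha : a ∈ Algebra.adjoin ℂ (Set.range Sym0.cls) := adjoin_cls ▸ Algebra.mem_top
  induction ha using Algebra.adjoin_induction with
  | mem x hx => obtain ⟨s, rfl⟩ := hx; rw [ofFormal_cls, dQ_val]
  | algebraMap r => rw [AlgHom.commutes, dQ_algebraMap]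
  | add x y _ _ hx hy => rw [map_add, map_add, hx, hy, add_zero]
  | mul x y _ _ hx hy => rw [map_mul, dQ_mul, hx, hy, zero_mul, mul_zero, add_zero]

/-! ## Generators adapted to the differential -/

theorem kgExtend_mem {M : Type} [AddCommGroup M] [Module ℂ M] (m : ℝ)
    {f : Multiset (Fin 4) → M} {Y : Submodule ℂ M} (h : ∀ J, f J ∈ Y) (J : Multiset (Fin 4)) :
    kgExtend m f J ∈ Y := by
  induction J using time_induction with
  | h1 J hJ => rw [kgExtend_of_lt m f hJ]; exact h J
  | h2 J ih ih' =>
    rw [kgExtend_cons_cons]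
    exact Submodule.sub_mem _ (Submodule.sum_mem _ fun i _ => ih' i) (Submodule.smul_mem _ _ ih)

/-- The initial data of `gauge`. -/
noncomputable def gaugeData (m : ℝ) (J : Multiset (Fin 4)) : JetSpace m :=
  if h : J = 0 then (m : ℂ)⁻¹ • jv m (.Phi, 0)
  else jv m (.v (Multiset.exists_mem_of_ne_zero h).choose,
    J.erase (Multiset.exists_mem_of_ne_zero h).choose)

theorem gaugeData_zero (m : ℝ) : gaugeData m 0 = (m : ℂ)⁻¹ • jv m (.Phi, 0) := dif_pos rfl

theorem exists_gaugeData_eq (m : ℝ) {J : Multiset (Fin 4)} (h : J ≠ 0) :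
    ∃ μ L, μ ::ₘ L = J ∧ gaugeData m J = jv m (.v μ, L) :=
  ⟨_, _, Multiset.cons_erase (Multiset.exists_mem_of_ne_zero h).choose_spec, dif_neg h⟩

/-- A preimage of `i u_J` under the differential. -/
noncomputable def gauge (m : ℝ) : Multiset (Fin 4) → JetSpace m := kgExtend m (gaugeData m)

/-- `C_J` in the space of jet variables. -/
noncomputable def CjetV (m : ℝ) (J : Multiset (Fin 4)) : JetSpace m :=
  ∑ μ, eta μ μ • jv m (.v μ, μ ::ₘ J) + (m : ℂ) • jv m (.Phi, J)

theorem toPoly_CjetV (m : ℝ) (J : Multiset (Fin 4)) : toPoly m (CjetV m J) = Cjet m J := by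
  simp only [CjetV, Cjet, map_add, map_sum, map_smul, toPoly_jv]

/-- Generators of `𝒫` in which the differential is diagonal: cocycles and contractible pairs. -/
inductive Gen : Type
  | W (s : Sym0)
  | C (J : Multiset (Fin 4))
  | G (J : Multiset (Fin 4))
  | U (J : Multiset (Fin 4))
  | T (J : Multiset (Fin 4))

/-- The linear combination of jet variables denoted by a generator. -/
noncomputable def Gen.vec (m : ℝ) : Gen → JetSpace m
  | .W s => s.valV m
  | .C J => CjetV m J
  | .G J => gauge m J
  | .U J => jv m (.u, J)
  | .T J => jv m (.ut, J)

/-- The canonical dimension of a generator. -/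
def Gen.dim : Gen → ℕ
  | .W s => s.dim
  | .C J => Multiset.card J + 2
  | .G J => max 1 (Multiset.card J)
  | .U J => Multiset.card J + 1
  | .T J => Multiset.card J + 1

/-- The number of contractible generators. -/
def Gen.charge : Gen → ℕ
  | .W _ => 0
  | _ => 1

/-- The span of the generators of dimension `≤ n`. -/
noncomputable def genLE (m : ℝ) (n : ℕ) : Submodule ℂ (JetSpace m) :=
  Submodule.span ℂ {x | ∃ g : Gen, g.dim ≤ n ∧ g.vec m = x}

theorem genLE_mono (m : ℝ) {i j : ℕ} (h : i ≤ j) : genLE m i ≤ genLE m j :=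
  Submodule.span_mono fun _ ⟨g, hg, e⟩ => ⟨g, hg.trans h, e⟩

theorem vec_mem_genLE (m : ℝ) (g : Gen) {n : ℕ} (h : g.dim ≤ n) : g.vec m ∈ genLE m n :=
  Submodule.subset_span ⟨g, h, rfl⟩

theorem idx_eq_cons_erase {k : ℕ} (f : Fin k → Fin 4) (i : Fin k) :
    idx f = f i ::ₘ (Finset.univ.erase i).val.map f := (cons_map_erase f i).symm

theorem map_erase_update {k : ℕ} (I : Fin k → Fin 4) (i : Fin k) (μ : Fin 4) :
    (Finset.univ.erase i).val.map (Function.update I i μ) = (Finset.univ.erase i).val.map I :=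
  Multiset.map_congr rfl fun l hl => by
    rw [Function.update_of_ne]
    rw [Finset.mem_val] at hl
    exact Finset.ne_of_mem_erase hl

theorem idx_update {k : ℕ} (I : Fin k → Fin 4) (i : Fin k) (μ : Fin 4) :
    idx (Function.update I i μ) = μ ::ₘ (Finset.univ.erase i).val.map I := by
  rw [idx_eq_cons_erase _ i, Function.update_self, map_erase_update]

theorem idx_update_update {k : ℕ} (I : Fin k → Fin 4) {i j : Fin k} (h : i ≠ j) :
    ∃ K : Multiset (Fin 4), Multiset.card K + 2 = k ∧
      ∀ μ ν, idx (Function.update (Function.update I i μ) j ν) = μ ::ₘ ν ::ₘ K := by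
  have hi : i ∈ Finset.univ.erase j := Finset.mem_erase.2 ⟨h, Finset.mem_univ _⟩
  have e : ∀ μ ν, idx (Function.update (Function.update I i μ) j ν) =
      μ ::ₘ ν ::ₘ ((Finset.univ.erase j).erase i).val.map I := fun μ ν => by
    rw [idx_update, ← Finset.insert_erase hi, Finset.insert_val_of_notMem (by simp),
      Multiset.map_cons, Function.update_self, Multiset.cons_swap, Finset.insert_erase hi]
    congr 2
    refine Multiset.map_congr rfl fun l hl => ?_
    rw [Function.update_of_ne]
    rw [Finset.mem_val] at hl
    exact Finset.ne_of_mem_erase hl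
  refine ⟨_, ?_, e⟩
  have := card_idx (Function.update (Function.update I i 0) j 0)
  rw [e] at this
  simpa using this

theorem card_map_erase {k : ℕ} (I : Fin k → Fin 4) (l : Fin k) :
    Multiset.card ((Finset.univ.erase l).val.map I) + 1 = k := by
  rw [← Multiset.card_cons (I l), cons_map_erase, card_idx]

/-! ### The adapted generators span the jet variables in each dimension -/

section Spanning

variable {m : ℝ} {n : ℕ}

/-- On shell, a trace over derivative indices removes two derivatives; this drives the induction on
dimension. -/
theorem sum_jv_mem {Y : Submodule ℂ (JetSpace m)} {α : Fld} {J : Multiset (Fin 4)}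
    (h : jv m (α, J) ∈ Y) : ∑ κ, eta κ κ • jv m (α, κ ::ₘ κ ::ₘ J) ∈ Y := by
  rw [eq_neg_of_add_eq_zero_left (jv_kleinGordon m α J)]
  exact Submodule.neg_mem _ (Submodule.smul_mem _ _ h)

/-- Modulo `genLE`, the derivatives of Φ are traceless by the Klein-Gordon equation and g is of
lower order. Hence φ agrees with its traceless part, which is a generator. -/
theorem phiTensorV_mem (h : ∀ (α : Fld) (J : Multiset (Fin 4)), Multiset.card J ≤ n →
    jv m (α, J) ∈ genLE m (n + 1)) (I : Fin (n + 1) → Fin 4) :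
    phiTensorV m (n + 1) I ∈ genLE m (n + 2) := by
  have h' : ∀ (α : Fld) (J : Multiset (Fin 4)), Multiset.card J ≤ n → jv m (α, J) ∈ genLE m (n + 2) :=
    fun α J hJ => genLE_mono m (by omega) (h α J hJ)
  have hg : ∀ I : Fin (n + 1) → Fin 4, gTensorV m (n + 1) I ∈ genLE m (n + 2) := fun I =>
    Submodule.smul_mem _ _ (Submodule.sum_mem _ fun l _ => h' _ _ (by
      have := card_map_erase I l; omega))
  have h1 := sub_tlProj_mem (T := phiTensorV m (n + 1)) (Y := genLE m (n + 2))
    (fun I i j hij => ?_) I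
  · have h2 : tlProj (phiTensorV m (n + 1)) I ∈ genLE m (n + 2) :=
      vec_mem_genLE m (.W (.phi n I)) le_rfl
    simpa using Submodule.add_mem _ h1 h2
  · obtain ⟨K, hK, e⟩ := idx_update_update I hij
    simp only [phiTensorV, smul_sub, Finset.sum_sub_distrib, e]
    exact Submodule.sub_mem _ (sum_jv_mem (h' _ _ (by omega))) (Submodule.sum_mem _ fun μ _ =>
      Submodule.smul_mem _ _ (Submodule.smul_mem _ _ (hg _)))

theorem tail_update_succ {k : ℕ} (I : Fin (k + 2) → Fin 4) (l : Fin k) (μ : Fin 4) :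
    (fun i : Fin k => Function.update I l.succ.succ μ i.succ.succ) =
      Function.update (fun i : Fin k => I i.succ.succ) l μ := by
  funext i
  simp only [Function.update_apply, Fin.succ_inj]

/-- `∂_a v_b - ∂_b v_a` and its derivatives. -/
noncomputable def curlV (m : ℝ) (a b : Fin 4) (K : Multiset (Fin 4)) : JetSpace m :=
  jv m (.v b, a ::ₘ K) - jv m (.v a, b ::ₘ K)

/-- The divergence of F is □v_b - ∂_b(∂·v), and ∂·v = C - mΦ. -/
theorem curlV_div_mem (h : ∀ (α : Fld) (J : Multiset (Fin 4)), Multiset.card J ≤ n →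
    jv m (α, J) ∈ genLE m (n + 1)) (b : Fin 4) {K : Multiset (Fin 4)}
    (hK : Multiset.card K + 1 = n) :
    ∑ κ, eta κ κ • curlV m κ b (κ ::ₘ K) ∈ genLE m (n + 2) := by
  have e : ∑ κ, eta κ κ • curlV m κ b (κ ::ₘ K) =
      ∑ κ, eta κ κ • jv m (.v b, κ ::ₘ κ ::ₘ K) -
      (CjetV m (b ::ₘ K) - (m : ℂ) • jv m (.Phi, b ::ₘ K)) := by
    simp only [curlV, CjetV, smul_sub, Finset.sum_sub_distrib, Multiset.cons_swap b]
    abel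
  rw [e]
  refine Submodule.sub_mem _ (sum_jv_mem (genLE_mono m (by omega) (h _ _ (by omega))))
    (Submodule.sub_mem _ (vec_mem_genLE m (.C _) ?_) (Submodule.smul_mem _ _
      (genLE_mono m (by omega) (h _ _ ?_))))
  · simp only [Gen.dim, Multiset.card_cons]; omega
  · rw [Multiset.card_cons]; omega

theorem curlV_antisymm (a b : Fin 4) (K : Multiset (Fin 4)) :
    curlV m a b K = - curlV m b a K := (neg_sub _ _).symm

theorem curlV_div_mem' (h : ∀ (α : Fld) (J : Multiset (Fin 4)), Multiset.card J ≤ n →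
    jv m (α, J) ∈ genLE m (n + 1)) (b : Fin 4) {K : Multiset (Fin 4)}
    (hK : Multiset.card K + 1 = n) :
    ∑ κ, eta κ κ • curlV m b κ (κ ::ₘ K) ∈ genLE m (n + 2) := by
  have := Submodule.neg_mem _ (curlV_div_mem h b hK)
  simpa only [curlV_antisymm b, smul_neg, Finset.sum_neg_distrib] using this

/-- The trace over the antisymmetric pair vanishes, a mixed trace is a divergence of F, and a trace
over two derivative indices is reduced by the Klein-Gordon equation. -/
theorem fieldStrengthV_trace_mem (h : ∀ (α : Fld) (J : Multiset (Fin 4)), Multiset.card J ≤ n →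
    jv m (α, J) ∈ genLE m (n + 1)) (I : Fin (n + 2) → Fin 4) (i j : Fin (n + 2)) (hij : i ≠ j) :
    ∑ μ, eta μ μ • fieldStrengthV m n (Function.update (Function.update I i μ) j μ) ∈
      genLE m (n + 2) := by
  have hF : ∀ I, fieldStrengthV m n I = curlV m (I 0) (I 1) (idx fun l : Fin n => I l.succ.succ) :=
    fun I => rfl
  have tail0 : ∀ (I : Fin (n + 2) → Fin 4) (μ : Fin 4) (l : Fin n),
      Function.update I 0 μ l.succ.succ = I l.succ.succ := fun I μ l =>
    Function.update_of_ne (Fin.succ_ne_zero _) _ _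
  have ne1 : ∀ l : Fin n, l.succ.succ ≠ 1 := fun l => by
    simp only [ne_eq, Fin.ext_iff, Fin.val_succ, Fin.val_one]; omega
  have tail1 : ∀ (I : Fin (n + 2) → Fin 4) (μ : Fin 4) (l : Fin n),
      Function.update I 1 μ l.succ.succ = I l.succ.succ := fun I μ l =>
    Function.update_of_ne (ne1 l) _ _
  have at0 : ∀ (I : Fin (n + 2) → Fin 4) (μ : Fin 4) (l : Fin n),
      Function.update I l.succ.succ μ 0 = I 0 := fun I μ l =>
    Function.update_of_ne (Fin.succ_ne_zero _).symm _ _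
  have at1 : ∀ (I : Fin (n + 2) → Fin 4) (μ : Fin 4) (l : Fin n),
      Function.update I l.succ.succ μ 1 = I 1 := fun I μ l =>
    Function.update_of_ne (ne1 l).symm _ _
  have at01 : ∀ (I : Fin (n + 2) → Fin 4) (μ : Fin 4), Function.update I 0 μ 1 = I 1 :=
    fun I μ => Function.update_of_ne (by simp) _ _
  have at10 : ∀ (I : Fin (n + 2) → Fin 4) (μ : Fin 4), Function.update I 1 μ 0 = I 0 :=
    fun I μ => Function.update_of_ne (by simp) _ _
  have h01 : ∑ μ, eta μ μ • fieldStrengthV m n (Function.update (Function.update I 0 μ) 1 μ) ∈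
      genLE m (n + 2) := by
    refine Submodule.sum_mem _ fun μ _ => Submodule.smul_mem _ _ ?_
    rw [hF, Function.update_self, at10, Function.update_self, curlV, sub_self]
    exact Submodule.zero_mem _
  have h0 : ∀ l : Fin n, ∑ μ, eta μ μ • fieldStrengthV m n
      (Function.update (Function.update I 0 μ) l.succ.succ μ) ∈ genLE m (n + 2) := fun l => by
    have := card_map_erase (fun l : Fin n => I l.succ.succ) l
    simp only [hF, at0, at1, at01, Function.update_self, tail_update_succ, idx_update, tail0]
    exact curlV_div_mem h _ this
  have h1 : ∀ l : Fin n, ∑ μ, eta μ μ • fieldStrengthV m n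
      (Function.update (Function.update I 1 μ) l.succ.succ μ) ∈ genLE m (n + 2) := fun l => by
    have := card_map_erase (fun l : Fin n => I l.succ.succ) l
    simp only [hF, at0, at1, at10, Function.update_self, tail_update_succ, idx_update, tail1]
    exact curlV_div_mem' h _ this
  have swap : ∀ i j : Fin (n + 2), i ≠ j → ∑ μ, eta μ μ • fieldStrengthV m n
      (Function.update (Function.update I i μ) j μ) ∈ genLE m (n + 2) →
      ∑ μ, eta μ μ • fieldStrengthV m n
      (Function.update (Function.update I j μ) i μ) ∈ genLE m (n + 2) := fun i j hij hm => by
    simpa only [Function.update_comm hij] using hm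
  revert hij
  refine Fin.cases (fun hij => ?_) (fun i => Fin.cases (fun hij => ?_) (fun i hij => ?_) i) i
  · revert hij
    refine Fin.cases (fun hij => absurd rfl hij) (fun j => Fin.cases (fun _ => h01)
      (fun j _ => h0 j) j) j
  · revert hij
    refine Fin.cases (fun hij => swap _ _ hij.symm h01) (fun j => Fin.cases
      (fun hij => absurd rfl hij) (fun j _ => h1 j) j) j
  · revert hij
    refine Fin.cases (fun hij => swap _ _ hij.symm (h0 i)) (fun j => Fin.cases
      (fun hij => swap _ _ hij.symm (h1 i)) (fun j hij => ?_) j) j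
    obtain ⟨K, hK, e⟩ := idx_update_update (fun l : Fin n => I l.succ.succ) (i := i) (j := j)
      (fun h => hij (by rw [h]))
    simp only [hF, at0, at1, tail_update_succ, e, curlV, smul_sub, Finset.sum_sub_distrib]
    have hc : ∀ a κ, a ::ₘ κ ::ₘ κ ::ₘ K = κ ::ₘ κ ::ₘ a ::ₘ K := fun a κ => by
      rw [Multiset.cons_swap a κ, Multiset.cons_swap a κ]
    simp only [hc]
    refine Submodule.sub_mem _ (sum_jv_mem (genLE_mono m (by omega) (h _ _ ?_)))
      (sum_jv_mem (genLE_mono m (by omega) (h _ _ ?_))) <;>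
    · rw [Multiset.card_cons]; omega

theorem curlV_mem (h : ∀ (α : Fld) (J : Multiset (Fin 4)), Multiset.card J ≤ n →
    jv m (α, J) ∈ genLE m (n + 1)) (a b : Fin 4) {K : Multiset (Fin 4)}
    (hK : Multiset.card K = n) : curlV m a b K ∈ genLE m (n + 2) := by
  obtain ⟨f, rfl⟩ := exists_idx K hK
  have h1 := sub_tlProj_mem (fieldStrengthV_trace_mem h)
    (Matrix.vecCons a (Matrix.vecCons b f))
  have h2 : tlProj (fieldStrengthV m n) (Matrix.vecCons a (Matrix.vecCons b f)) ∈
      genLE m (n + 2) := vec_mem_genLE m (.W (.F n _)) le_rfl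
  have h3 := Submodule.add_mem _ h1 h2
  rw [sub_add_cancel] at h3
  exact h3

/-- Variables v_{μ;J} and v_{ν;K} with the same total multi-index are equal or differ by a
derivative of F, so the choices made in `gaugeData` do not matter here. -/
theorem v_sub_v_mem (h : ∀ (α : Fld) (J : Multiset (Fin 4)), Multiset.card J < n →
    jv m (α, J) ∈ genLE m n) {μ ν : Fin 4} {J K : Multiset (Fin 4)} (e : μ ::ₘ J = ν ::ₘ K)
    (hJ : Multiset.card J = n) : jv m (.v μ, J) - jv m (.v ν, K) ∈ genLE m (n + 1) := by
  rcases Multiset.cons_eq_cons.1 e with ⟨rfl, rfl⟩ | ⟨_, L, rfl, rfl⟩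
  · rw [sub_self]; exact Submodule.zero_mem _
  · rw [Multiset.card_cons] at hJ
    subst hJ
    exact curlV_mem (fun α J hJ => h α J (by omega)) ν μ rfl

/-- Induction on the time indices. For K = 00L, the definition of C expresses v_{0;0L} by the
spatial v_{i;iL}, in parallel with the recursion for `gauge`; the discrepancies are C_L, Φ_L and
`gauge m L`. -/
theorem v_sub_gauge_mem (h : ∀ (α : Fld) (J : Multiset (Fin 4)), Multiset.card J < n →
    jv m (α, J) ∈ genLE m n) (K : Multiset (Fin 4)) : ∀ (μ : Fin 4) (J : Multiset (Fin 4)),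
    μ ::ₘ J = K → Multiset.card J = n → jv m (.v μ, J) - gauge m K ∈ genLE m (n + 1) := by
  induction K using time_induction with
  | h1 K hK =>
    intro μ J e hJ
    rw [gauge, kgExtend_of_lt _ _ hK]
    obtain ⟨ν, L, e', hL⟩ := exists_gaugeData_eq m (J := K) (by rw [← e]; exact Multiset.cons_ne_zero)
    rw [hL]
    exact v_sub_v_mem h (e.trans e'.symm) hJ
  | h2 L _ ih =>
    intro μ J e hJ
    have h1 := v_sub_v_mem h e hJ
    have hL : Multiset.card L + 1 = n := by
      have := congrArg Multiset.card e
      simp only [Multiset.card_cons] at this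
      omega
    have h2 : jv m (.v 0, 0 ::ₘ L) = CjetV m L - (m : ℂ) • jv m (.Phi, L) +
        ∑ i : Fin 3, jv m (.v i.succ, i.succ ::ₘ L) := by
      rw [CjetV, sum_eta_self_smul]
      abel
    have h3 : jv m (.v μ, J) - gauge m (0 ::ₘ 0 ::ₘ L) =
        (jv m (.v μ, J) - jv m (.v 0, 0 ::ₘ L)) + CjetV m L - (m : ℂ) • jv m (.Phi, L) +
        (∑ i : Fin 3, (jv m (.v i.succ, i.succ ::ₘ L) - gauge m (i.succ ::ₘ i.succ ::ₘ L))) +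
        (m : ℂ) ^ 2 • gauge m L := by
      rw [gauge, kgExtend_cons_cons, h2, Finset.sum_sub_distrib]
      abel
    rw [h3]
    refine Submodule.add_mem _ (Submodule.add_mem _ (Submodule.sub_mem _ (Submodule.add_mem _ h1
      (vec_mem_genLE m (.C L) ?_)) (Submodule.smul_mem _ _ (genLE_mono m (by omega)
        (h _ _ (by omega))))) (Submodule.sum_mem _ fun i _ => ih i _ _ rfl ?_))
      (Submodule.smul_mem _ _ (vec_mem_genLE m (.G L) ?_))
    · simp only [Gen.dim]; omega
    · rw [Multiset.card_cons, hL]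
    · simp only [Gen.dim]; omega

/-- A variable v differs from G, and Φ_J with J nonempty from φ, by elements already treated. The
undifferentiated Φ is m times G at the empty index, since no φ exists there. -/
theorem jv_mem_genLE (hm : m ≠ 0) (n : ℕ) : ∀ (α : Fld) (J : Multiset (Fin 4)),
    Multiset.card J < n → jv m (α, J) ∈ genLE m n := by
  induction n with
  | zero => intro α J hJ; omega
  | succ n ih =>
    intro α J hJ
    rcases Nat.lt_succ_iff_lt_or_eq.1 hJ with h | h
    · exact genLE_mono m (by omega) (ih α J h)
    · cases α with
      | v μ =>
        rw [← sub_add_cancel (jv m (.v μ, J)) (gauge m (μ ::ₘ J))]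
        refine Submodule.add_mem _ (v_sub_gauge_mem ih _ _ _ rfl h) (vec_mem_genLE m (.G _) ?_)
        simp only [Gen.dim, Multiset.card_cons]
        omega
      | Phi =>
        cases n with
        | zero =>
          rw [Multiset.card_eq_zero] at h
          subst h
          have h1 : gauge m 0 ∈ genLE m (0 + 1) := vec_mem_genLE m (.G 0) (by simp [Gen.dim])
          rw [gauge, kgExtend_of_lt _ _ (by simp), gaugeData_zero] at h1
          have hm' : (m : ℂ) ≠ 0 := by exact_mod_cast hm
          simpa [smul_smul, hm'] using Submodule.smul_mem _ (m : ℂ) h1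
        | succ n =>
          obtain ⟨f, rfl⟩ := exists_idx J h
          have h1 := phiTensorV_mem (fun α J hJ => ih α J (by omega)) f
          have h2 : gTensorV m (n + 1) f ∈ genLE m (n + 2) :=
            Submodule.smul_mem _ _ (Submodule.sum_mem _ fun l _ =>
              genLE_mono m (by omega) (ih _ _ (by have := card_map_erase f l; omega)))
          have h3 := Submodule.add_mem _ h1 (Submodule.smul_mem _ (m : ℂ) h2)
          rw [phiTensorV, sub_add_cancel] at h3
          exact h3
      | u => exact vec_mem_genLE m (.U J) (by simp only [Gen.dim]; omega)
      | ut => exact vec_mem_genLE m (.T J) (by simp only [Gen.dim]; omega)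

end Spanning

/-! ## Odd derivations -/

section OddDerivation

variable {m : ℝ}

/-- Odd graded derivations of `𝒫`. -/
structure IsOddDerivation (δ : Poly m →ₗ[ℂ] Poly m) : Prop where
  mul : ∀ p q, δ (p * q) = δ p * q + parityAut m p * δ q
  parity : ∀ p, δ (parityAut m p) = - parityAut m (δ p)

theorem parityAut_parityAut (p : Poly m) : parityAut m (parityAut m p) = p := by
  induction p using poly_induction m with
  | h1 c => simp
  | hj a =>
    have : (-1 : ℂ) ^ a.1.parity * (-1 : ℂ) ^ a.1.parity = 1 := by
      rw [← mul_pow]; norm_num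
    simp [parityAut_jet, smul_smul, this]
  | hm p q hp hq => simp [hp, hq]
  | ha p q hp hq => simp [hp, hq]

theorem parityAut_toPoly {ε : ℕ} {x : JetSpace m} (hx : x ∈ parityPart m ε) :
    parityAut m (toPoly m x) = (-1 : ℂ) ^ ε • toPoly m x := by
  induction hx using Submodule.span_induction with
  | mem x hx =>
    obtain ⟨a, rfl, rfl⟩ := hx
    rw [toPoly_jv, parityAut_jet]
  | zero => simp
  | add x y _ _ hx hy => rw [map_add, map_add, hx, hy, smul_add]
  | smul c x _ hx => rw [map_smul, map_smul, hx, smul_comm]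

theorem Fld.parity_le_one (α : Fld) : α.parity ≤ 1 := by
  cases α <;> simp [Fld.parity]

/-- A linear map of the space of jet variables which changes the parity. -/
def IsOdd (L : JetSpace m →ₗ[ℂ] JetSpace m) : Prop :=
  ∀ a, L (jv m a) ∈ parityPart m (1 - a.1.parity)

theorem neg_one_pow_sub {p : ℕ} (hp : p ≤ 1) (q : ℕ) :
    (-1 : ℂ) ^ ((1 - p) * q) = (-1 : ℂ) ^ ((p + 1) * q) := by
  interval_cases p
  · rfl
  · rw [pow_mul, pow_mul]; norm_num

/-- Anticommutation with the parity automorphism propagates from the variables to products by the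
Leibniz rule. -/
theorem isOddDerivation_of_jet {δ : Poly m →ₗ[ℂ] Poly m}
    (hmul : ∀ p q, δ (p * q) = δ p * q + parityAut m p * δ q)
    (hc : ∀ c : ℂ, δ (algebraMap ℂ _ c) = 0)
    {L : JetSpace m →ₗ[ℂ] JetSpace m} (hL : IsOdd L) (hj : ∀ a, δ (jet m a) = toPoly m (L (jv m a))) :
    IsOddDerivation δ := by
  refine ⟨hmul, fun p => ?_⟩
  induction p using poly_induction m with
  | h1 c => simp [hc]
  | hj a =>
    rw [parityAut_jet, map_smul, hj, parityAut_toPoly (hL a), ← neg_smul]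
    congr 1
    have h := a.1.parity_le_one
    interval_cases a.1.parity <;> norm_num
  | hm p q hp hq =>
    simp only [hmul, map_mul, map_add, hp, hq, parityAut_parityAut]
    noncomm_ring
  | ha p q hp hq => simp only [map_add, hp, hq, neg_add]

/-- The value on a jet variable of the homomorphism which encodes an odd derivation. -/
noncomputable def oddMat (L : JetSpace m →ₗ[ℂ] JetSpace m) (a : Jet) :
    Matrix (Fin 2) (Fin 2) (Poly m) :=
  !![(-1 : ℂ) ^ a.1.parity • jet m a, toPoly m (L (jv m a)); 0, jet m a]

/-- Upper triangular matrices encode the graded Leibniz rule in the corner entry. Compatibility with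
graded commutativity holds there because L reverses parity. -/
theorem oddMat_rel {L : JetSpace m →ₗ[ℂ] JetSpace m} (hL : IsOdd L) ⦃x y : FreeAlgebra ℂ Jet⦄
    (h : Rel m x y) :
    FreeAlgebra.lift ℂ (oddMat L) x = FreeAlgebra.lift ℂ (oddMat L) y := by
  induction h with
  | comm a b =>
    have e1 := jet_comm m a b
    have e2 := toPoly_mul_jet (hL a) b
    have e3 := toPoly_mul_jet (hL b) a
    rw [neg_one_pow_sub (Fld.parity_le_one _)] at e2 e3
    have e4 : (-1 : ℂ) ^ a.1.parity * (-1 : ℂ) ^ a.1.parity = 1 := by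
      rw [← mul_pow]; norm_num
    have e5 : (-1 : ℂ) ^ (a.1.parity * b.1.parity) * (-1 : ℂ) ^ (a.1.parity * b.1.parity) = 1 := by
      rw [← mul_pow]; norm_num
    simp only [map_mul, map_smul, FreeAlgebra.lift_ι_apply, oddMat, Matrix.mul_fin_two]
    ext i j
    fin_cases i <;> fin_cases j
    · simp [e1, smul_smul]
      congr 1
      ring
    · simp [e2, e3, smul_smul]
      rw [add_comm]
      congr 2
      · ring
      · rw [add_mul, one_mul, pow_add, mul_comm b.1.parity, ← mul_assoc, e5, one_mul]
    · simp
    · simp [e1]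
  | kleinGordon α J =>
    have k1 := jet_kleinGordon m α J
    have k2 := congrArg (fun x => toPoly m (L x)) (jv_kleinGordon m α J)
    simp only [map_add, map_sum, map_smul, map_zero] at k2
    simp only [map_add, map_sum, map_smul, map_zero, FreeAlgebra.lift_ι_apply, oddMat]
    ext i j
    fin_cases i <;> fin_cases j
    · have k3 := congrArg (fun z => (-1 : ℂ) ^ α.parity • z) k1
      simp only [smul_add, Finset.smul_sum, smul_zero, smul_comm ((-1 : ℂ) ^ α.parity)] at k3
      simpa [Matrix.sum_apply] using k3
    · simpa [Matrix.sum_apply] using k2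
    · simp [Matrix.sum_apply]
    · simpa [Matrix.sum_apply] using k1

/-- An odd linear map of the space of jet variables extends to an odd derivation. -/
theorem exists_oddDerivation {L : JetSpace m →ₗ[ℂ] JetSpace m} (hL : IsOdd L) :
    ∃ δ : Poly m →ₗ[ℂ] Poly m, IsOddDerivation δ ∧ ∀ x, δ (toPoly m x) = toPoly m (L x) := by
  obtain ⟨H, hH⟩ : ∃ H : Poly m →ₐ[ℂ] Matrix (Fin 2) (Fin 2) (Poly m),
      ∀ a, H (jet m a) = oddMat L a :=
    ⟨Poly.lift m (oddMat L) (oddMat_rel hL), fun a => by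
      rw [jet, Poly.lift_mk, FreeAlgebra.lift_ι_apply]⟩
  have hrow : ∀ p, H p 0 0 = parityAut m p ∧ H p 1 0 = 0 ∧ H p 1 1 = p := fun p => by
    induction p using poly_induction m with
    | h1 c => simp [Matrix.algebraMap_matrix_apply]
    | hj a => simp [hH, oddMat, parityAut_jet]
    | hm p q hp hq =>
      obtain ⟨h1, h2, h3⟩ := hp
      obtain ⟨k1, k2, k3⟩ := hq
      simp [Matrix.mul_apply, h1, h2, h3, k1, k2, k3]
    | ha p q hp hq =>
      obtain ⟨h1, h2, h3⟩ := hp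
      obtain ⟨k1, k2, k3⟩ := hq
      simp [h1, h2, h3, k1, k2, k3]
  have hj : ∀ a, (Matrix.entryLinearMap ℂ (Poly m) 0 1 ∘ₗ H.toLinearMap) (jet m a) =
      toPoly m (L (jv m a)) := fun a => by simp [hH, oddMat]
  refine ⟨Matrix.entryLinearMap ℂ (Poly m) 0 1 ∘ₗ H.toLinearMap,
    isOddDerivation_of_jet (fun p q => ?_) (fun c => ?_) hL hj, fun x => ?_⟩
  · simp [Matrix.mul_apply, (hrow p).1, (hrow q).2.2, add_comm]
  · simp [Matrix.algebraMap_matrix_apply]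
  · refine LinearMap.congr_fun (f := (Matrix.entryLinearMap ℂ (Poly m) 0 1 ∘ₗ H.toLinearMap) ∘ₗ
      toPoly m) (g := toPoly m ∘ₗ L) (jet_linearMap_ext fun a => ?_) x
    rw [LinearMap.comp_apply, toPoly_jv, hj]
    rfl

theorem IsOddDerivation.map_one {δ : Poly m →ₗ[ℂ] Poly m} (h : IsOddDerivation δ) : δ 1 = 0 := by
  have := h.mul 1 1
  simpa using this

/-- The anticommutator of two odd derivations is a derivation. -/
theorem IsOddDerivation.anticomm_mul {δ ε : Poly m →ₗ[ℂ] Poly m} (hδ : IsOddDerivation δ)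
    (hε : IsOddDerivation ε) (p q : Poly m) :
    δ (ε (p * q)) + ε (δ (p * q)) =
      (δ (ε p) + ε (δ p)) * q + p * (δ (ε q) + ε (δ q)) := by
  simp only [hδ.mul, hε.mul, map_add, hδ.parity, hε.parity, parityAut_parityAut]
  noncomm_ring

end OddDerivation

/-! ## The contracting homotopy -/

section Homotopy

variable (m : ℝ)

/-- The differential on the space of jet variables. -/
noncomputable def dV : JetSpace m →ₗ[ℂ] JetSpace m := linearPart m ∘ₗ dQ m ∘ₗ toPoly m

theorem dV_v (μ : Fin 4) (J : Multiset (Fin 4)) :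
    dV m (jv m (.v μ, J)) = Complex.I • jv m (.u, μ ::ₘ J) := by
  simp only [dV, LinearMap.comp_apply, toPoly_jv, dQ_jet, dQGen]
  rw [← toPoly_jv, ← map_smul, linearPart_toPoly]

theorem dV_Phi (J : Multiset (Fin 4)) :
    dV m (jv m (.Phi, J)) = (Complex.I * (m : ℂ)) • jv m (.u, J) := by
  simp only [dV, LinearMap.comp_apply, toPoly_jv, dQ_jet, dQGen]
  rw [← toPoly_jv, ← map_smul, linearPart_toPoly]

theorem dV_u (J : Multiset (Fin 4)) : dV m (jv m (.u, J)) = 0 := by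
  simp only [dV, LinearMap.comp_apply, toPoly_jv, dQ_jet, dQGen, map_zero]

theorem dV_ut (J : Multiset (Fin 4)) :
    dV m (jv m (.ut, J)) = (-Complex.I) • CjetV m J := by
  simp only [dV, LinearMap.comp_apply, toPoly_jv, dQ_jet, dQGen]
  rw [← toPoly_CjetV, ← map_smul, linearPart_toPoly]

/-- On variables d_Q is linear, so passing to the linear part loses nothing. -/
theorem toPoly_dV (x : JetSpace m) : toPoly m (dV m x) = dQ m (toPoly m x) := by
  have : toPoly m ∘ₗ dV m = dQ m ∘ₗ toPoly m := jet_linearMap_ext fun a => by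
    obtain ⟨α, J⟩ := a
    rw [LinearMap.comp_apply, LinearMap.comp_apply, toPoly_jv, dQ_jet]
    cases α <;> simp only [dV_v, dV_Phi, dV_u, dV_ut, dQGen, map_smul, map_zero, toPoly_jv,
      toPoly_CjetV]
  exact LinearMap.congr_fun this x

theorem CjetV_mem_parityPart (J : Multiset (Fin 4)) : CjetV m J ∈ parityPart m 0 :=
  Submodule.add_mem _ (Submodule.sum_mem _ fun _ _ => Submodule.smul_mem _ _ (jv_v_mem m _ _))
    (Submodule.smul_mem _ _ (jv_Phi_mem m _))

theorem gauge_mem_parityPart (J : Multiset (Fin 4)) : gauge m J ∈ parityPart m 0 :=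
  kgExtend_mem m (fun J => by
    by_cases h : J = 0
    · subst h
      rw [gaugeData_zero]
      exact Submodule.smul_mem _ _ (jv_Phi_mem m _)
    · obtain ⟨μ, L, -, e⟩ := exists_gaugeData_eq m h
      rw [e]
      exact jv_v_mem m _ _) J

theorem isOdd_dV : IsOdd (dV m) := by
  rintro ⟨α, J⟩
  cases α with
  | v μ => rw [dV_v]; exact Submodule.smul_mem _ _ (jv_mem_parityPart m (.u, _))
  | Phi => rw [dV_Phi]; exact Submodule.smul_mem _ _ (jv_mem_parityPart m (.u, _))
  | u => rw [dV_u]; exact Submodule.zero_mem _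
  | ut => rw [dV_ut]; exact Submodule.smul_mem _ _ (CjetV_mem_parityPart m _)

theorem isOddDerivation_dQ : IsOddDerivation (dQ m) :=
  isOddDerivation_of_jet (dQ_mul m) (dQ_algebraMap m) (isOdd_dV m) fun a => by
    rw [toPoly_dV, toPoly_jv]

variable {m}

/-- For the initial data, both Φ/m and v_{μ;L} with μL = J have the stated image. The recursion
carries it over because u solves the same Klein-Gordon equation. -/
theorem dV_gauge (hm : m ≠ 0) (J : Multiset (Fin 4)) :
    dV m (gauge m J) = Complex.I • jv m (.u, J) := by
  have hm' : (m : ℂ) ≠ 0 := by exact_mod_cast hm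
  induction J using time_induction with
  | h1 J hJ =>
    rw [gauge, kgExtend_of_lt _ _ hJ]
    by_cases h : J = 0
    · subst h
      rw [gaugeData_zero, map_smul, dV_Phi, smul_smul, mul_comm, mul_assoc, mul_inv_cancel₀ hm',
        mul_one]
    · obtain ⟨μ, L, rfl, e⟩ := exists_gaugeData_eq m h
      rw [e, dV_v]
  | h2 J ih ih' =>
    have h := (jv_kleinGordon m .u).cons_cons J
    rw [gauge, kgExtend_cons_cons, h, map_sub, map_sum, map_smul, smul_sub, Finset.smul_sum,
      smul_comm Complex.I]
    congr 1
    · exact Finset.sum_congr rfl fun i _ => ih' i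
    · exact congrArg _ ih

variable (m)

/-- The section `u_J ↦ gauge J`. -/
noncomputable def gaugeMap : JetSpace m →ₗ[ℂ] JetSpace m :=
  jetLift m (fun | (.u, J) => gauge m J | _ => 0) fun α => by
    cases α with
    | u => exact kleinGordon_kgExtend m _
    | v μ => intro J; simp
    | Phi => intro J; simp
    | ut => intro J; simp

/-- The linear map which sends `Φ_J` to `ũ_J`. -/
noncomputable def antighostMap : JetSpace m →ₗ[ℂ] JetSpace m :=
  jetLift m (fun | (.Phi, J) => jv m (.ut, J) | _ => 0) fun α => by
    cases α with
    | Phi => exact jv_kleinGordon m .ut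
    | v μ => intro J; simp
    | u => intro J; simp
    | ut => intro J; simp

theorem gaugeMap_u (J : Multiset (Fin 4)) : gaugeMap m (jv m (.u, J)) = gauge m J :=
  jetLift_jv _ _ _ _

theorem gaugeMap_ut (J : Multiset (Fin 4)) : gaugeMap m (jv m (.ut, J)) = 0 :=
  jetLift_jv _ _ _ _

theorem gaugeMap_of_even {x : JetSpace m} (hx : x ∈ parityPart m 0) : gaugeMap m x = 0 := by
  suffices h : parityPart m 0 ≤ LinearMap.ker (gaugeMap m) from h hx
  refine Submodule.span_le.2 ?_
  rintro _ ⟨⟨α, J⟩, h, rfl⟩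
  cases α with
  | v μ => exact jetLift_jv _ _ _ _
  | Phi => exact jetLift_jv _ _ _ _
  | u => simp [Fld.parity] at h
  | ut => simp [Fld.parity] at h

theorem antighostMap_jv_of_ne {α : Fld} (J : Multiset (Fin 4)) (h : α ≠ .Phi) :
    antighostMap m (jv m (α, J)) = 0 := by
  cases α with
  | Phi => exact absurd rfl h
  | v μ => exact jetLift_jv _ _ _ _
  | u => exact jetLift_jv _ _ _ _
  | ut => exact jetLift_jv _ _ _ _

theorem antighostMap_Phi (J : Multiset (Fin 4)) :
    antighostMap m (jv m (.Phi, J)) = jv m (.ut, J) :=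
  jetLift_jv _ _ _ _

theorem antighostMap_mem (x : JetSpace m) : antighostMap m x ∈ parityPart m 1 := by
  suffices h : ⊤ ≤ (parityPart m 1).comap (antighostMap m) from h (Submodule.mem_top : x ∈ ⊤)
  rw [← jv_span, Submodule.span_le]
  rintro _ ⟨⟨α, J⟩, rfl⟩
  rw [SetLike.mem_coe, Submodule.mem_comap]
  cases α with
  | Phi => rw [antighostMap_Phi]; exact jv_mem_parityPart m (.ut, J)
  | v μ => rw [antighostMap_jv_of_ne m J (by simp)]; exact Submodule.zero_mem _
  | u => rw [antighostMap_jv_of_ne m J (by simp)]; exact Submodule.zero_mem _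
  | ut => rw [antighostMap_jv_of_ne m J (by simp)]; exact Submodule.zero_mem _

theorem antighostMap_CjetV (J : Multiset (Fin 4)) :
    antighostMap m (CjetV m J) = (m : ℂ) • jv m (.ut, J) := by
  rw [CjetV, map_add, map_sum, map_smul, antighostMap_Phi]
  simp only [map_smul, antighostMap_jv_of_ne m _ (show Fld.v _ ≠ .Phi by simp), smul_zero,
    Finset.sum_const_zero, zero_add]

/-- The values of the contracting homotopy on the adapted generators. -/
noncomputable def homotopyVec : Gen → JetSpace m
  | .C J => Complex.I • jv m (.ut, J)
  | .U J => (-Complex.I) • gauge m J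
  | _ => 0

variable {m}

theorem dV_valV (s : Sym0) : dV m (s.valV m) = 0 := by
  rw [← linearPart_toPoly m (dV m (s.valV m)), toPoly_dV, toPoly_valV, dQ_val, map_zero]

theorem dV_CjetV (J : Multiset (Fin 4)) : dV m (CjetV m J) = 0 := by
  rw [← linearPart_toPoly m (dV m _), toPoly_dV, toPoly_CjetV, dQ_Cjet, map_zero]

/-- The generators satisfy relations, so values on them cannot simply be prescribed; h is assembled
from maps defined on the whole on-shell space. -/
theorem exists_homotopy_linear (hm : m ≠ 0) : ∃ L : JetSpace m →ₗ[ℂ] JetSpace m,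
    IsOdd L ∧ ∀ g : Gen, L (g.vec m) = homotopyVec m g := by
  have hm' : (m : ℂ) ≠ 0 := by exact_mod_cast hm
  obtain ⟨ℓ, hℓ⟩ := LinearMap.exists_leftInverse_of_injective
    ((toFormal m).comp (ofFormal m)).toLinearMap
    (LinearMap.ker_eq_bot.2 (toFormal_ofFormal_injective hm))
  -- P fixes every W and vanishes on C, u and ũ. It exists because the composite through the formal
  -- polynomials is injective and so has a linear left inverse ℓ.
  obtain ⟨P, hP, hPW⟩ : ∃ P : JetSpace m →ₗ[ℂ] JetSpace m,
      (∀ x, toFormal m (toPoly m x) = 0 → P x = 0) ∧ ∀ s : Sym0, P (s.valV m) = s.valV m := by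
    refine ⟨linearPart m ∘ₗ (ofFormal m).toLinearMap ∘ₗ ℓ ∘ₗ (toFormal m).toLinearMap ∘ₗ toPoly m,
      fun x hx => ?_, fun s => ?_⟩
    · simp [hx]
    · have h := LinearMap.congr_fun hℓ s.cls
      simp only [LinearMap.comp_apply, AlgHom.toLinearMap_apply, AlgHom.comp_apply, ofFormal_cls,
        LinearMap.id_apply] at h
      simp only [LinearMap.comp_apply, AlgHom.toLinearMap_apply, toPoly_valV, h, ofFormal_cls]
      rw [← toPoly_valV, linearPart_toPoly]
  have hu : ∀ J, P (jv m (.u, J)) = 0 := fun J => hP _ (by simp [jetImage])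
  have hut : ∀ J, P (jv m (.ut, J)) = 0 := fun J => hP _ (by simp [jetImage])
  -- The rightmost factor kills G, then 1 - P kills W. On C_J, `antighostMap` sees only mΦ_J and
  -- gives mũ_J, which explains the factor i/m. The last term supplies U ↦ -iG.
  refine ⟨(Complex.I * (m : ℂ)⁻¹) • antighostMap m ∘ₗ (LinearMap.id - P) ∘ₗ
    (LinearMap.id + Complex.I • gaugeMap m ∘ₗ dV m) - Complex.I • gaugeMap m, ?_, ?_⟩
  · rintro ⟨α, J⟩
    have key : ∀ x : JetSpace m, (Complex.I * (m : ℂ)⁻¹) • antighostMap m x ∈ parityPart m 1 :=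
      fun x => Submodule.smul_mem _ _ (antighostMap_mem m x)
    cases α with
    | v μ =>
      have h := gaugeMap_of_even m (jv_v_mem m μ J)
      simp only [LinearMap.sub_apply, LinearMap.smul_apply, LinearMap.comp_apply, h, smul_zero,
        sub_zero]
      exact key _
    | Phi =>
      have h := gaugeMap_of_even m (jv_Phi_mem m J)
      simp only [LinearMap.sub_apply, LinearMap.smul_apply, LinearMap.comp_apply, h, smul_zero,
        sub_zero]
      exact key _
    | u =>
      simp only [LinearMap.sub_apply, LinearMap.smul_apply, LinearMap.comp_apply,
        LinearMap.add_apply, LinearMap.id_apply, dV_u, map_zero, smul_zero, add_zero, hu, sub_zero,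
        gaugeMap_u, antighostMap_jv_of_ne m J (show Fld.u ≠ .Phi by simp), zero_sub]
      exact Submodule.neg_mem _ (Submodule.smul_mem _ _ (gauge_mem_parityPart m J))
    | ut =>
      simp only [LinearMap.sub_apply, LinearMap.smul_apply, LinearMap.comp_apply,
        LinearMap.add_apply, LinearMap.id_apply, dV_ut, map_smul,
        gaugeMap_of_even m (CjetV_mem_parityPart m J), smul_zero, add_zero, hut, sub_zero,
        gaugeMap_ut, antighostMap_jv_of_ne m J (show Fld.ut ≠ .Phi by simp)]
      exact Submodule.zero_mem _
  · intro g
    simp only [LinearMap.sub_apply, LinearMap.smul_apply, LinearMap.comp_apply,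
        LinearMap.add_apply, LinearMap.id_apply]
    cases g with
    | W s =>
      simp only [Gen.vec, homotopyVec, dV_valV, map_zero, smul_zero, add_zero, hPW, sub_self,
        gaugeMap_of_even m (valV_mem_parityPart m s)]
    | C J =>
      have h : P (CjetV m J) = 0 := hP _ (by rw [toPoly_CjetV, toFormal_Cjet hm])
      simp only [Gen.vec, homotopyVec, dV_CjetV, map_zero, smul_zero, add_zero, h, sub_zero,
        gaugeMap_of_even m (CjetV_mem_parityPart m J), antighostMap_CjetV]
      rw [smul_smul, mul_assoc, inv_mul_cancel₀ hm', mul_one]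
    | G J =>
      simp only [Gen.vec, homotopyVec, dV_gauge hm, map_smul, gaugeMap_u,
        gaugeMap_of_even m (gauge_mem_parityPart m J), smul_zero, sub_zero]
      rw [smul_smul, Complex.I_mul_I, neg_one_smul, add_neg_cancel, map_zero, sub_zero, map_zero,
        smul_zero]
    | U J =>
      simp only [Gen.vec, homotopyVec, dV_u, map_zero, smul_zero, add_zero, hu, sub_zero,
        gaugeMap_u, antighostMap_jv_of_ne m J (show Fld.u ≠ .Phi by simp), zero_sub, neg_smul]
    | T J =>
      simp only [Gen.vec, homotopyVec, dV_ut, map_smul,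
        gaugeMap_of_even m (CjetV_mem_parityPart m J), smul_zero, add_zero, hut, sub_zero,
        gaugeMap_ut, antighostMap_jv_of_ne m J (show Fld.ut ≠ .Phi by simp)]

theorem dV_homotopyVec_add (hm : m ≠ 0) {L : JetSpace m →ₗ[ℂ] JetSpace m}
    (hL : ∀ g : Gen, L (g.vec m) = homotopyVec m g) (g : Gen) :
    dV m (L (g.vec m)) + L (dV m (g.vec m)) = (g.charge : ℂ) • g.vec m := by
  have hu : ∀ J, L (jv m (.u, J)) = (-Complex.I) • gauge m J := fun J => hL (.U J)
  have hC : ∀ J, L (CjetV m J) = Complex.I • jv m (.ut, J) := fun J => hL (.C J)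
  rw [hL]
  cases g with
  | W s => simp [Gen.vec, homotopyVec, Gen.charge, dV_valV]
  | C J =>
    simp [Gen.vec, homotopyVec, Gen.charge, dV_CjetV, dV_ut, smul_smul]
  | G J =>
    simp [Gen.vec, homotopyVec, Gen.charge, dV_gauge hm, hu, smul_smul]
  | U J =>
    simp [Gen.vec, homotopyVec, Gen.charge, dV_gauge hm, dV_u, smul_smul]
  | T J =>
    simp [Gen.vec, homotopyVec, Gen.charge, dV_ut, hC, smul_smul]

end Homotopy

/-! ## Reduction of cocycles -/

section Reduction

variable {m : ℝ}

/-- The span of the jet variables of dimension `≤ n`. -/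
noncomputable def jetLE (m : ℝ) (n : ℕ) : Submodule ℂ (JetSpace m) :=
  Submodule.span ℂ {x | ∃ a : Jet, a.dim ≤ n ∧ jv m a = x}

theorem jv_mem_jetLE {α : Fld} {J : Multiset (Fin 4)} {n : ℕ} (h : Multiset.card J + 1 ≤ n) :
    jv m (α, J) ∈ jetLE m n :=
  Submodule.subset_span ⟨(α, J), by simp only [Jet.dim]; omega, rfl⟩

theorem toPoly_mem_PolyLE {x : JetSpace m} {n : ℕ} (hx : x ∈ jetLE m n) :
    toPoly m x ∈ PolyLE m n := by
  suffices h : jetLE m n ≤ (PolyLE m n).comap (toPoly m) from h hx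
  refine Submodule.span_le.2 ?_
  rintro _ ⟨a, ha, rfl⟩
  rw [SetLike.mem_coe, Submodule.mem_comap, toPoly_jv]
  exact weightLE_mono (by exact_mod_cast ha) (gen_mem_weightLE a)

/-- G_J involves v with at most card J - 1 derivatives and is thus one dimension lower than u_J,
except that at the empty index it is Φ/m; hence the maximum with 1. -/
theorem gauge_mem_jetLE (J : Multiset (Fin 4)) : ∀ {n : ℕ}, max 1 (Multiset.card J) ≤ n →
    gauge m J ∈ jetLE m n := by
  induction J using time_induction with
  | h1 J hJ =>
    intro n hn
    rw [gauge, kgExtend_of_lt _ _ hJ]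
    by_cases h : J = 0
    · subst h
      rw [gaugeData_zero]
      exact Submodule.smul_mem _ _ (jv_mem_jetLE (by simpa using hn))
    · obtain ⟨μ, L, rfl, e⟩ := exists_gaugeData_eq m h
      rw [e]
      rw [Multiset.card_cons] at hn
      exact jv_mem_jetLE (by omega)
  | h2 J ih ih' =>
    intro n hn
    simp only [Multiset.card_cons] at hn ih'
    rw [gauge, kgExtend_cons_cons]
    exact Submodule.sub_mem _ (Submodule.sum_mem _ fun i _ => ih' i (by omega))
      (Submodule.smul_mem _ _ (ih (by omega)))

theorem vec_mem_jetLE (g : Gen) : g.vec m ∈ jetLE m g.dim := by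
  cases g with
  | W s =>
    cases s with
    | F n I =>
      refine tlProj_mem (T := fieldStrengthV m n) (fun I => ?_) I
      refine Submodule.sub_mem _ (jv_mem_jetLE ?_) (jv_mem_jetLE ?_) <;>
      simp only [Multiset.card_cons, card_idx, Gen.dim, Sym0.dim] <;> omega
    | phi n I =>
      refine tlProj_mem (T := phiTensorV m (n + 1)) (fun I => ?_) I
      refine Submodule.sub_mem _ (jv_mem_jetLE ?_) (Submodule.smul_mem _ _
        (Submodule.smul_mem _ _ (Submodule.sum_mem _ fun l _ => jv_mem_jetLE ?_)))
      · simp only [card_idx, Gen.dim, Sym0.dim]; omega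
      · have := card_map_erase I l
        simp only [Gen.dim, Sym0.dim]; omega
  | C J =>
    refine Submodule.add_mem _ (Submodule.sum_mem _ fun μ _ => Submodule.smul_mem _ _
      (jv_mem_jetLE ?_)) (Submodule.smul_mem _ _ (jv_mem_jetLE ?_))
    · simp only [Multiset.card_cons, Gen.dim]; omega
    · simp only [Gen.dim]; omega
  | G J => exact gauge_mem_jetLE J le_rfl
  | U J => exact jv_mem_jetLE le_rfl
  | T J => exact jv_mem_jetLE le_rfl

/-- The element of `𝒫` denoted by a generator. -/
noncomputable def Gen.val (m : ℝ) (g : Gen) : Poly m := toPoly m (g.vec m)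

/-- Variables and generators are linear combinations of each other without increase of dimension, so
their monomials define the same filtration. -/
theorem PolyLE_eq (hm : m ≠ 0) (n : ℤ) : PolyLE m n = weightLE (Gen.val m) Gen.dim n := by
  refine le_antisymm (weightLE_le_of_gen (fun a => ?_) n)
    (weightLE_le_of_gen (fun g => toPoly_mem_PolyLE (vec_mem_jetLE g)) n)
  have h : genLE m a.dim ≤ (weightLE (Gen.val m) Gen.dim a.dim).comap (toPoly m) := by
    refine Submodule.span_le.2 ?_
    rintro _ ⟨g, hg, rfl⟩
    exact weightLE_mono (by exact_mod_cast hg) (gen_mem_weightLE g)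
  rw [← toPoly_jv]
  exact h (jv_mem_genLE hm _ a.1 a.2 (by simp only [Jet.dim]; omega))

theorem parityAut_mem_PolyLE {p : Poly m} {n : ℤ} (hp : p ∈ PolyLE m n) :
    parityAut m p ∈ PolyLE m n := by
  refine weightLE_le_of_gen (fun a => ?_) n (map_weightLE (parityAut m) hp)
  rw [parityAut_jet]
  exact Submodule.smul_mem _ _ (gen_mem_weightLE a)

theorem Gen.val_mem (g : Gen) : g.val m ∈ PolyLE m g.dim := toPoly_mem_PolyLE (vec_mem_jetLE g)

theorem one_le_dim (g : Gen) : 1 ≤ g.dim := by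
  cases g with
  | W s => cases s <;> simp only [Gen.dim, Sym0.dim] <;> omega
  | C J => simp only [Gen.dim]; omega
  | G J => exact le_max_left _ _
  | U J => simp only [Gen.dim]; omega
  | T J => simp only [Gen.dim]; omega

theorem charge_le_dim (L : List Gen) : (L.map Gen.charge).sum ≤ (L.map Gen.dim).sum := by
  refine List.sum_le_sum fun g _ => le_trans ?_ (one_le_dim g)
  cases g <;> simp [Gen.charge]

/-- A contracting homotopy for the differential on the adapted generators. -/
structure IsHomotopy (h : Poly m →ₗ[ℂ] Poly m) : Prop extends IsOddDerivation h where
  mem : ∀ g : Gen, h (g.val m) ∈ PolyLE m g.dim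
  anticomm : ∀ g : Gen, dQ m (h (g.val m)) + h (dQ m (g.val m)) = (g.charge : ℂ) • g.val m

theorem exists_isHomotopy (hm : m ≠ 0) : ∃ h : Poly m →ₗ[ℂ] Poly m, IsHomotopy h := by
  obtain ⟨L, hL, hg⟩ := exists_homotopy_linear hm
  obtain ⟨h, hh, hL'⟩ := exists_oddDerivation hL
  refine ⟨h, hh, fun g => ?_, fun g => ?_⟩
  · rw [Gen.val, hL', hg]
    refine toPoly_mem_PolyLE ?_
    cases g with
    | C J =>
      refine Submodule.smul_mem _ _ (jv_mem_jetLE ?_)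
      simp only [Gen.dim]; omega
    | U J =>
      refine Submodule.smul_mem _ _ (gauge_mem_jetLE J ?_)
      simp only [Gen.dim]; omega
    | W s => exact Submodule.zero_mem _
    | G J => exact Submodule.zero_mem _
    | T J => exact Submodule.zero_mem _
  · rw [Gen.val, hL', ← toPoly_dV, ← toPoly_dV, hL', ← map_add, dV_homotopyVec_add hm hg, map_smul]

variable {h : Poly m →ₗ[ℂ] Poly m}

theorem IsHomotopy.mem_PolyLE (hm : m ≠ 0) (hh : IsHomotopy h) {p : Poly m} {n : ℤ}
    (hp : p ∈ PolyLE m n) : h p ∈ PolyLE m n := by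
  have key : ∀ L : List Gen, (L.map (Gen.val m)).prod ∈ PolyLE m ((L.map Gen.dim).sum : ℕ) ∧
      h (L.map (Gen.val m)).prod ∈ PolyLE m ((L.map Gen.dim).sum : ℕ) := by
    intro L
    induction L with
    | nil =>
      refine ⟨by simpa [PolyLE] using one_mem_weightLE (gen := jet m) (w := Jet.dim), ?_⟩
      simp [hh.map_one]
    | cons g L ih =>
      simp only [List.map_cons, List.prod_cons, List.sum_cons, Nat.cast_add, hh.mul]
      exact ⟨mul_mem_weightLE g.val_mem ih.1, Submodule.add_mem _
        (mul_mem_weightLE (hh.mem g) ih.1)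
        (mul_mem_weightLE (parityAut_mem_PolyLE g.val_mem) ih.2)⟩
  rw [PolyLE_eq hm] at hp
  suffices h' : weightLE (Gen.val m) Gen.dim n ≤ (PolyLE m n).comap h from h' hp
  refine Submodule.span_le.2 ?_
  rintro _ ⟨L, hL, rfl⟩
  exact weightLE_mono hL (key L).2

/-- The anticommutator of the differential and the homotopy. -/
noncomputable def countOp (h : Poly m →ₗ[ℂ] Poly m) : Poly m →ₗ[ℂ] Poly m :=
  dQ m ∘ₗ h + h ∘ₗ dQ m

theorem countOp_apply (p : Poly m) : countOp h p = dQ m (h p) + h (dQ m p) := rfl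

/-- The anticommutator is an even derivation, so its eigenvalues on generators add up along a
product. -/
theorem IsHomotopy.countOp_prod (hh : IsHomotopy h) (L : List Gen) :
    countOp h (L.map (Gen.val m)).prod =
      (((L.map Gen.charge).sum : ℕ) : ℂ) • (L.map (Gen.val m)).prod := by
  induction L with
  | nil => simp [countOp_apply, hh.map_one, (isOddDerivation_dQ m).map_one]
  | cons g L ih =>
    rw [countOp_apply] at ih
    simp only [List.map_cons, List.prod_cons, List.sum_cons, Nat.cast_add]
    rw [countOp_apply, (isOddDerivation_dQ m).anticomm_mul hh.toIsOddDerivation, ih, hh.anticomm,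
      smul_mul_assoc, mul_smul_comm, add_smul]

/-- The product of the operators `1 - D / j` for `j = 1, …, N`. -/
noncomputable def chargeProj (D : Poly m →ₗ[ℂ] Poly m) : ℕ → Poly m →ₗ[ℂ] Poly m
  | 0 => LinearMap.id
  | N + 1 => (LinearMap.id - ((N : ℂ) + 1)⁻¹ • D) ∘ₗ chargeProj D N

theorem chargeProj_succ (D : Poly m →ₗ[ℂ] Poly m) (N : ℕ) (p : Poly m) :
    chargeProj D (N + 1) p = chargeProj D N p - ((N : ℂ) + 1)⁻¹ • D (chargeProj D N p) := rfl

/-- On the eigenvalue c the operator is the product of the 1 - c/j over 1 ≤ j ≤ N, which is 1 for c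
= 0 and has a zero factor for 1 ≤ c ≤ N. -/
theorem chargeProj_of_eigen {D : Poly m →ₗ[ℂ] Poly m} {x : Poly m} {c : ℕ}
    (hx : D x = (c : ℂ) • x) (N : ℕ) :
    ∃ a : ℂ, chargeProj D N x = a • x ∧ (c = 0 → a = 1) ∧ (1 ≤ c → c ≤ N → a = 0) := by
  induction N with
  | zero => exact ⟨1, by simp [chargeProj], fun _ => rfl, fun h h' => by omega⟩
  | succ N ih =>
    obtain ⟨a, ha, h0, h1⟩ := ih
    refine ⟨a * (1 - ((N : ℂ) + 1)⁻¹ * c), ?_, fun hc => ?_, fun hc hc' => ?_⟩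
    · rw [chargeProj_succ, ha, map_smul, hx, smul_smul, smul_smul, ← sub_smul]
      congr 1
      ring
    · rw [h0 hc, hc]; simp
    · rcases Nat.lt_succ_iff_lt_or_eq.1 (Nat.lt_succ_of_le hc') with h2 | h2
      · rw [h1 hc (by omega), zero_mul]
      · have : (N : ℂ) + 1 ≠ 0 := by exact_mod_cast Nat.succ_ne_zero N
        rw [h2]
        push_cast
        rw [inv_mul_cancel₀ this, sub_self, mul_zero]

theorem IsHomotopy.chargeProj_mem (hm : m ≠ 0) (hh : IsHomotopy h) {p : Poly m} {n : ℤ}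
    (hp : p ∈ PolyLE m n) (N : ℕ) : chargeProj (countOp h) N p ∈ PolyLE m n := by
  rw [PolyLE_eq hm] at hp ⊢
  suffices h' : weightLE (Gen.val m) Gen.dim n ≤
      (weightLE (Gen.val m) Gen.dim n).comap (chargeProj (countOp h) N) from h' hp
  refine Submodule.span_le.2 ?_
  rintro _ ⟨L, hL, rfl⟩
  obtain ⟨a, ha, -, -⟩ := chargeProj_of_eigen (hh.countOp_prod L) N
  rw [SetLike.mem_coe, Submodule.mem_comap, ha]
  exact Submodule.smul_mem _ _ (Submodule.subset_span ⟨L, hL, rfl⟩)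

theorem exists_symbols_of_charge_eq_zero (L : List Gen) (hL : (L.map Gen.charge).sum = 0) :
    ∃ L' : List Sym0, (L'.map Sym0.dim).sum = (L.map Gen.dim).sum ∧
      ofFormal m (L'.map Sym0.cls).prod = (L.map (Gen.val m)).prod := by
  induction L with
  | nil => exact ⟨[], by simp⟩
  | cons g L ih =>
    simp only [List.map_cons, List.sum_cons, Nat.add_eq_zero_iff] at hL
    obtain ⟨L', h1, h2⟩ := ih hL.2
    cases g with
    | W s =>
      refine ⟨s :: L', ?_, ?_⟩
      · simp only [List.map_cons, List.sum_cons, h1]; rfl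
      · simp only [List.map_cons, List.prod_cons, map_mul, h2, ofFormal_cls, ← toPoly_valV]; rfl
    | C J => exact absurd hL.1 one_ne_zero
    | G J => exact absurd hL.1 one_ne_zero
    | U J => exact absurd hL.1 one_ne_zero
    | T J => exact absurd hL.1 one_ne_zero

/-- Each generator has dimension at least 1, so charges in 𝒫⁽ⁿ⁾ are at most n and n factors kill all
positive ones. Charge zero leaves products of symbols of the same dimension. -/
theorem IsHomotopy.chargeProj_mem_map (hm : m ≠ 0) (hh : IsHomotopy h) {p : Poly m} {n : ℕ}
    (hp : p ∈ PolyLE m n) :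
    chargeProj (countOp h) n p ∈ (FormalP0LE n).map (ofFormal m).toLinearMap := by
  rw [PolyLE_eq hm] at hp
  suffices h' : weightLE (Gen.val m) Gen.dim n ≤
      ((FormalP0LE n).map (ofFormal m).toLinearMap).comap (chargeProj (countOp h) n) from h' hp
  refine Submodule.span_le.2 ?_
  rintro _ ⟨L, hL, rfl⟩
  obtain ⟨a, ha, -, ha1⟩ := chargeProj_of_eigen (hh.countOp_prod L) n
  rw [SetLike.mem_coe, Submodule.mem_comap, ha]
  by_cases hc : (L.map Gen.charge).sum = 0
  · obtain ⟨L', h1, h2⟩ := exists_symbols_of_charge_eq_zero (m := m) L hc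
    rw [← h2]
    exact Submodule.smul_mem _ _ ⟨_, Submodule.subset_span ⟨L', by rw [h1]; exact hL, rfl⟩, rfl⟩
  · have h3 := charge_le_dim L
    rw [ha1 (by omega) (by omega), zero_smul]
    exact Submodule.zero_mem _

/-- On a cocycle D is d_Q h, so each factor 1 - D/j subtracts d_Q of an element of 𝒫⁽ⁿ⁾ and leaves a
cocycle. -/
theorem IsHomotopy.chargeProj_cocycle (hm : m ≠ 0) (hh : IsHomotopy h) {p : Poly m} {n : ℤ}
    (hp : p ∈ PolyLE m n) (hd : dQ m p = 0) (N : ℕ) :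
    ∃ y ∈ PolyLE m n, chargeProj (countOp h) N p = p - dQ m y := by
  induction N with
  | zero => exact ⟨0, Submodule.zero_mem _, by simp [chargeProj]⟩
  | succ N ih =>
    obtain ⟨y, hy, e⟩ := ih
    have h1 : dQ m (chargeProj (countOp h) N p) = 0 := by rw [e, map_sub, hd, dQ_dQ, sub_zero]
    refine ⟨y + ((N : ℂ) + 1)⁻¹ • h (chargeProj (countOp h) N p), Submodule.add_mem _ hy
      (Submodule.smul_mem _ _ (hh.mem_PolyLE hm (hh.chargeProj_mem hm hp N))), ?_⟩
    rw [chargeProj_succ, countOp_apply, h1, map_zero, add_zero, map_add, map_smul, ← sub_sub, ← e]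

/-- Every cocycle is the sum of a primary cocycle and a coboundary, without increase of the
dimension. -/
theorem exists_eq_ofFormal_add_dQ (hm : m ≠ 0) {p : Poly m} {n : ℕ} (hp : p ∈ PolyLE m n)
    (hd : dQ m p = 0) : ∃ a ∈ FormalP0LE n, ∃ y ∈ PolyLE m n, p = ofFormal m a + dQ m y := by
  obtain ⟨h, hh⟩ := exists_isHomotopy hm
  obtain ⟨y, hy, e⟩ := hh.chargeProj_cocycle hm hp hd n
  obtain ⟨a, ha, e'⟩ := hh.chargeProj_mem_map hm hp
  refine ⟨a, ha, y, hy, ?_⟩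
  rw [AlgHom.toLinearMap_apply] at e'
  rw [e', e, sub_add_cancel]

theorem adjoin_jet : Algebra.adjoin ℂ (Set.range (jet m)) = ⊤ := by
  rw [eq_top_iff]
  rintro p -
  induction p using poly_induction m with
  | h1 c => exact Subalgebra.algebraMap_mem _ c
  | hj a => exact Algebra.subset_adjoin ⟨a, rfl⟩
  | hm p q hp hq => exact Subalgebra.mul_mem _ hp hq
  | ha p q hp hq => exact Subalgebra.add_mem _ hp hq

theorem ofFormal_mem_PolyLE {a : FormalP0} {n : ℤ} (ha : a ∈ FormalP0LE n) :
    ofFormal m a ∈ PolyLE m n := by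
  refine weightLE_le_of_gen (fun s => ?_) n (map_weightLE (ofFormal m) ha)
  rw [ofFormal_cls, ← toPoly_valV]
  exact Gen.val_mem (.W s)

end Reduction

/-! ## The cohomology spaces -/

theorem exists_equiv_HQ {m : ℝ} (hm : m ≠ 0) :
    ∃ e : FormalP0 ≃ₗ[ℂ] HQ m, ∀ a : FormalP0, ∃ h : ofFormal m a ∈ ZQ m,
      e a = Submodule.Quotient.mk ⟨ofFormal m a, h⟩ := by
  have hz : ∀ a, (ofFormal m).toLinearMap a ∈ ZQ m := fun a => dQ_ofFormal m a
  let f : FormalP0 →ₗ[ℂ] HQ m :=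
    ((BQ m).submoduleOf (ZQ m)).mkQ ∘ₗ (ofFormal m).toLinearMap.codRestrict (ZQ m) hz
  refine ⟨LinearEquiv.ofBijective f ⟨?_, ?_⟩, fun a => ⟨hz a, rfl⟩⟩
  · rw [← LinearMap.ker_eq_bot, LinearMap.ker_eq_bot']
    intro a ha
    obtain ⟨q, hq⟩ := (Submodule.Quotient.mk_eq_zero _).1 ha
    exact eq_zero_of_ofFormal_eq_dQ hm hq.symm
  · intro x
    obtain ⟨⟨p, hp⟩, rfl⟩ := Submodule.Quotient.mk_surjective _ x
    obtain ⟨n, hn⟩ := exists_mem_weightLE (w := Jet.dim) adjoin_jet p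
    obtain ⟨a, -, y, -, e⟩ := exists_eq_ofFormal_add_dQ hm hn hp
    refine ⟨a, (Submodule.Quotient.eq _).2 ⟨-y, ?_⟩⟩
    rw [map_neg]
    change _ = ofFormal m a - p
    rw [e]
    abel

theorem SQLE_le_ZQLE (m : ℝ) (n : ℤ) : SQLE m n ≤ ZQLE m n := by
  rintro _ ⟨hp, ⟨q, -, rfl⟩⟩
  exact ⟨dQ_dQ m q, hp⟩

theorem exists_equiv_HQLE {m : ℝ} (hm : m ≠ 0) (n : ℕ) :
    ∃ e : (FormalP0LE n × (SQLE m n ⧸ (BQLE m n).submoduleOf (SQLE m n))) ≃ₗ[ℂ] HQLE m n,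
      ∀ (a : FormalP0LE n) (s : SQLE m n),
        ∃ h : ofFormal m (a : FormalP0) + (s : Poly m) ∈ ZQLE m n,
          e (a, Submodule.Quotient.mk s) = Submodule.Quotient.mk ⟨_, h⟩ := by
  have hz : ∀ a : FormalP0LE n, ((ofFormal m).toLinearMap ∘ₗ (FormalP0LE n).subtype) a ∈ ZQLE m n :=
    fun a => ⟨dQ_ofFormal m a, ofFormal_mem_PolyLE a.2⟩
  let f₁ : FormalP0LE n →ₗ[ℂ] HQLE m n := ((BQLE m n).submoduleOf (ZQLE m n)).mkQ ∘ₗ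
    ((ofFormal m).toLinearMap ∘ₗ (FormalP0LE n).subtype).codRestrict (ZQLE m n) hz
  let f₂ : (SQLE m n ⧸ (BQLE m n).submoduleOf (SQLE m n)) →ₗ[ℂ] HQLE m n :=
    ((BQLE m n).submoduleOf (SQLE m n)).mapQ ((BQLE m n).submoduleOf (ZQLE m n))
      (Submodule.inclusion (SQLE_le_ZQLE m n)) fun _ hx => hx
  have hf : ∀ (a : FormalP0LE n) (s : SQLE m n),
      ∃ h : ofFormal m (a : FormalP0) + (s : Poly m) ∈ ZQLE m n,
        f₁.coprod f₂ (a, Submodule.Quotient.mk s) = Submodule.Quotient.mk ⟨_, h⟩ := fun a s =>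
    ⟨Submodule.add_mem _ (hz a) (SQLE_le_ZQLE m n s.2), rfl⟩
  refine ⟨LinearEquiv.ofBijective (f₁.coprod f₂) ⟨?_, ?_⟩, hf⟩
  · rw [← LinearMap.ker_eq_bot, LinearMap.ker_eq_bot']
    rintro ⟨a, x⟩ hx
    obtain ⟨s, rfl⟩ := Submodule.Quotient.mk_surjective _ x
    obtain ⟨h, e⟩ := hf a s
    rw [e] at hx
    have hb := (Submodule.Quotient.mk_eq_zero _).1 hx
    obtain ⟨q, hq, hqe⟩ := hb
    change dQ m q = ofFormal m a + s at hqe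
    obtain ⟨-, ⟨r, -, hr⟩⟩ := s.2
    -- As s is itself a coboundary, Ψ(a) is one too and a = 0; only then does q become a primitive
    -- of s of dimension at most n - 1.
    have ha : (a : FormalP0) = 0 := eq_zero_of_ofFormal_eq_dQ hm (q := q - r) (by
      rw [map_sub, hqe, hr, add_sub_cancel_right])
    have ha' : a = 0 := Subtype.ext ha
    subst ha'
    rw [Prod.mk_eq_zero]
    refine ⟨rfl, (Submodule.Quotient.mk_eq_zero _).2 ⟨q, hq, ?_⟩⟩
    rw [hqe]
    simp
  · intro x
    obtain ⟨⟨p, hp⟩, rfl⟩ := Submodule.Quotient.mk_surjective _ x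
    obtain ⟨a, ha, y, hy, e⟩ := exists_eq_ofFormal_add_dQ hm hp.2 hp.1
    -- d_Q y has dimension at most n although d_Q may raise the dimension of y, because it is the
    -- difference of p and Ψ(a).
    have hs : dQ m y ∈ SQLE m n := by
      refine ⟨?_, y, hy, rfl⟩
      rw [eq_sub_of_add_eq' e.symm]
      exact Submodule.sub_mem _ hp.2 (ofFormal_mem_PolyLE ha)
    obtain ⟨h, e'⟩ := hf ⟨a, ha⟩ ⟨_, hs⟩
    refine ⟨_, e'.trans ?_⟩
    congr 1
    exact Subtype.ext e.symm

end MassiveGauge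

/-! ### The theorem -/

theorem mainTheorem4 (m : ℝ) (hm : 0 < m) :
    -- the traceless parts `F⁽⁰⁾` and `φ⁽⁰⁾` exist and are unique
    (∀ n : ℕ, ∃! T₀, MassiveGauge.IsTracelessPart (MassiveGauge.fieldStrength m n) T₀) ∧
    (∀ n : ℕ, ∃! T₀, MassiveGauge.IsTracelessPart (MassiveGauge.phiTensor m (n + 1)) T₀) ∧
    -- every cocycle is cohomologous to an element of `𝒫₀`
    (∀ p ∈ MassiveGauge.ZQ m, ∃ p₀ ∈ MassiveGauge.P0 m, ∃ q : MassiveGauge.Poly m,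
      p = p₀ + MassiveGauge.dQ m q) ∧
    -- the relations in `𝒫₀` are the Bianchi identities, and the quotient is the cohomology
    ∃ Ψ : MassiveGauge.FormalP0 →ₐ[ℂ] MassiveGauge.Poly m,
      (∀ s : MassiveGauge.Sym0, Ψ s.cls = s.val m) ∧
      Function.Injective Ψ ∧
      Ψ.range = MassiveGauge.P0 m ∧
      (∃ e : MassiveGauge.FormalP0 ≃ₗ[ℂ] MassiveGauge.HQ m,
        ∀ a : MassiveGauge.FormalP0, ∃ h : Ψ a ∈ MassiveGauge.ZQ m,
          e a = Submodule.Quotient.mk ⟨Ψ a, h⟩) ∧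
      -- the version filtered by the canonical dimension
      ∀ n : ℕ,
        (∀ p ∈ MassiveGauge.ZQLE m n, ∃ p₁ ∈ MassiveGauge.P0 m, ∃ p₂ ∈ MassiveGauge.PolyLE m n,
          p₁ ∈ MassiveGauge.PolyLE m n ∧ p = p₁ + MassiveGauge.dQ m p₂) ∧
        ∃ e : (MassiveGauge.FormalP0LE n ×
            (MassiveGauge.SQLE m n ⧸ (MassiveGauge.BQLE m n).submoduleOf (MassiveGauge.SQLE m n)))
            ≃ₗ[ℂ] MassiveGauge.HQLE m n,
          ∀ (a : MassiveGauge.FormalP0LE n) (s : MassiveGauge.SQLE m n),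
            ∃ h : Ψ (a : MassiveGauge.FormalP0) + (s : MassiveGauge.Poly m) ∈ MassiveGauge.ZQLE m n,
              e (a, Submodule.Quotient.mk s) = Submodule.Quotient.mk ⟨_, h⟩ := by
  have hm' : m ≠ 0 := hm.ne'
  have hP0 : ∀ a, MassiveGauge.ofFormal m a ∈ MassiveGauge.P0 m := fun a => by
    rw [← MassiveGauge.ofFormal_range]
    exact ⟨a, rfl⟩
  refine ⟨fun n => MassiveGauge.existsUnique_isTracelessPart _,
    fun n => MassiveGauge.existsUnique_isTracelessPart _, fun p hp => ?_, MassiveGauge.ofFormal m,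
    MassiveGauge.ofFormal_cls m, ?_, MassiveGauge.ofFormal_range m,
    MassiveGauge.exists_equiv_HQ hm', fun n => ⟨fun p hp => ?_,
    MassiveGauge.exists_equiv_HQLE hm' n⟩⟩
  · obtain ⟨n, hn⟩ := MassiveGauge.exists_mem_weightLE (w := MassiveGauge.Jet.dim)
      MassiveGauge.adjoin_jet p
    obtain ⟨a, -, y, -, e⟩ := MassiveGauge.exists_eq_ofFormal_add_dQ hm' hn hp
    exact ⟨_, hP0 a, y, e⟩
  · exact Function.Injective.of_comp (f := MassiveGauge.toFormal m)
      (MassiveGauge.toFormal_ofFormal_injective hm')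
  · obtain ⟨a, ha, y, hy, e⟩ := MassiveGauge.exists_eq_ofFormal_add_dQ hm' hp.2 hp.1
    exact ⟨_, hP0 a, y, hy, MassiveGauge.ofFormal_mem_PolyLE ha, e⟩
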